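/- Let $d\in\mathbb N$, $r,s\in(0,\infty)^d$. Given $\lambda\in(0,\infty)^d$, let $x_i\sim\mathrm{Po}(r_i\lambda_i)$ and $y_i\sim\mathrm{Po}(s_i\lambda_i)$ $(i=1,\dots,d)$ be independent, with probability mass functions $p(x\mid\lambda)$, $p(y\mid\lambda)$. A predictive distribution $q$ assigns to each $x\in\mathbb N^d$ a probability distribution $q(\cdot\mid x)$ on $\mathbb N^d$; its Kullback--Leibler risk at $\lambda$ is $$R(\lambda,q)=\sum_x p(x\mid\lambda)\sum_y p(y\mid\lambda)\log\frac{p(y\mid\lambda)}{q(y\mid x)}\in[0,\infty].$$ We say that $q$ dominates $q'$ if $R(\lambda,q)\le R(\lambda,q')$ for all $\lambda\in(0,\infty)^d$, with strict inequality for some $\lambda$. For a (possibly improper) prior $\pi$ on $(0,\infty)^d$ the Bayesian predictive distribution is $$p_\pi(y\mid x)=\frac{\int p(x\mid\lambda)p(y\mid\lambda)\,\pi(d\lambda)}{\int p(x\mid\lambda)\,\pi(d\lambda)}.$$ Let $p_{\mathrm J}$ be the one based on the Jeffreys prior $\pi_{\mathrm J}(\lambda)\propto\prod_i\lambda_i^{-1/2}$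 and $p_{f,\mathrm J}$ the one based on $\pi_{f,\mathrm J}(\lambda)\propto f(\theta)\prod_i\lambda_i^{-1/2}$, where $$\theta_i=\sqrt{\lambda_i/\gamma_i},\qquad \gamma_i=\frac1{r_i}-\frac1{r_i+s_i},$$ or, if $r_1=\dots=r_d$ and $s_1=\dots=s_d$ (same duration), also with $\theta_i=\sqrt{\lambda_i}$ instead. Let $\eta\in\mathbb R^d$, $0<\alpha\le (d-2)/2$ and $$f(\theta)=\sum_{a\in\{1,-1\}^d}\Bigl(\sum_{i=1}^d(a_i\theta_i-\eta_i)^2\Bigr)^{-\alpha}.$$ Then, for the same or different durations, $p_{\mathrm J}$ and $p_{f,\mathrm J}$ are well-defined predictive distributions, $p_{f,\mathrm J}$ dominates $p_{\mathrm J}$, and $p_{f,\mathrm J}$ is nearly minimax: for every $\lambda\in(0,\infty)^d$, $$R(\lambda,p_{f,\mathrm J})<1.04\cdot B,\qquad B=\frac12\sum_{i=1}^d\log\frac{r_i+s_i}{r_i},$$ where $B$ is a lower bound for the minimax risk, i.e. $B\le\inf_q\sup_{\lambda}R(\lambda,q)$, the infimum being over all predictive distributions $q$. -/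

import Mathlib

open MeasureTheory
open scoped ENNReal

namespace PoissonPrediction

noncomputable section

/-- Joint law on `ℕ^d` of independent Poisson variables with means `c i * lam i`
(`c` is the vector of durations, `lam` the vector of intensities). -/
def poissonLaw {d : ℕ} (c lam : Fin d → ℝ) : Measure (Fin d → ℕ) :=
  Measure.pi fun i => ProbabilityTheory.poissonMeasure (c i * lam i).toNNReal

instance {d : ℕ} (c lam : Fin d → ℝ) : IsProbabilityMeasure (poissonLaw c lam) := by
  unfold poissonLaw; infer_instance

/-- The probability mass function of `poissonLaw`, in its usual form. -/
theorem poissonLaw_singleton {d : ℕ} (c lam : Fin d → ℝ) (h : ∀ i, 0 ≤ c i * lam i)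
    (x : Fin d → ℕ) :
    poissonLaw c lam {x} = ENNReal.ofReal
      (∏ i, (c i * lam i) ^ x i / (x i).factorial * Real.exp (-(c i * lam i))) := by
  rw [poissonLaw, Measure.pi_singleton, ENNReal.ofReal_prod_of_nonneg]
  · refine Finset.prod_congr rfl fun i _ => ?_
    rw [ProbabilityTheory.poissonMeasure_singleton, Real.coe_toNNReal _ (h i)]
    congr 1
    ring
  · intro i _
    have := h i
    positivity

/-- The Bayesian predictive distribution based on the (possibly improper) prior `prior`:
`p(y ∣ x) = ∫ p(x ∣ lam) p(y ∣ lam) prior(d lam) / ∫ p(x ∣ lam) prior(d lam)`. -/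
def bayesPredictive {d : ℕ} (r s : Fin d → ℝ) (prior : Measure (Fin d → ℝ))
    (x : Fin d → ℕ) : Measure (Fin d → ℕ) :=
  Measure.count.withDensity fun y =>
    (∫⁻ lam, poissonLaw r lam {x} * poissonLaw s lam {y} ∂prior) /
      ∫⁻ lam, poissonLaw r lam {x} ∂prior

/-- A predictive distribution assigns to every observation `x` a probability distribution
for `y`. For `bayesPredictive` this says that the posterior is proper, i.e. that
`0 < ∫ p(x ∣ lam) prior(d lam) < ∞` for every `x`. -/
def IsPredictive {d : ℕ} (q : (Fin d → ℕ) → Measure (Fin d → ℕ)) : Prop :=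
  ∀ x, IsProbabilityMeasure (q x)

/-- The Kullback--Leibler risk: the expectation over `x ∼ p(· ∣ lam)` of the Kullback--Leibler
divergence from `p(y ∣ lam)` to `q(y ∣ x)`; it may be `∞`. -/
def klRisk {d : ℕ} (r s : Fin d → ℝ) (q : (Fin d → ℕ) → Measure (Fin d → ℕ))
    (lam : Fin d → ℝ) : ℝ≥0∞ :=
  ∫⁻ x, InformationTheory.klDiv (poissonLaw s lam) (q x) ∂(poissonLaw r lam)

/-- `q` dominates `q'` under Kullback--Leibler risk: never worse, and somewhere better. -/
def Dominates {d : ℕ} (r s : Fin d → ℝ) (q q' : (Fin d → ℕ) → Measure (Fin d → ℕ)) : Prop :=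
  (∀ lam : Fin d → ℝ, (∀ i, 0 < lam i) → klRisk r s q lam ≤ klRisk r s q' lam) ∧
    ∃ lam : Fin d → ℝ, (∀ i, 0 < lam i) ∧ klRisk r s q lam < klRisk r s q' lam

/-- The minimax risk: infimum over all predictive distributions of the maximal risk. -/
def minimaxRisk {d : ℕ} (r s : Fin d → ℝ) : ℝ≥0∞ :=
  ⨅ (q : (Fin d → ℕ) → Measure (Fin d → ℕ)) (_ : IsPredictive q),
    ⨆ (lam : Fin d → ℝ) (_ : ∀ i, 0 < lam i), klRisk r s q lam

/-- The number `(1/2) ∑ i, log ((r i + s i) / r i)`. -/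
def minimaxLowerBound {d : ℕ} (r s : Fin d → ℝ) : ℝ :=
  (1 / 2) * ∑ i, Real.log ((r i + s i) / r i)

/-- Nearly minimax: the risk is everywhere less than `1.04` times the minimax lower bound. -/
def NearlyMinimax {d : ℕ} (r s : Fin d → ℝ) (q : (Fin d → ℕ) → Measure (Fin d → ℕ)) : Prop :=
  ∀ lam : Fin d → ℝ, (∀ i, 0 < lam i) →
    klRisk r s q lam < ENNReal.ofReal (1.04 * minimaxLowerBound r s)

/-- The Jeffreys prior `∏ i, (lam i)^(-1/2) d lam` on the positive orthant. -/
def jeffreysPrior (d : ℕ) : Measure (Fin d → ℝ) :=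
  (volume.restrict {lam : Fin d → ℝ | ∀ i, 0 < lam i}).withDensity
    fun lam => ENNReal.ofReal (∏ i, lam i ^ (-(1 / 2) : ℝ))

/-- The prior with density `f(θ)` relative to the Jeffreys prior, where
`θ i = √(lam i / γ i)`. -/
def priorOf {d : ℕ} (γ : Fin d → ℝ) (f : (Fin d → ℝ) → ℝ≥0∞) : Measure (Fin d → ℝ) :=
  (jeffreysPrior d).withDensity fun lam => f fun i => Real.sqrt (lam i / γ i)

/-- The scale vector `1 / r i - 1 / (r i + s i)`. -/
def durationScale {d : ℕ} (r s : Fin d → ℝ) : Fin d → ℝ :=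
  fun i => 1 / r i - 1 / (r i + s i)

/-- `f(θ) = ∑_{a ∈ {1,-1}^d} (∑ i, (a i * θ i - η i)^2)^(-α)`, with value `∞` where
some base vanishes. -/
def pointShrinkage {d : ℕ} (η : Fin d → ℝ) (α : ℝ) (θ : Fin d → ℝ) : ℝ≥0∞ :=
  ∑ a : Fin d → ℤˣ, (ENNReal.ofReal (∑ i, (((a i : ℤ) : ℝ) * θ i - η i) ^ 2)) ^ (-α)

end

end PoissonPrediction

open PoissonPrediction

/-! Domination. For two priors A and B, the inequality log t ≤ t - 1 bounds the risk of B minus the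
risk of A by E[p_A(y|x) / p_B(y|x)] - 1 (`klRisk_add_two_le`). Since x + y is sufficient, p_π(y|x)
is a λ-free binomial weight times m_{r+s}(x+y) / m_r(x), with m the marginal mass function of the
prior. Conditionally on z = x + y the expected ratio is therefore free of λ, and it suffices that
the binomial average of m^B_r / m^A_r over the splittings of z be smaller than m^B_{r+s}(z) /
m^A_{r+s}(z) (`klRisk_lt_of_marginal_ratio`).

In the coordinates λ = γθ² the Jeffreys prior becomes a multiple of Lebesgue measure on the whole of
ℝ^d, and f becomes a sum of Riesz kernels |θ - aη|^(-2α). The binomial average of the normalized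
likelihoods p_r(x|γθ²) / m^J_r(x) is the Gaussian convolution of p_{r+s}(z|γφ²) / m^J_{r+s}(z)
(`lintegral_gaussKernel_mul_poissonWeight`); γ is the scale that makes this Gaussian isotropic.
Moving the symmetric kernel onto the Riesz kernel, which is superharmonic for α ≤ (d-2)/2, decreases
the integral strictly (`lintegral_rieszKernel_gauss_lt`).

Near minimaxity. The Jeffreys risk is exactly the sum over i of ½ log((r+s)/r) + D((r+s)λ) - D(rλ),
with D = `entropyDefect` and D'(μ) = log μ - E log(z + ½) for z Poisson of mean μ
(`klRisk_jeffreys`). A numerical estimate gives D'(μ) < 0.02/μ (`logBias_gt`), so the risk is below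
(½ + 0.02) ∑ log((r+s)/r) = 1.04 B, and by domination so is the other risk.

Lower bound. The maximal risk of any q is at least the Bayes risk under independent gamma priors of
shape ½ and rate b. Gibbs' inequality in dual form compares q with the Bayes predictive distribution
of that prior, whose expected log-ratio is explicit. The estimate D'(μ) > -exp(-μ)/μ controls the
error, which vanishes as b → 0 (`minimaxLowerBound_le_of_gammaPrior`). -/

/-! ### Calculus of Poisson expectations -/

/-- `∑ k, μ^k / k! * g k`, the unnormalized Poisson expectation of `g`. -/
noncomputable def expSeries (g : ℕ → ℝ) (μ : ℝ) : ℝ := ∑' k : ℕ, μ ^ k / k.factorial * g k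

/-- Growth at most geometric with ratio two. -/
def Tame (g : ℕ → ℝ) : Prop := ∃ C, ∀ k, |g k| ≤ C * 2 ^ k

theorem Tame.succ {g : ℕ → ℝ} (hg : Tame g) : Tame fun k => g (k + 1) := by
  obtain ⟨C, hC⟩ := hg
  refine ⟨2 * C, fun k => (hC (k + 1)).trans (le_of_eq ?_)⟩
  ring

theorem Tame.sub {g h : ℕ → ℝ} (hg : Tame g) (hh : Tame h) : Tame fun k => g k - h k := by
  obtain ⟨C, hC⟩ := hg
  obtain ⟨D, hD⟩ := hh
  refine ⟨C + D, fun k => (abs_sub _ _).trans ?_⟩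
  have := hC k
  have := hD k
  linarith

theorem Tame.add {g h : ℕ → ℝ} (hg : Tame g) (hh : Tame h) : Tame fun k => g k + h k := by
  obtain ⟨C, hC⟩ := hg
  obtain ⟨D, hD⟩ := hh
  refine ⟨C + D, fun k => (abs_add_le _ _).trans ?_⟩
  have := hC k
  have := hD k
  linarith

theorem Tame.const_mul {g : ℕ → ℝ} (hg : Tame g) (c : ℝ) : Tame fun k => c * g k := by
  obtain ⟨C, hC⟩ := hg
  refine ⟨|c| * C, fun k => ?_⟩
  rw [abs_mul, mul_assoc]
  exact mul_le_mul_of_nonneg_left (hC k) (abs_nonneg c)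

theorem tame_const (c : ℝ) : Tame fun _ => c :=
  ⟨|c|, fun k => le_mul_of_one_le_right (abs_nonneg c) (one_le_pow₀ (by norm_num))⟩

theorem tame_of_le_quadratic {g : ℕ → ℝ} (C : ℝ) (hC : 0 ≤ C)
    (h : ∀ k, |g k| ≤ C * ((k : ℝ) + 1) ^ 2) : Tame g := by
  refine ⟨4 * C, fun k => (h k).trans ?_⟩
  have key : ((k : ℝ) + 1) ^ 2 ≤ 4 * 2 ^ k := by
    have h1 : ∀ n : ℕ, (n + 1) ^ 2 ≤ 4 * 2 ^ n := by
      intro n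
      induction n using Nat.strong_induction_on with
      | _ n ih =>
        rcases n with _ | _ | _ | n
        · norm_num
        · norm_num
        · norm_num
        · have := ih (n + 2) (by omega)
          have e : 2 ^ (n + 1 + 1 + 1) = 2 * 2 ^ (n + 2) := by ring
          rw [e]
          generalize 2 ^ (n + 2) = w at *
          nlinarith [Nat.zero_le n, Nat.zero_le (n ^ 2)]
    exact_mod_cast h1 k
  nlinarith

theorem Tame.summable {g : ℕ → ℝ} (hg : Tame g) (μ : ℝ) :
    Summable fun k : ℕ => μ ^ k / k.factorial * g k := by
  obtain ⟨C, hC⟩ := hg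
  refine Summable.of_norm_bounded (g := fun k => C * ((2 * |μ|) ^ k / k.factorial))
    ((Real.summable_pow_div_factorial _).mul_left C) fun k => ?_
  rw [Real.norm_eq_abs, abs_mul, abs_div, abs_pow, Nat.abs_cast, mul_pow]
  calc |μ| ^ k / k.factorial * |g k| ≤ |μ| ^ k / k.factorial * (C * 2 ^ k) := by
        gcongr; exact hC k
    _ = _ := by ring

theorem expSeries_sub {g h : ℕ → ℝ} (hg : Tame g) (hh : Tame h) (μ : ℝ) :
    expSeries (fun k => g k - h k) μ = expSeries g μ - expSeries h μ := by
  unfold expSeries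
  rw [← (hg.summable μ).tsum_sub (hh.summable μ)]
  exact tsum_congr fun k => by ring

theorem expSeries_add {g h : ℕ → ℝ} (hg : Tame g) (hh : Tame h) (μ : ℝ) :
    expSeries (fun k => g k + h k) μ = expSeries g μ + expSeries h μ := by
  unfold expSeries
  rw [← (hg.summable μ).tsum_add (hh.summable μ)]
  exact tsum_congr fun k => by ring

theorem expSeries_const_mul (g : ℕ → ℝ) (c μ : ℝ) :
    expSeries (fun k => c * g k) μ = c * expSeries g μ := by
  unfold expSeries
  rw [← tsum_mul_left]
  exact tsum_congr fun k => by ring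

theorem expSeries_const (c μ : ℝ) : expSeries (fun _ => c) μ = c * Real.exp μ := by
  unfold expSeries
  rw [tsum_mul_right, Real.exp_eq_exp_ℝ, NormedSpace.exp_eq_tsum_div, mul_comm]

theorem expSeries_mono {g h : ℕ → ℝ} (hg : Tame g) (hh : Tame h) (hgh : ∀ k, g k ≤ h k)
    {μ : ℝ} (hμ : 0 ≤ μ) : expSeries g μ ≤ expSeries h μ :=
  (hg.summable μ).tsum_le_tsum (fun k => mul_le_mul_of_nonneg_left (hgh k) (by positivity))
    (hh.summable μ)

theorem hasDerivAt_expSeries {g : ℕ → ℝ} (hg : Tame g) (μ : ℝ) :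
    HasDerivAt (expSeries g) (expSeries (fun k => g (k + 1)) μ) μ := by
  obtain ⟨C, hC⟩ := hg
  have hg : Tame g := ⟨C, hC⟩
  have hC0 : 0 ≤ C := by have := (abs_nonneg _).trans (hC 0); simpa using this
  set R := |μ| + 1
  have hR : 0 ≤ R := by positivity
  have hder : ∀ k : ℕ, ∀ y : ℝ, HasDerivAt (fun y : ℝ => y ^ (k + 1) / (k + 1).factorial * g (k + 1))
      (y ^ k / k.factorial * g (k + 1)) y := by
    intro k y
    have := ((hasDerivAt_pow (k + 1) y).div_const ((k + 1).factorial : ℝ)).mul_const (g (k + 1))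
    convert! this using 1
    rw [Nat.factorial_succ]
    push_cast
    have : (k.factorial : ℝ) ≠ 0 := by positivity
    field_simp
  have hmem : μ ∈ Metric.ball (0 : ℝ) R := by simp [R]
  have h1 := hasDerivAt_tsum_of_isPreconnected
    (u := fun k => 2 * C * ((2 * R) ^ k / k.factorial))
    (g := fun (k : ℕ) (y : ℝ) => y ^ (k + 1) / (k + 1).factorial * g (k + 1))
    (g' := fun (k : ℕ) (y : ℝ) => y ^ k / k.factorial * g (k + 1))
    (t := Metric.ball (0 : ℝ) R) (y₀ := μ) (y := μ)
    ((Real.summable_pow_div_factorial _).mul_left _) Metric.isOpen_ball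
    (convex_ball _ _).isPreconnected (fun k y _ => hder k y) ?_ hmem
    ((summable_nat_add_iff 1).2 (hg.summable μ)) hmem
  · have h2 : expSeries g = fun y => g 0 + ∑' k : ℕ, y ^ (k + 1) / (k + 1).factorial * g (k + 1) := by
      funext y
      unfold expSeries
      rw [(hg.summable y).tsum_eq_zero_add]
      simp
    rw [h2]
    exact h1.const_add (g 0)
  · intro k y hy
    have hy' : |y| ≤ R := by
      have : |y| < R := by simpa using hy
      exact this.le
    rw [Real.norm_eq_abs, abs_mul, abs_div, abs_pow, Nat.abs_cast]
    calc |y| ^ k / k.factorial * |g (k + 1)| ≤ R ^ k / k.factorial * (C * 2 ^ (k + 1)) := by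
          gcongr; exact hC (k + 1)
      _ = _ := by rw [mul_pow]; ring

/-- The expectation of `g` under the Poisson law with mean `μ`. -/
noncomputable def poissonMean (g : ℕ → ℝ) (μ : ℝ) : ℝ := Real.exp (-μ) * expSeries g μ

theorem poissonMean_sub {g h : ℕ → ℝ} (hg : Tame g) (hh : Tame h) (μ : ℝ) :
    poissonMean (fun k => g k - h k) μ = poissonMean g μ - poissonMean h μ := by
  simp only [poissonMean, expSeries_sub hg hh]; ring

theorem poissonMean_add {g h : ℕ → ℝ} (hg : Tame g) (hh : Tame h) (μ : ℝ) :
    poissonMean (fun k => g k + h k) μ = poissonMean g μ + poissonMean h μ := by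
  simp only [poissonMean, expSeries_add hg hh]; ring

theorem poissonMean_const_mul (g : ℕ → ℝ) (c μ : ℝ) :
    poissonMean (fun k => c * g k) μ = c * poissonMean g μ := by
  simp only [poissonMean, expSeries_const_mul]; ring

theorem poissonMean_const (c μ : ℝ) : poissonMean (fun _ => c) μ = c := by
  rw [poissonMean, expSeries_const, mul_left_comm, ← Real.exp_add]; simp

theorem poissonMean_mono {g h : ℕ → ℝ} (hg : Tame g) (hh : Tame h) (hgh : ∀ k, g k ≤ h k)
    {μ : ℝ} (hμ : 0 ≤ μ) : poissonMean g μ ≤ poissonMean h μ :=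
  mul_le_mul_of_nonneg_left (expSeries_mono hg hh hgh hμ) (Real.exp_nonneg _)

/-- Differentiation in the mean acts on `g` as the forward difference. This is what reduces Γ(z + ½)
to log(z + ½), and log(z + ½) to the midpoint defect. -/
theorem hasDerivAt_poissonMean {g : ℕ → ℝ} (hg : Tame g) (μ : ℝ) :
    HasDerivAt (poissonMean g) (poissonMean (fun k => g (k + 1) - g k) μ) μ := by
  have h1 : HasDerivAt (fun y : ℝ => Real.exp (-y)) (-Real.exp (-μ)) μ := by
    simpa using (hasDerivAt_neg μ).exp
  have := h1.mul (hasDerivAt_expSeries hg μ)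
  convert! this using 1
  rw [poissonMean_sub hg.succ hg, poissonMean, poissonMean]
  ring

/-- Poisson expectation of `z` times a function of `z - 1`. -/
theorem mul_poissonMean_succ {g : ℕ → ℝ} (hg : Tame g) (μ : ℝ) :
    μ * poissonMean (fun k => g (k + 1)) μ = poissonMean (fun k => k * g k) μ := by
  have hs : Summable fun k : ℕ => μ ^ k / k.factorial * (k * g k) := by
    rw [← summable_nat_add_iff 1]
    refine ((hg.succ.summable μ).mul_left μ).congr fun k => ?_
    rw [Nat.factorial_succ]
    push_cast
    have : (k.factorial : ℝ) ≠ 0 := by positivity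
    field_simp
    ring
  unfold poissonMean expSeries
  rw [hs.tsum_eq_zero_add, mul_left_comm, ← tsum_mul_left]
  congr 1
  simp only [Nat.cast_zero, zero_mul, mul_zero, zero_add]
  refine tsum_congr fun k => ?_
  rw [Nat.factorial_succ]
  push_cast
  have : (k.factorial : ℝ) ≠ 0 := by positivity
  field_simp
  ring

/-! ### The functions log(z + ½) and log Γ(z + ½), and the midpoint rule for 1/t -/

/-- The logarithm of `z + 1/2`. -/
noncomputable def logHalf (k : ℕ) : ℝ := Real.log ((k : ℝ) + 1 / 2)

theorem abs_logHalf_le (k : ℕ) : |logHalf k| ≤ (k : ℝ) + 1 := by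
  unfold logHalf
  have hk : (0 : ℝ) ≤ k := Nat.cast_nonneg k
  rw [abs_le]
  constructor
  · have := Real.one_sub_inv_le_log_of_pos (x := (k : ℝ) + 1 / 2) (by positivity)
    have h2 : ((k : ℝ) + 1 / 2)⁻¹ ≤ 2 := by
      rw [inv_le_comm₀ (by positivity) (by norm_num)]; norm_num
    linarith
  · have := Real.log_le_sub_one_of_pos (x := (k : ℝ) + 1 / 2) (by positivity)
    linarith

theorem tame_logHalf : Tame logHalf :=
  tame_of_le_quadratic 1 zero_le_one fun k => (abs_logHalf_le k).trans (by
    have hk : (0 : ℝ) ≤ k := Nat.cast_nonneg k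
    nlinarith)

/-- The logarithm of `Γ(z + 1/2)`. -/
noncomputable def logGammaHalf (k : ℕ) : ℝ := Real.log (Real.Gamma ((k : ℝ) + 1 / 2))

theorem logGammaHalf_succ (k : ℕ) : logGammaHalf (k + 1) - logGammaHalf k = logHalf k := by
  unfold logGammaHalf logHalf
  have e : ((k + 1 : ℕ) : ℝ) + 1 / 2 = ((k : ℝ) + 1 / 2) + 1 := by push_cast; ring
  rw [e, Real.Gamma_add_one (by positivity), Real.log_mul (by positivity)
    (Real.Gamma_pos_of_pos (by positivity)).ne']
  ring

theorem tame_logGammaHalf : Tame logGammaHalf := by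
  refine tame_of_le_quadratic (|logGammaHalf 0| + 1) (by positivity) fun k => ?_
  have key : ∀ k : ℕ, |logGammaHalf k| ≤ |logGammaHalf 0| + (k : ℝ) * (k + 1) := by
    intro k
    induction k with
    | zero => simp
    | succ k ih =>
      have e : logGammaHalf (k + 1) = logGammaHalf k + logHalf k := by
        rw [← logGammaHalf_succ]; ring
      rw [e]
      have h1 := abs_add_le (logGammaHalf k) (logHalf k)
      have h2 := abs_logHalf_le k
      have hk : (0 : ℝ) ≤ k := Nat.cast_nonneg k
      push_cast
      nlinarith
  have hk : (0 : ℝ) ≤ k := Nat.cast_nonneg k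
  have h0 := abs_nonneg (logGammaHalf 0)
  nlinarith [key k, mul_nonneg h0 (by positivity : (0 : ℝ) ≤ (k : ℝ) ^ 2 + 2 * k)]

/-- The defect of the midpoint rule for `1 / t` on `[k + 1/2, k + 3/2]`. -/
noncomputable def midpointDefect (k : ℕ) : ℝ := logHalf (k + 1) - logHalf k - 1 / ((k : ℝ) + 1)

/-- With m = k + 1 and x = 1/(2m), the increment of log is log((1+x)/(1-x)) = 2 ∑ x^(2i+1)/(2i+1),
whose first term is 1/m. The defect is the positive remainder; replacing 1/(2i+1) by 1/3 there
leaves a geometric series. -/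
theorem midpointDefect_bounds (k : ℕ) :
    0 < midpointDefect k ∧
      midpointDefect k ≤ 1 / (3 * ((k : ℝ) + 1) * (4 * ((k : ℝ) + 1) ^ 2 - 1)) := by
  set m : ℝ := (k : ℝ) + 1 with hm
  have hm1 : 1 ≤ m := by simp [hm]
  set x : ℝ := 1 / (2 * m) with hx
  have hx0 : 0 < x := by positivity
  have hx1 : x ≤ 1 / 2 := by
    rw [hx, div_le_div_iff₀ (by positivity) (by norm_num)]; linarith
  have hx' : |x| < 1 := by rw [abs_of_pos hx0]; linarith
  have hs := Real.hasSum_log_sub_log_of_abs_lt_one hx'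
  have e1 : Real.log (1 + x) - Real.log (1 - x) = logHalf (k + 1) - logHalf k := by
    unfold logHalf
    rw [← Real.log_div (by positivity) (by linarith), ← Real.log_div (by positivity) (by positivity)]
    congr 1
    have : 1 - x ≠ 0 := by linarith
    have h2 : ((k : ℝ) + 1 / 2) ≠ 0 := by positivity
    rw [div_eq_div_iff this h2]
    push_cast
    have : (k : ℝ) = m - 1 := by simp [hm]
    rw [this, hx]
    field_simp
    ring
  rw [e1] at hs
  have hs' := (hasSum_nat_add_iff' 1).2 hs
  have e2 : midpointDefect k = logHalf (k + 1) - logHalf k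
      - ∑ i ∈ Finset.range 1, (2 : ℝ) * (1 / (2 * i + 1)) * x ^ (2 * i + 1) := by
    simp [midpointDefect, hx, ← hm]
    ring
  rw [← e2] at hs'
  have hpos : ∀ i : ℕ, 0 < (2 : ℝ) * (1 / (2 * ((i + 1 : ℕ) : ℝ) + 1)) * x ^ (2 * (i + 1) + 1) :=
    fun i => by positivity
  constructor
  · rw [← hs'.tsum_eq]
    exact hs'.summable.tsum_pos (fun i => (hpos i).le) 0 (hpos 0)
  · have hx2 : x ^ 2 < 1 := by nlinarith
    have hg := (hasSum_geometric_of_lt_one (sq_nonneg x) hx2).mul_left (2 / 3 * x ^ 3)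
    have := hasSum_le (fun i => ?_) hs' hg
    · refine this.trans (le_of_eq ?_)
      rw [hx]
      have h4 : (4 * m ^ 2 - 1) ≠ 0 := by nlinarith
      have h5 : 1 - (1 / (2 * m)) ^ 2 ≠ 0 := by rw [← hx]; linarith
      have h6 : 1 - (1 / (2 * m)) ^ 2 = (4 * m ^ 2 - 1) / (4 * m ^ 2) := by field_simp; ring
      rw [h6, inv_div]
      field_simp
      norm_num
    · have e : x ^ (2 * (i + 1) + 1) = x ^ 3 * (x ^ 2) ^ i := by ring
      rw [e]
      have : (1 : ℝ) / (2 * ((i + 1 : ℕ) : ℝ) + 1) ≤ 1 / 3 := by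
        push_cast
        rw [div_le_div_iff₀ (by positivity) (by norm_num)]
        have : (0 : ℝ) ≤ i := Nat.cast_nonneg i
        linarith
      have h3 : 0 ≤ x ^ 3 * (x ^ 2) ^ i := by positivity
      nlinarith

theorem tame_of_abs_le (C : ℝ) {g : ℕ → ℝ} (h : ∀ k, |g k| ≤ C) : Tame g :=
  ⟨C, fun k => (h k).trans
    (le_mul_of_one_le_right ((abs_nonneg _).trans (h 0)) (one_le_pow₀ (by norm_num)))⟩

theorem tame_inv_succ : Tame fun k => 1 / ((k : ℝ) + 1) :=
  tame_of_abs_le 1 fun k => by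
    rw [abs_of_pos (by positivity), div_le_one (by positivity)]
    have hk : (0 : ℝ) ≤ k := Nat.cast_nonneg k
    linarith

theorem tame_inv_succ_mul : Tame fun k => 1 / (((k : ℝ) + 1) * (k + 2)) :=
  tame_of_abs_le 1 fun k => by
    rw [abs_of_pos (by positivity), div_le_one (by positivity)]
    have hk : (0 : ℝ) ≤ k := Nat.cast_nonneg k
    nlinarith

theorem poissonMean_zero_indicator (μ : ℝ) :
    poissonMean (fun k => if k = 0 then 1 else 0) μ = Real.exp (-μ) := by
  unfold poissonMean expSeries
  rw [tsum_eq_single 0]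
  · simp
  · intro k hk
    simp [hk]

theorem tame_zero_indicator : Tame fun k => if k = 0 then (1 : ℝ) else 0 :=
  tame_of_abs_le 1 fun k => by split_ifs <;> simp

theorem poissonMean_inv_succ {μ : ℝ} (hμ : 0 < μ) :
    poissonMean (fun k => 1 / ((k : ℝ) + 1)) μ = (1 - Real.exp (-μ)) / μ := by
  have hT : Tame fun k : ℕ => 1 / (k : ℝ) := tame_of_abs_le 1 fun k => by
    rcases k with _ | k
    · simp
    · rw [abs_of_pos (by positivity), div_le_one (by positivity)]
      have hk : (0 : ℝ) ≤ k := Nat.cast_nonneg k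
      push_cast; linarith
  have h := mul_poissonMean_succ hT μ
  -- Because 1/0 = 0, the product k · (1/k) vanishes at k = 0; this atom is the source of exp(-μ).
  have e : (fun k : ℕ => (k : ℝ) * (1 / (k : ℝ))) = fun k => 1 - if k = 0 then 1 else 0 := by
    funext k
    rcases k with _ | k
    · simp
    · have : ((k + 1 : ℕ) : ℝ) ≠ 0 := by positivity
      rw [mul_one_div_cancel this]; simp
  rw [e, poissonMean_sub (tame_const 1) tame_zero_indicator, poissonMean_const,
    poissonMean_zero_indicator] at h
  rw [eq_div_iff hμ.ne', mul_comm, ← h]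
  push_cast
  rfl

theorem poissonMean_inv_succ_mul {μ : ℝ} (hμ : 0 < μ) :
    poissonMean (fun k => 1 / (((k : ℝ) + 1) * (k + 2))) μ
      = (1 - Real.exp (-μ) - μ * Real.exp (-μ)) / μ ^ 2 := by
  have hT : Tame fun k : ℕ => 1 / ((k : ℝ) * (k + 1)) := tame_of_abs_le 1 fun k => by
    rcases k with _ | k
    · simp
    · rw [abs_of_pos (by positivity), div_le_one (by positivity)]
      have hk : (0 : ℝ) ≤ k := Nat.cast_nonneg k
      push_cast; nlinarith
  have h := mul_poissonMean_succ hT μ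
  have e : (fun k : ℕ => (k : ℝ) * (1 / ((k : ℝ) * (k + 1))))
      = fun k : ℕ => 1 / ((k : ℝ) + 1) - if k = 0 then 1 else 0 := by
    funext k
    rcases k with _ | k
    · simp
    · have : ((k + 1 : ℕ) : ℝ) ≠ 0 := by positivity
      have h2 : ((k + 1 : ℕ) : ℝ) + 1 ≠ 0 := by positivity
      simp only [Nat.succ_ne_zero, if_false, sub_zero]
      field_simp
  rw [e, poissonMean_sub tame_inv_succ tame_zero_indicator, poissonMean_inv_succ hμ,
    poissonMean_zero_indicator] at h
  have e2 : (fun k : ℕ => 1 / ((((k + 1 : ℕ) : ℕ) : ℝ) * (((k + 1 : ℕ) : ℝ) + 1)))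
      = fun k : ℕ => 1 / (((k : ℝ) + 1) * (k + 2)) := by
    funext k
    push_cast
    ring
  rw [e2] at h
  rw [eq_div_iff (by positivity), sq, mul_comm, mul_assoc, h]
  field_simp

theorem tame_midpointDefect : Tame midpointDefect :=
  (tame_logHalf.succ.sub tame_logHalf).sub tame_inv_succ

/-- The numerical core of the constant 0.02. The summands with k ≤ 4 are negative and those with 5 ≤
k ≤ 10 positive, so three ranges of x are treated separately. -/
theorem midpoint_polynomial_pos {x : ℝ} (hx : 0 ≤ x) :
    0 < 0.02 + 1.02 * x + x ^ 2 * ∑ k ∈ Finset.range 11, x ^ k / k.factorial *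
      (0.02 * (1 / (((k : ℝ) + 1) * (k + 2)))
        - 1 / (3 * ((k : ℝ) + 1) * (4 * ((k : ℝ) + 1) ^ 2 - 1))) := by
  simp only [Finset.sum_range_succ, Finset.sum_range_zero, Nat.factorial]
  norm_num
  rcases le_total x 5 with h5 | h5
  -- Here the term 1.02 x dominates: the negative powers x², …, x⁶ are bounded linearly through x ≤
  -- 5, and the positive powers x⁷, …, x¹² are dropped.
  · have h : ∀ n : ℕ, 0 ≤ x ^ n := fun n => by positivity
    have h1 : ∀ n : ℕ, x ^ (n + 1) ≤ 5 ^ n * x := fun n => by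
      rw [pow_succ]; exact mul_le_mul_of_nonneg_right (pow_le_pow_left₀ hx h5 n) hx
    have := h1 1
    have := h1 2
    have := h1 3
    have := h1 4
    have := h1 5
    have := h 7
    have := h 8
    have := h 9
    have := h 10
    have := h 11
    have := h 12
    norm_num at *
    ring_nf
    linarith
  · rcases le_total x 6.25 with h6 | h6
    · obtain ⟨v, rfl⟩ : ∃ v, x = v + 5 := ⟨x - 5, by ring⟩
      have hv : 0 ≤ v := by linarith
      have hv2 : v ≤ 1.25 := by norm_num at h6 ⊢; linarith
      -- A cubic minorant in v = x - 5; the difference has only nonnegative coefficients in v. The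
      -- last range works in the same way with a quadratic in v = x - 6.25.
      have h1 : 0 < 1.17 - 0.773 * v - 0.13 * v ^ 2 + 0.08 * v ^ 3 := by
        norm_num at hv2
        nlinarith [mul_nonneg hv (sub_nonneg.2 hv2), mul_nonneg (mul_nonneg hv hv) (sub_nonneg.2 hv2), pow_nonneg hv 3]
      refine h1.trans_le ?_
      rw [← sub_nonneg]
      ring_nf
      positivity
    · obtain ⟨v, rfl⟩ : ∃ v, x = v + 6.25 := ⟨x - 6.25, by ring⟩
      have hv : 0 ≤ v := by linarith
      have h1 : 0 < 0.31 - 0.25 * v + 0.79 * v ^ 2 := by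
        nlinarith [sq_nonneg (v - 0.2)]
      refine h1.trans_le ?_
      rw [← sub_nonneg]
      ring_nf
      positivity

/-! ### Bias of the logarithm of a Poisson variable -/

/-- The bias `E log (z + 1/2) - log μ` of the logarithm of a Poisson variable. -/
noncomputable def logBias (μ : ℝ) : ℝ := poissonMean logHalf μ - Real.log μ

theorem hasDerivAt_logBias {μ : ℝ} (hμ : 0 < μ) :
    HasDerivAt logBias (poissonMean midpointDefect μ - Real.exp (-μ) / μ) μ := by
  have h := (hasDerivAt_poissonMean tame_logHalf μ).sub (Real.hasDerivAt_log hμ.ne')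
  refine h.congr_deriv ?_
  have e : (fun k => logHalf (k + 1) - logHalf k)
      = fun k => midpointDefect k + 1 / ((k : ℝ) + 1) := by
    funext k; simp [midpointDefect]
  rw [e, poissonMean_add tame_midpointDefect tame_inv_succ, poissonMean_inv_succ hμ]
  field_simp
  ring

theorem poissonMean_midpointDefect_pos {μ : ℝ} (hμ : 0 ≤ μ) :
    0 ≤ poissonMean midpointDefect μ := by
  have := poissonMean_mono (tame_const 0) tame_midpointDefect
    (fun k => (midpointDefect_bounds k).1.le) hμ
  rwa [poissonMean_const] at this

/-- After multiplication by μ² exp(μ), write 0.02 exp(μ) = 0.02 (1 + μ) + 0.02 μ² ∑ μ^k/k! ·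
1/((k+1)(k+2)). Both sides are then power series that can be compared coefficientwise, apart from
finitely many terms left to `midpoint_polynomial_pos`. -/
theorem poissonMean_midpointDefect_lt {μ : ℝ} (hμ : 0 < μ) :
    poissonMean midpointDefect μ < Real.exp (-μ) / μ + 0.02 / μ ^ 2 := by
  set b : ℕ → ℝ := fun k => 1 / (3 * ((k : ℝ) + 1) * (4 * ((k : ℝ) + 1) ^ 2 - 1)) with hb
  have hbpos : ∀ k : ℕ, 3 ≤ 4 * ((k : ℝ) + 1) ^ 2 - 1 := fun k => by
    have hk : (0 : ℝ) ≤ k := Nat.cast_nonneg k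
    nlinarith
  have hbT : Tame b := tame_of_abs_le 1 fun k => by
    have hk : (0 : ℝ) ≤ k := Nat.cast_nonneg k
    have h3 := hbpos k
    have h4 : 0 < 3 * ((k : ℝ) + 1) * (4 * ((k : ℝ) + 1) ^ 2 - 1) := by positivity
    rw [abs_of_pos (by positivity), div_le_one h4]
    nlinarith
  set w : ℕ → ℝ := fun k => 0.02 * (1 / (((k : ℝ) + 1) * (k + 2))) - b k with hw
  have hwT : Tame w := (tame_inv_succ_mul.const_mul 0.02).sub hbT
  -- Nonnegativity already holds from k = 5; the terms 5 ≤ k ≤ 10 are kept because they give the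
  -- truncated polynomial its positive leading part.
  have hwpos : ∀ k, 11 ≤ k → 0 ≤ w k := fun k hk => by
    have hk' : (11 : ℝ) ≤ k := by exact_mod_cast hk
    have h3 := hbpos k
    rw [hw, hb, sub_nonneg]
    simp only
    rw [mul_one_div, div_le_div_iff₀ (by positivity) (by positivity)]
    nlinarith [mul_nonneg (by linarith : (0 : ℝ) ≤ (k : ℝ) - 11) (by linarith : (0 : ℝ) ≤ (k : ℝ) - 11),
      mul_nonneg (mul_nonneg (by linarith : (0 : ℝ) ≤ (k : ℝ) - 11)
        (by linarith : (0 : ℝ) ≤ (k : ℝ) - 11)) (by linarith : (0 : ℝ) ≤ (k : ℝ) - 11)]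
  have hsum : ∑ k ∈ Finset.range 11, μ ^ k / k.factorial * w k ≤ expSeries w μ :=
    (hwT.summable μ).sum_le_tsum _ fun k hk =>
      mul_nonneg (by positivity) (hwpos k (by simpa using hk))
  have hpoly := midpoint_polynomial_pos hμ.le
  have h1 : poissonMean midpointDefect μ ≤ poissonMean b μ :=
    poissonMean_mono tame_midpointDefect hbT (fun k => (midpointDefect_bounds k).2) hμ.le
  have h2 : poissonMean w μ = 0.02 * ((1 - Real.exp (-μ) - μ * Real.exp (-μ)) / μ ^ 2)
      - poissonMean b μ := by
    rw [hw, poissonMean_sub (tame_inv_succ_mul.const_mul 0.02) hbT, poissonMean_const_mul,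
      poissonMean_inv_succ_mul hμ]
  have h3 : 0 < 0.02 + 1.02 * μ + μ ^ 2 * expSeries w μ :=
    hpoly.trans_le (by gcongr)
  have h4 : 0 < Real.exp (-μ) / μ ^ 2 * (0.02 + 1.02 * μ + μ ^ 2 * expSeries w μ) := by positivity
  have h5 : Real.exp (-μ) / μ ^ 2 * (0.02 + 1.02 * μ + μ ^ 2 * expSeries w μ)
      = Real.exp (-μ) / μ + 0.02 / μ ^ 2 - 0.02 * ((1 - Real.exp (-μ) - μ * Real.exp (-μ)) / μ ^ 2)
        + poissonMean w μ := by
    unfold poissonMean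
    field_simp
    ring
  rw [h5, h2] at h4
  linarith

/-- A crude bound from log t ≥ 1 - 1/t, needed only, with `logBias_le_div`, to see that the bias
tends to 0 at infinity. -/
theorem neg_two_div_le_logBias {μ : ℝ} (hμ : 0 < μ) : -2 / μ ≤ logBias μ := by
  have hT : Tame fun k : ℕ => 1 / ((k : ℝ) + 1) + 2 * (1 / (((k : ℝ) + 1) * (k + 2))) :=
    tame_inv_succ.add (tame_inv_succ_mul.const_mul 2)
  have h1 : poissonMean (fun k : ℕ => (Real.log μ + 1) -
      μ * (1 / ((k : ℝ) + 1) + 2 * (1 / (((k : ℝ) + 1) * (k + 2))))) μ ≤ poissonMean logHalf μ := by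
    refine poissonMean_mono ((tame_const _).sub (hT.const_mul μ)) tame_logHalf (fun k => ?_) hμ.le
    have hk : (0 : ℝ) ≤ k := Nat.cast_nonneg k
    have h2 := Real.one_sub_inv_le_log_of_pos (x := ((k : ℝ) + 1 / 2) / μ) (by positivity)
    rw [Real.log_div (by positivity) hμ.ne', inv_div] at h2
    -- The majorant has explicit Poisson means; the coefficient 2 makes it an equality at k = 0.
    have h3 : 1 / ((k : ℝ) + 1 / 2) ≤ 1 / ((k : ℝ) + 1) + 2 * (1 / (((k : ℝ) + 1) * (k + 2))) := by
      rw [← sub_nonneg]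
      have : 1 / ((k : ℝ) + 1) + 2 * (1 / (((k : ℝ) + 1) * (k + 2))) - 1 / ((k : ℝ) + 1 / 2)
        = (3 / 2 * k) / (((k : ℝ) + 1) * (k + 2) * (k + 1 / 2)) := by
        field_simp; ring
      rw [this]; positivity
    have h4 := mul_le_mul_of_nonneg_left h3 hμ.le
    rw [mul_one_div] at h4
    unfold logHalf
    linarith
  rw [poissonMean_sub (tame_const _) (hT.const_mul μ), poissonMean_const, poissonMean_const_mul,
    poissonMean_add tame_inv_succ (tame_inv_succ_mul.const_mul 2), poissonMean_const_mul,
    poissonMean_inv_succ hμ, poissonMean_inv_succ_mul hμ] at h1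
  have h5 : μ * ((1 - Real.exp (-μ)) / μ
      + 2 * ((1 - Real.exp (-μ) - μ * Real.exp (-μ)) / μ ^ 2)) ≤ 1 + 2 / μ := by
    have e : μ * ((1 - Real.exp (-μ)) / μ
      + 2 * ((1 - Real.exp (-μ) - μ * Real.exp (-μ)) / μ ^ 2))
      = 1 + 2 / μ - (Real.exp (-μ) + 2 * (Real.exp (-μ) + μ * Real.exp (-μ)) / μ) := by
      field_simp; ring
    rw [e]
    have : 0 ≤ Real.exp (-μ) + 2 * (Real.exp (-μ) + μ * Real.exp (-μ)) / μ := by positivity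
    linarith
  unfold logBias
  rw [neg_div]
  linarith

theorem tame_natCast : Tame fun k => (k : ℝ) :=
  tame_of_le_quadratic 1 zero_le_one fun k => by
    have hk : (0 : ℝ) ≤ k := Nat.cast_nonneg k
    rw [abs_of_nonneg hk]; nlinarith

theorem poissonMean_natCast (μ : ℝ) : poissonMean (fun k => (k : ℝ)) μ = μ := by
  have := mul_poissonMean_succ (tame_const 1) μ
  rw [poissonMean_const] at this
  simpa using this.symm

theorem logBias_le_div {μ : ℝ} (hμ : 0 < μ) : logBias μ ≤ 1 / 2 / μ := by
  have hT : Tame fun k : ℕ => 1 / μ * (k : ℝ) := tame_natCast.const_mul _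
  have h1 : poissonMean logHalf μ ≤ poissonMean (fun k : ℕ => 1 / μ * (k : ℝ) +
      (1 / 2 / μ - 1 + Real.log μ)) μ := by
    refine poissonMean_mono tame_logHalf (hT.add (tame_const _)) (fun k => ?_) hμ.le
    have h2 := Real.log_le_sub_one_of_pos (x := ((k : ℝ) + 1 / 2) / μ) (by positivity)
    rw [Real.log_div (by positivity) hμ.ne', add_div] at h2
    unfold logHalf
    rw [one_div_mul_eq_div]
    linarith
  rw [poissonMean_add hT (tame_const _), poissonMean_const, poissonMean_const_mul,
    poissonMean_natCast, one_div_mul_cancel hμ.ne'] at h1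
  unfold logBias
  linarith

theorem strictAntiOn_Ioi_of_hasDerivAt_neg {f f' : ℝ → ℝ} (hd : ∀ x, 0 < x → HasDerivAt f (f' x) x)
    (hn : ∀ x, 0 < x → f' x < 0) : StrictAntiOn f (Set.Ioi 0) :=
  strictAntiOn_of_deriv_neg (convex_Ioi 0)
    (fun x hx => (hd x hx).continuousAt.continuousWithinAt) fun x hx => by
      rw [interior_Ioi] at hx
      rw [(hd x hx).deriv]
      exact hn x hx

theorem pos_of_hasDerivAt_neg_of_tendsto {f f' : ℝ → ℝ}
    (hd : ∀ x, 0 < x → HasDerivAt f (f' x) x) (hn : ∀ x, 0 < x → f' x < 0)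
    (hl : Filter.Tendsto f Filter.atTop (nhds 0)) {x : ℝ} (hx : 0 < x) : 0 < f x := by
  have hanti := strictAntiOn_Ioi_of_hasDerivAt_neg hd hn
  have hx1 : (0 : ℝ) < x + 1 := by linarith
  have h1 : f (x + 1) < f x := hanti hx hx1 (by linarith)
  have h2 : 0 ≤ f (x + 1) := le_of_tendsto hl (by
    filter_upwards [Filter.eventually_ge_atTop (x + 1)] with y hy
    exact hanti.antitoneOn hx1 (hx1.trans_le hy) hy)
  linarith

theorem tendsto_logBias : Filter.Tendsto logBias Filter.atTop (nhds 0) := by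
  refine tendsto_of_tendsto_of_tendsto_of_le_of_le' (g := fun μ : ℝ => -2 / μ)
    (h := fun μ : ℝ => 1 / 2 / μ) (tendsto_const_nhds.div_atTop Filter.tendsto_id)
    (tendsto_const_nhds.div_atTop Filter.tendsto_id) ?_ ?_
  · filter_upwards [Filter.eventually_gt_atTop 0] with μ hμ using neg_two_div_le_logBias hμ
  · filter_upwards [Filter.eventually_gt_atTop 0] with μ hμ using logBias_le_div hμ

theorem hasDerivAt_const_div {c μ : ℝ} (hμ : 0 < μ) :
    HasDerivAt (fun y : ℝ => c / y) (-(c / μ ^ 2)) μ := by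
  have h := (hasDerivAt_inv hμ.ne').const_mul c
  refine h.congr_deriv ?_
  rw [mul_neg, div_eq_mul_inv]

/-- The function `logBias μ + 0.02/μ` decreases strictly, by the bound on the mean midpoint defect,
and tends to 0, so it is positive. -/
theorem logBias_gt {μ : ℝ} (hμ : 0 < μ) : -(0.02 / μ) < logBias μ := by
  have h := pos_of_hasDerivAt_neg_of_tendsto (f := fun μ => logBias μ + 0.02 / μ)
    (fun x hx => (hasDerivAt_logBias hx).add (hasDerivAt_const_div hx))
    (fun x hx => by have := poissonMean_midpointDefect_lt hx; linarith)
    (by simpa using tendsto_logBias.add (tendsto_const_nhds.div_atTop Filter.tendsto_id)) hμ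
  linarith

/-- Again a strictly decreasing function with limit 0: in the derivative of exp(-μ)/μ - `logBias μ`
the terms exp(-μ)/μ cancel and only negative ones remain. -/
theorem logBias_lt {μ : ℝ} (hμ : 0 < μ) : logBias μ < Real.exp (-μ) / μ := by
  have hd : ∀ x : ℝ, 0 < x → HasDerivAt (fun y : ℝ => Real.exp (-y) / y)
      (-(Real.exp (-x) / x) - Real.exp (-x) / x ^ 2) x := fun x hx => by
    have h1 : HasDerivAt (fun y : ℝ => Real.exp (-y)) (-Real.exp (-x)) x := by
      simpa using (hasDerivAt_neg x).exp
    refine (h1.div (hasDerivAt_id x) hx.ne').congr_deriv ?_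
    simp only [id]
    field_simp
  have h := pos_of_hasDerivAt_neg_of_tendsto (f := fun μ => Real.exp (-μ) / μ - logBias μ)
    (fun x hx => (hd x hx).sub (hasDerivAt_logBias hx))
    (fun x hx => by
      have := poissonMean_midpointDefect_pos hx.le
      have h2 : 0 < Real.exp (-x) / x ^ 2 := by positivity
      linarith)
    (by
      have : Filter.Tendsto (fun x : ℝ => Real.exp (-x) / x) Filter.atTop (nhds 0) := by
        have h1 := Real.tendsto_exp_neg_atTop_nhds_zero
        have h2 := h1.mul tendsto_inv_atTop_zero
        simpa [div_eq_mul_inv] using h2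
      simpa using this.sub tendsto_logBias) hμ
  linarith

/-! ### Increments of the entropy defect -/

/-- The entropy-like function whose increments give the risk of the Jeffreys predictive
distribution. -/
noncomputable def entropyDefect (μ : ℝ) : ℝ :=
  μ * Real.log μ - μ - poissonMean logGammaHalf μ

theorem hasDerivAt_entropyDefect {μ : ℝ} (hμ : 0 < μ) :
    HasDerivAt entropyDefect (-logBias μ) μ := by
  have h := ((Real.hasDerivAt_mul_log hμ.ne').sub (hasDerivAt_id μ)).sub
    (hasDerivAt_poissonMean tame_logGammaHalf μ)
  refine h.congr_deriv ?_
  simp only [logGammaHalf_succ, logBias]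
  ring

/-- Integrates the lower bound on the bias. This is where 1.04 comes from: 0.02 is four per cent of
the coefficient ½ in the minimax lower bound. -/
theorem entropyDefect_sub_lt {μ ν : ℝ} (hμ : 0 < μ) (hν : μ < ν) :
    entropyDefect ν - entropyDefect μ < 0.02 * (Real.log ν - Real.log μ) := by
  have h := strictAntiOn_Ioi_of_hasDerivAt_neg
    (f := fun x => entropyDefect x - 0.02 * Real.log x)
    (fun x hx => (hasDerivAt_entropyDefect hx).sub ((Real.hasDerivAt_log hx.ne').const_mul _))
    (fun x hx => by
      have := logBias_gt hx
      rw [div_eq_mul_inv] at this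
      linarith) hμ (hμ.trans hν) hν
  simp only at h
  linarith

/-- Integrates the upper bound on the bias, with exp(-x) replaced by its value at the left end. The
exponential factor makes the error negligible under a prior that spreads out to infinity. -/
theorem entropyDefect_sub_ge {μ ν : ℝ} (hμ : 0 < μ) (hν : μ ≤ ν) :
    -(Real.exp (-μ) * (Real.log ν - Real.log μ)) ≤ entropyDefect ν - entropyDefect μ := by
  have hd : ∀ x ∈ Set.Ici μ, HasDerivAt (fun x => entropyDefect x + Real.exp (-μ) * Real.log x)
      (-logBias x + Real.exp (-μ) * x⁻¹) x := fun x hx =>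
    (hasDerivAt_entropyDefect (hμ.trans_le hx)).add
      ((Real.hasDerivAt_log (hμ.trans_le hx).ne').const_mul _)
  have h := monotoneOn_of_deriv_nonneg (convex_Ici μ)
    (fun x hx => (hd x hx).continuousAt.continuousWithinAt)
    (fun x hx => (hd x (interior_subset hx)).differentiableAt.differentiableWithinAt)
    (fun x hx => by
      have hx := interior_subset hx
      have hx0 : 0 < x := hμ.trans_le hx
      rw [(hd x hx).deriv]
      have h1 := logBias_lt hx0
      have h2 : Real.exp (-x) / x ≤ Real.exp (-μ) * x⁻¹ := by
        rw [div_eq_mul_inv]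
        gcongr
        exact hx
      linarith) (Set.self_mem_Ici) hν hν
  simp only at h
  linarith

/-! ### Kullback–Leibler divergence on countable spaces -/

open InformationTheory in
theorem klDiv_eq_tsum {Y : Type*} [MeasurableSpace Y] [Countable Y] [MeasurableSingletonClass Y]
    (P Q : Measure Y) [IsFiniteMeasure P] [IsFiniteMeasure Q] (hQ : ∀ y, Q {y} ≠ 0) :
    klDiv P Q = ∑' y, Q {y} * ENNReal.ofReal (klFun (P {y} / Q {y}).toReal) := by
  have hac : P ≪ Q := by
    intro s hs
    have : s = ∅ := by
      by_contra h
      obtain ⟨y, hy⟩ := Set.nonempty_iff_ne_empty.2 h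
      exact hQ y (measure_mono_null (Set.singleton_subset_iff.2 hy) hs)
    simp [this]
  rw [klDiv_eq_lintegral_klFun_of_ac hac, lintegral_countable']
  refine tsum_congr fun y => ?_
  have h : P {y} = P.rnDeriv Q y * Q {y} := by
    conv_lhs => rw [← Measure.withDensity_rnDeriv_eq P Q hac]
    rw [withDensity_apply _ (measurableSet_singleton y), lintegral_singleton]
  rw [h, ENNReal.mul_div_cancel_right (hQ y) (measure_ne_top _ _), mul_comm]

theorem ofReal_integral_le_lintegral_ofReal {Y : Type*} [MeasurableSpace Y] {μ : Measure Y}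
    {f : Y → ℝ} (hf : Integrable f μ) :
    ENNReal.ofReal (∫ y, f y ∂μ) ≤ ∫⁻ y, ENNReal.ofReal (f y) ∂μ := by
  have h := ofReal_integral_eq_lintegral_ofReal hf.pos_part
    (Filter.Eventually.of_forall fun y => le_max_right _ _)
  calc ENNReal.ofReal (∫ y, f y ∂μ) ≤ ENNReal.ofReal (∫ y, max (f y) 0 ∂μ) :=
        ENNReal.ofReal_le_ofReal (integral_mono hf hf.pos_part fun y => le_max_left _ _)
    _ = ∫⁻ y, ENNReal.ofReal (f y) ∂μ := by
        rw [h]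
        exact lintegral_congr fun y => by simp

open InformationTheory in
/-- Gibbs' inequality in its dual form. -/
theorem ofReal_integral_add_one_le_klDiv_add {Y : Type*} [MeasurableSpace Y]
    (P Q : Measure Y) [IsProbabilityMeasure P] [IsProbabilityMeasure Q] {h : Y → ℝ}
    (hm : Measurable h) (hi : Integrable h P) :
    ENNReal.ofReal (∫ y, h y ∂P + 1) ≤ klDiv P Q + ∫⁻ y, ENNReal.ofReal (Real.exp (h y)) ∂Q := by
  by_cases hac : P ≪ Q
  swap
  · rw [klDiv_of_not_ac hac]; simp
  rw [klDiv_eq_lintegral_klFun_of_ac hac, ← lintegral_add_right _ (by fun_prop)]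
  have hi' : Integrable (fun y => (P.rnDeriv Q y).toReal * h y) Q :=
    (integrable_rnDeriv_smul_iff hac).2 hi
  have e : ∫ y, h y ∂P + 1 = ∫ y, ((P.rnDeriv Q y).toReal * h y + 1) ∂Q := by
    rw [integral_add hi' (integrable_const _)]
    have := integral_rnDeriv_smul (f := h) hac
    simp only [smul_eq_mul] at this
    rw [this]
    simp
  rw [e]
  refine (ofReal_integral_le_lintegral_ofReal (hi'.add (integrable_const _))).trans
    (lintegral_mono fun y => ?_)
  set u := (P.rnDeriv Q y).toReal with hu
  have hu0 : 0 ≤ u := ENNReal.toReal_nonneg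
  rw [← ENNReal.ofReal_add (klFun_nonneg hu0) (Real.exp_nonneg _)]
  refine ENNReal.ofReal_le_ofReal ?_
  change u * h y + 1 ≤ _
  unfold klFun
  rcases hu0.eq_or_lt with h0 | hpos
  · rw [← h0]; simp [Real.exp_nonneg]
  -- The Young inequality u h ≤ u log u - u + exp h, a rearrangement of 1 + t ≤ exp t at t = h - log
  -- u.
  · have h1 := Real.add_one_le_exp (h y - Real.log u)
    rw [Real.exp_sub, Real.exp_log hpos, le_div_iff₀ hpos] at h1
    linarith

-- The pointwise form of p log(a/b) ≤ p (a/b - 1). All terms stand on the side where they are added,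
-- since subtraction in `ℝ≥0∞` truncates; this also explains the summands 1 and 2 in the lemmas
-- below.
open InformationTheory in
theorem klFun_term_add_le {p a b : ℝ≥0∞} (hp : p ≠ ∞) (ha : a ≠ 0) (ha' : a ≠ ∞) (hb : b ≠ 0)
    (hb' : b ≠ ∞) :
    b * ENNReal.ofReal (klFun (p / b).toReal) + (a + p) ≤
      a * ENNReal.ofReal (klFun (p / a).toReal) + (b + p * (a / b)) := by
  lift p to NNReal using hp
  lift a to NNReal using ha'
  lift b to NNReal using hb'
  have ha0 : (0 : ℝ) < a := by
    have : a ≠ 0 := by exact_mod_cast ha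
    exact_mod_cast pos_iff_ne_zero.2 this
  have hb0 : (0 : ℝ) < b := by
    have : b ≠ 0 := by exact_mod_cast hb
    exact_mod_cast pos_iff_ne_zero.2 this
  have hp0 : (0 : ℝ) ≤ p := p.2
  have e : ∀ q : NNReal, (q : ℝ≥0∞) = ENNReal.ofReal q := fun q => (ENNReal.ofReal_coe_nnreal).symm
  rw [e p, e a, e b]
  have hk1 : 0 ≤ klFun ((p : ℝ) / b) := klFun_nonneg (by positivity)
  have hk2 : 0 ≤ klFun ((p : ℝ) / a) := klFun_nonneg (by positivity)
  rw [← ENNReal.ofReal_div_of_pos ha0, ← ENNReal.ofReal_div_of_pos hb0,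
    ← ENNReal.ofReal_div_of_pos hb0, ENNReal.toReal_ofReal (by positivity),
    ENNReal.toReal_ofReal (by positivity), ← ENNReal.ofReal_mul hb0.le,
    ← ENNReal.ofReal_mul ha0.le, ← ENNReal.ofReal_mul hp0, ← ENNReal.ofReal_add ha0.le hp0,
    ← ENNReal.ofReal_add hb0.le (by positivity), ← ENNReal.ofReal_add (by positivity) (by positivity),
    ← ENNReal.ofReal_add (by positivity) (by positivity)]
  refine ENNReal.ofReal_le_ofReal ?_
  unfold klFun
  have h1 : (b : ℝ) * (p / b * Real.log (p / b) + 1 - p / b) = p * Real.log (p / b) + b - p := by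
    field_simp
  have h2 : (a : ℝ) * (p / a * Real.log (p / a) + 1 - p / a) = p * Real.log (p / a) + a - p := by
    field_simp
  rw [h1, h2]
  rcases hp0.eq_or_lt with h0 | hp1
  · rw [← h0]; simp; linarith
  · have h3 := Real.log_le_sub_one_of_pos (x := (a : ℝ) / b) (by positivity)
    rw [Real.log_div ha0.ne' hb0.ne'] at h3
    rw [Real.log_div hp1.ne' hb0.ne', Real.log_div hp1.ne' ha0.ne']
    nlinarith

theorem klDiv_add_two_le {Y : Type*} [MeasurableSpace Y] [Countable Y] [MeasurableSingletonClass Y]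
    (P A B : Measure Y) [IsProbabilityMeasure P] [IsProbabilityMeasure A] [IsProbabilityMeasure B]
    (hA : ∀ y, A {y} ≠ 0) (hB : ∀ y, B {y} ≠ 0) :
    InformationTheory.klDiv P B + 2 ≤
      InformationTheory.klDiv P A + 1 + ∑' y, P {y} * (A {y} / B {y}) := by
  have hone : ∀ (M : Measure Y) [IsProbabilityMeasure M], ∑' y, M {y} = 1 := fun M _ => by
    have := lintegral_countable' (μ := M) (fun _ => (1 : ℝ≥0∞))
    simpa using this.symm
  rw [klDiv_eq_tsum P A hA, klDiv_eq_tsum P B hB, add_assoc]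
  nth_rewrite 1 [← hone B]
  rw [show (2 : ℝ≥0∞) = ∑' y, (A {y} + P {y}) by rw [ENNReal.tsum_add, hone A, hone P]; norm_num,
    ← ENNReal.tsum_add, ← ENNReal.tsum_add, ← ENNReal.tsum_add]
  exact ENNReal.tsum_le_tsum fun y => klFun_term_add_le (measure_ne_top _ _) (hA y)
    (measure_ne_top _ _) (hB y) (measure_ne_top _ _)

/-- Comparison of risks through the expected likelihood ratio. -/
theorem klRisk_add_two_le {d : ℕ} (r s lam : Fin d → ℝ) (qA qB : (Fin d → ℕ) → Measure (Fin d → ℕ))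
    (hA : IsPredictive qA) (hB : IsPredictive qB) (hA0 : ∀ x y, qA x {y} ≠ 0)
    (hB0 : ∀ x y, qB x {y} ≠ 0) :
    klRisk r s qB lam + 2 ≤ klRisk r s qA lam + 1 +
      ∑' x, poissonLaw r lam {x} * ∑' y, poissonLaw s lam {y} * (qA x {y} / qB x {y}) := by
  unfold klRisk
  have e1 : ∀ c : ℝ≥0∞, c = ∫⁻ _, c ∂(poissonLaw r lam) := fun c => by simp
  have e2 : ∑' x, poissonLaw r lam {x} * ∑' y, poissonLaw s lam {y} * (qA x {y} / qB x {y})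
      = ∫⁻ x, ∑' y, poissonLaw s lam {y} * (qA x {y} / qB x {y}) ∂(poissonLaw r lam) := by
    rw [lintegral_countable']
    exact tsum_congr fun x => mul_comm _ _
  rw [e1 2, e1 1, e2, ← lintegral_add_right _ (by fun_prop), ← lintegral_add_right _ (by fun_prop),
    ← lintegral_add_right _ (measurable_of_countable _)]
  refine lintegral_mono fun x => ?_
  have := hA x
  have := hB x
  simpa using klDiv_add_two_le (poissonLaw s lam) (qA x) (qB x) (hA0 x) (hB0 x)

/-! ### Poisson likelihoods and sufficiency of the sum -/

/-- The Poisson probability of `k` for mean `c * l`. -/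
noncomputable def poissonWeight (c l : ℝ) (k : ℕ) : ℝ :=
  (c * l) ^ k / k.factorial * Real.exp (-(c * l))

theorem poissonWeight_nonneg {c l : ℝ} (h : 0 ≤ c * l) (k : ℕ) : 0 ≤ poissonWeight c l k := by
  unfold poissonWeight; positivity

theorem poissonWeight_pos {c l : ℝ} (h : 0 < c * l) (k : ℕ) : 0 < poissonWeight c l k := by
  unfold poissonWeight; positivity

theorem continuous_poissonWeight (c : ℝ) (k : ℕ) : Continuous fun l => poissonWeight c l k := by
  unfold poissonWeight; fun_prop

theorem poissonLaw_singleton_eq_prod {d : ℕ} {c lam : Fin d → ℝ} (h : ∀ i, 0 ≤ c i * lam i)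
    (x : Fin d → ℕ) :
    poissonLaw c lam {x} = ∏ i, ENNReal.ofReal (poissonWeight (c i) (lam i) (x i)) := by
  rw [poissonLaw_singleton c lam h, ENNReal.ofReal_prod_of_nonneg]
  · rfl
  · exact fun i _ => poissonWeight_nonneg (h i) _

theorem measurable_poissonLaw_singleton {d : ℕ} (c : Fin d → ℝ) (x : Fin d → ℕ) :
    Measurable fun lam => poissonLaw c lam {x} := by
  have e : (fun lam => poissonLaw c lam {x}) = fun lam : Fin d → ℝ => ∏ i,
      ENNReal.ofReal (Real.exp (-((c i * lam i).toNNReal : ℝ))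
        * ((c i * lam i).toNNReal : ℝ) ^ x i / (x i).factorial) := by
    funext lam
    rw [poissonLaw, Measure.pi_singleton]
    exact Finset.prod_congr rfl fun i _ => ProbabilityTheory.poissonMeasure_singleton _ _
  rw [e]
  fun_prop

theorem poissonLaw_singleton_pos {d : ℕ} {c lam : Fin d → ℝ} (h : ∀ i, 0 < c i * lam i)
    (x : Fin d → ℕ) : 0 < poissonLaw c lam {x} := by
  rw [poissonLaw_singleton_eq_prod fun i => (h i).le]
  exact CanonicallyOrderedAdd.prod_pos.2 fun i _ => ENNReal.ofReal_pos.2 (poissonWeight_pos (h i) _)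

/-- The binomial weight of splitting `k + l` events into `k` events at rate `r` and `l` events
at rate `s`. -/
noncomputable def splitWeight (r s : ℝ) (k l : ℕ) : ℝ :=
  ((k + l).choose k : ℝ) * r ^ k * s ^ l / (r + s) ^ (k + l)

theorem splitWeight_pos {r s : ℝ} (hr : 0 < r) (hs : 0 < s) (k l : ℕ) : 0 < splitWeight r s k l := by
  have : 0 < (k + l).choose k := Nat.choose_pos (Nat.le_add_right k l)
  unfold splitWeight
  positivity

/-- Given its sum, a pair of independent Poisson variables is binomially split with probabilities
free of the intensity. -/
theorem poissonWeight_mul {r s : ℝ} (hr : 0 < r) (hs : 0 < s) (lam : ℝ) (k l : ℕ) :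
    poissonWeight r lam k * poissonWeight s lam l
      = splitWeight r s k l * poissonWeight (r + s) lam (k + l) := by
  have h := Nat.add_choose_mul_factorial_mul_factorial k l
  have h' : (((k + l).choose k : ℕ) : ℝ) * k.factorial * l.factorial = (k + l).factorial := by
    rw [Nat.choose_symm_add]; exact_mod_cast h
  have hrs : 0 < r + s := by positivity
  unfold poissonWeight splitWeight
  rw [← h']
  have : 0 < (k + l).choose k := Nat.choose_pos (Nat.le_add_right k l)
  have hc : (((k + l).choose k : ℕ) : ℝ) ≠ 0 := by positivity
  have e : Real.exp (-((r + s) * lam)) = Real.exp (-(r * lam)) * Real.exp (-(s * lam)) := by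
    rw [← Real.exp_add]; congr 1; ring
  rw [e]
  simp only [mul_pow, pow_add]
  field_simp

/-- The product of the binomial weights of all coordinates. -/
noncomputable def splitProd {d : ℕ} (r s : Fin d → ℝ) (x y : Fin d → ℕ) : ℝ≥0∞ :=
  ∏ i, ENNReal.ofReal (splitWeight (r i) (s i) (x i) (y i))

theorem poissonLaw_mul {d : ℕ} {r s lam : Fin d → ℝ} (hr : ∀ i, 0 < r i) (hs : ∀ i, 0 < s i)
    (hl : ∀ i, 0 ≤ lam i) (x y : Fin d → ℕ) :
    poissonLaw r lam {x} * poissonLaw s lam {y}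
      = splitProd r s x y * poissonLaw (r + s) lam {x + y} := by
  have h1 := fun i => mul_nonneg (hr i).le (hl i)
  have h2 := fun i => mul_nonneg (hs i).le (hl i)
  have h3 : ∀ i, 0 ≤ (r + s) i * lam i := fun i =>
    mul_nonneg (add_pos (hr i) (hs i)).le (hl i)
  rw [poissonLaw_singleton_eq_prod h1, poissonLaw_singleton_eq_prod h2,
    poissonLaw_singleton_eq_prod h3, splitProd, ← Finset.prod_mul_distrib,
    ← Finset.prod_mul_distrib]
  refine Finset.prod_congr rfl fun i _ => ?_
  rw [← ENNReal.ofReal_mul (poissonWeight_nonneg (h1 i) _),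
    ← ENNReal.ofReal_mul (splitWeight_pos (hr i) (hs i) _ _).le, poissonWeight_mul (hr i) (hs i)]
  rfl

theorem splitProd_ne_zero {d : ℕ} {r s : Fin d → ℝ} (hr : ∀ i, 0 < r i) (hs : ∀ i, 0 < s i)
    (x y : Fin d → ℕ) : splitProd r s x y ≠ 0 :=
  (CanonicallyOrderedAdd.prod_pos.2 fun i _ =>
    ENNReal.ofReal_pos.2 (splitWeight_pos (hr i) (hs i) _ _)).ne'

theorem splitProd_ne_top {d : ℕ} (r s : Fin d → ℝ) (x y : Fin d → ℕ) : splitProd r s x y ≠ ∞ :=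
  ENNReal.prod_ne_top fun _ _ => ENNReal.ofReal_ne_top

/-- Summation over pairs of multi-indices according to their sum. -/
theorem tsum_tsum_eq_tsum_sum_antidiagonal {d : ℕ} (F : (Fin d → ℕ) → (Fin d → ℕ) → ℝ≥0∞) :
    ∑' x, ∑' y, F x y = ∑' z : Fin d → ℕ,
      ∑ p ∈ Fintype.piFinset (fun i => Finset.HasAntidiagonal.antidiagonal (z i)),
        F (fun i => (p i).1) (fun i => (p i).2) := by
  have e1 : ∑' x, ∑' y, F x y = ∑' p : Fin d → ℕ × ℕ, F (fun i => (p i).1) (fun i => (p i).2) := by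
    rw [← ENNReal.tsum_prod, ← (Equiv.arrowProdEquivProdArrow (Fin d) (fun _ => ℕ) (fun _ => ℕ)).tsum_eq]
    rfl
  have e2 : ∀ p : Fin d → ℕ × ℕ, F (fun i => (p i).1) (fun i => (p i).2)
      = ∑' z : Fin d → ℕ, if p ∈ Fintype.piFinset (fun i => Finset.HasAntidiagonal.antidiagonal (z i)) then
        F (fun i => (p i).1) (fun i => (p i).2) else 0 := by
    intro p
    rw [tsum_eq_single (fun i => (p i).1 + (p i).2)]
    · rw [if_pos (by simp)]
    · intro z hz
      rw [if_neg]
      intro h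
      apply hz
      funext i
      have := Fintype.mem_piFinset.1 h i
      exact (Finset.HasAntidiagonal.mem_antidiagonal.1 this).symm
  rw [e1, tsum_congr e2, ENNReal.tsum_comm]
  refine tsum_congr fun z => ?_
  rw [tsum_eq_sum (s := Fintype.piFinset (fun i => Finset.HasAntidiagonal.antidiagonal (z i)))]
  · exact Finset.sum_congr rfl fun p hp => if_pos hp
  · exact fun p hp => if_neg hp

/-! ### Marginals, Bayesian predictive distributions and the domination criterion -/

/-- The marginal mass function of the observation under a prior. -/
noncomputable def priorMarginal {d : ℕ} (c : Fin d → ℝ) (prior : Measure (Fin d → ℝ))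
    (x : Fin d → ℕ) : ℝ≥0∞ := ∫⁻ lam, poissonLaw c lam {x} ∂prior

theorem lintegral_poissonLaw_mul {d : ℕ} {r s : Fin d → ℝ} (hr : ∀ i, 0 < r i)
    (hs : ∀ i, 0 < s i) {prior : Measure (Fin d → ℝ)} (hp : ∀ᵐ lam ∂prior, ∀ i, 0 < lam i)
    (x y : Fin d → ℕ) :
    ∫⁻ lam, poissonLaw r lam {x} * poissonLaw s lam {y} ∂prior
      = splitProd r s x y * priorMarginal (r + s) prior (x + y) := by
  rw [priorMarginal, ← lintegral_const_mul _ (measurable_poissonLaw_singleton _ _)]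
  refine lintegral_congr_ae ?_
  filter_upwards [hp] with lam h
  exact poissonLaw_mul hr hs (fun i => (h i).le) x y

theorem bayesPredictive_singleton {d : ℕ} {r s : Fin d → ℝ} (hr : ∀ i, 0 < r i)
    (hs : ∀ i, 0 < s i) {prior : Measure (Fin d → ℝ)} (hp : ∀ᵐ lam ∂prior, ∀ i, 0 < lam i)
    (x y : Fin d → ℕ) :
    bayesPredictive r s prior x {y}
      = splitProd r s x y * priorMarginal (r + s) prior (x + y) / priorMarginal r prior x := by
  rw [bayesPredictive, withDensity_apply _ (measurableSet_singleton y), lintegral_singleton,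
    Measure.count_singleton, mul_one, lintegral_poissonLaw_mul hr hs hp]
  rfl

theorem tsum_poissonLaw {d : ℕ} (c lam : Fin d → ℝ) : ∑' x, poissonLaw c lam {x} = 1 := by
  have := lintegral_countable' (μ := poissonLaw c lam) (fun _ => (1 : ℝ≥0∞))
  simpa using this.symm

theorem isPredictive_bayesPredictive {d : ℕ} {r s : Fin d → ℝ} {prior : Measure (Fin d → ℝ)}
    (h0 : ∀ x, priorMarginal r prior x ≠ 0) (h1 : ∀ x, priorMarginal r prior x ≠ ∞) :
    IsPredictive (bayesPredictive r s prior) := by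
  refine fun x => ⟨?_⟩
  rw [bayesPredictive, withDensity_apply _ MeasurableSet.univ, Measure.restrict_univ,
    lintegral_count]
  simp_rw [div_eq_mul_inv]
  have hm : ∀ y, AEMeasurable (fun lam => poissonLaw r lam {x} * poissonLaw s lam {y}) prior :=
    fun y => ((measurable_poissonLaw_singleton r x).mul
      (measurable_poissonLaw_singleton s y)).aemeasurable
  rw [ENNReal.tsum_mul_right, ← lintegral_tsum hm]
  simp_rw [ENNReal.tsum_mul_left, tsum_poissonLaw, mul_one]
  exact ENNReal.mul_inv_cancel (h0 x) (h1 x)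

/-- The prior based on `B` dominates the one based on `A` as soon as the ratio of marginals
is strictly increased by one step of the binomial averaging. -/
theorem klRisk_lt_of_marginal_ratio {d : ℕ} {r s : Fin d → ℝ} (hr : ∀ i, 0 < r i)
    (hs : ∀ i, 0 < s i) {A B : Measure (Fin d → ℝ)} (hA : ∀ᵐ lam ∂A, ∀ i, 0 < lam i)
    (hB : ∀ᵐ lam ∂B, ∀ i, 0 < lam i)
    (hA0 : ∀ c : Fin d → ℝ, (∀ i, 0 < c i) → ∀ x, priorMarginal c A x ≠ 0)
    (hA1 : ∀ c : Fin d → ℝ, (∀ i, 0 < c i) → ∀ x, priorMarginal c A x ≠ ∞)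
    (hB0 : ∀ c : Fin d → ℝ, (∀ i, 0 < c i) → ∀ x, priorMarginal c B x ≠ 0)
    (hB1 : ∀ c : Fin d → ℝ, (∀ i, 0 < c i) → ∀ x, priorMarginal c B x ≠ ∞)
    (hkey : ∀ z : Fin d → ℕ, ∑ p ∈ Fintype.piFinset (fun i => Finset.HasAntidiagonal.antidiagonal (z i)),
      splitProd r s (fun i => (p i).1) (fun i => (p i).2) *
        (priorMarginal r B (fun i => (p i).1) / priorMarginal r A (fun i => (p i).1))
      < priorMarginal (r + s) B z / priorMarginal (r + s) A z)
    {lam : Fin d → ℝ} (hl : ∀ i, 0 < lam i)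
    (hfin : klRisk r s (bayesPredictive r s A) lam ≠ ∞) :
    klRisk r s (bayesPredictive r s B) lam < klRisk r s (bayesPredictive r s A) lam := by
  have hrs : ∀ i, 0 < (r + s) i := fun i => add_pos (hr i) (hs i)
  have hpos : ∀ {C : Measure (Fin d → ℝ)} (_ : ∀ᵐ lam ∂C, ∀ i, 0 < lam i)
      (_ : ∀ c : Fin d → ℝ, (∀ i, 0 < c i) → ∀ x, priorMarginal c C x ≠ 0)
      (_ : ∀ c : Fin d → ℝ, (∀ i, 0 < c i) → ∀ x, priorMarginal c C x ≠ ∞) (x y : Fin d → ℕ),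
      bayesPredictive r s C x {y} ≠ 0 := fun hC h0 h1 x y => by
    rw [bayesPredictive_singleton hr hs hC]
    exact ENNReal.div_ne_zero.2 ⟨mul_ne_zero (splitProd_ne_zero hr hs x y) (h0 _ hrs _), h1 _ hr _⟩
  have hmain := klRisk_add_two_le r s lam _ _
    (isPredictive_bayesPredictive (s := s) (hA0 r hr) (hA1 r hr))
    (isPredictive_bayesPredictive (s := s) (hB0 r hr) (hB1 r hr)) (hpos hA hA0 hA1) (hpos hB hB0 hB1)
  -- Grouping by z = x + y, the binomial weights of the two predictive distributions cancel and one
  -- is restored by the likelihood; the hypothesis then bounds each group by the Poisson probability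
  -- of z.
  have hratio : ∑' x, poissonLaw r lam {x} * ∑' y, poissonLaw s lam {y} *
      (bayesPredictive r s A x {y} / bayesPredictive r s B x {y}) < 1 := by
    simp_rw [← ENNReal.tsum_mul_left]
    rw [tsum_tsum_eq_tsum_sum_antidiagonal]
    have hterm : ∀ z : Fin d → ℕ, ∑ p ∈ Fintype.piFinset (fun i => Finset.HasAntidiagonal.antidiagonal (z i)),
        poissonLaw r lam {fun i => (p i).1} * (poissonLaw s lam {fun i => (p i).2} *
          (bayesPredictive r s A (fun i => (p i).1) {fun i => (p i).2}
            / bayesPredictive r s B (fun i => (p i).1) {fun i => (p i).2}))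
        < poissonLaw (r + s) lam {z} := by
      intro z
      have hz : ∀ p ∈ Fintype.piFinset (fun i => Finset.HasAntidiagonal.antidiagonal (z i)),
          poissonLaw r lam {fun i => (p i).1} * (poissonLaw s lam {fun i => (p i).2} *
          (bayesPredictive r s A (fun i => (p i).1) {fun i => (p i).2}
            / bayesPredictive r s B (fun i => (p i).1) {fun i => (p i).2}))
          = poissonLaw (r + s) lam {z} *
            (priorMarginal (r + s) A z / priorMarginal (r + s) B z) *
            (splitProd r s (fun i => (p i).1) (fun i => (p i).2) *
            (priorMarginal r B (fun i => (p i).1) / priorMarginal r A (fun i => (p i).1))) := by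
        intro p hp
        have hpz : (fun i => (p i).1) + (fun i => (p i).2) = z := by
          funext i
          simpa using Fintype.mem_piFinset.1 hp i
        rw [← mul_assoc, poissonLaw_mul hr hs (fun i => (hl i).le), hpz,
          bayesPredictive_singleton hr hs hA, bayesPredictive_singleton hr hs hB, hpz]
        generalize hS : splitProd r s (fun i => (p i).1) (fun i => (p i).2) = S
        have hS0 : S ≠ 0 := hS ▸ splitProd_ne_zero hr hs _ _
        have hS1 : S ≠ ∞ := hS ▸ splitProd_ne_top _ _ _ _
        have a0 := hA0 r hr (fun i => (p i).1)
        have a1 := hA1 r hr (fun i => (p i).1)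
        have b0 := hB0 r hr (fun i => (p i).1)
        have b1 := hB1 r hr (fun i => (p i).1)
        have c0 := hB0 (r + s) hrs z
        have c1 := hB1 (r + s) hrs z
        generalize priorMarginal r A (fun i => (p i).1) = a at *
        generalize priorMarginal r B (fun i => (p i).1) = b at *
        generalize priorMarginal (r + s) B z = c at *
        generalize priorMarginal (r + s) A z = e at *
        have h1 : (S * e / a) / (S * c / b) = (e / c) * (b / a) := by
          simp only [div_eq_mul_inv]
          rw [ENNReal.mul_inv (Or.inr (ENNReal.inv_ne_top.2 b0)) (Or.inr (ENNReal.inv_ne_zero.2 b1)),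
            ENNReal.mul_inv (Or.inl hS0) (Or.inl hS1), inv_inv]
          calc S * e * a⁻¹ * (S⁻¹ * c⁻¹ * b) = (S * S⁻¹) * (e * c⁻¹ * (b * a⁻¹)) := by ring
            _ = _ := by rw [ENNReal.mul_inv_cancel hS0 hS1, one_mul]
        rw [h1]
        ring
      rw [Finset.sum_congr rfl hz, ← Finset.mul_sum]
      have a0 := hA0 (r + s) hrs z
      have a1 := hA1 (r + s) hrs z
      have b0 := hB0 (r + s) hrs z
      have b1 := hB1 (r + s) hrs z
      have hP0 : poissonLaw (r + s) lam {z} ≠ 0 :=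
        (poissonLaw_singleton_pos (fun i => mul_pos (hrs i) (hl i)) z).ne'
      have hP1 : poissonLaw (r + s) lam {z} ≠ ∞ := measure_ne_top _ _
      calc _ < poissonLaw (r + s) lam {z} * (priorMarginal (r + s) A z / priorMarginal (r + s) B z)
            * (priorMarginal (r + s) B z / priorMarginal (r + s) A z) := by
            refine ENNReal.mul_lt_mul_right ?_ ?_ (hkey z)
            · exact mul_ne_zero hP0 (ENNReal.div_ne_zero.2 ⟨a0, b1⟩)
            · exact ENNReal.mul_ne_top hP1 (ENNReal.div_ne_top a1 b0)
        _ = poissonLaw (r + s) lam {z} := by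
            rw [mul_assoc, ← ENNReal.inv_div (Or.inl a1) (Or.inl a0),
              ENNReal.inv_mul_cancel (ENNReal.div_ne_zero.2 ⟨b0, a1⟩) (ENNReal.div_ne_top b1 a0),
              mul_one]
    have hle := ENNReal.tsum_le_tsum fun z => (hterm z).le
    rw [← tsum_poissonLaw (r + s) lam]
    refine ENNReal.tsum_lt_tsum ?_ (fun z => (hterm z).le) (hterm 0)
    exact ne_top_of_le_ne_top (by rw [tsum_poissonLaw]; exact ENNReal.one_ne_top) hle
  have h2 : klRisk r s (bayesPredictive r s B) lam + 2 < klRisk r s (bayesPredictive r s A) lam + 2 := by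
    refine hmain.trans_lt ?_
    rw [show (2 : ℝ≥0∞) = 1 + 1 by norm_num, ← add_assoc]
    exact ENNReal.add_lt_add_left (ENNReal.add_ne_top.2 ⟨hfin, ENNReal.one_ne_top⟩) hratio
  exact (ENNReal.add_lt_add_iff_right (by norm_num)).1 h2

/-! ### The Jeffreys prior in square-root coordinates -/

theorem lintegral_pi_prod {d : ℕ} (μ : Fin d → Measure ℝ) [∀ i, SigmaFinite (μ i)]
    {f : Fin d → ℝ → ℝ≥0∞} (hf : ∀ i, Measurable (f i)) :
    ∫⁻ x, ∏ i, f i (x i) ∂(Measure.pi μ) = ∏ i, ∫⁻ t, f i t ∂(μ i) := by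
  induction d with
  | zero => simp
  | succ n ih =>
    rw [← ((measurePreserving_piFinSuccAbove μ 0).symm).lintegral_comp (by fun_prop)]
    simp_rw [MeasurableEquiv.piFinSuccAbove_symm_apply, Fin.insertNthEquiv,
      Fin.prod_univ_succ, Fin.insertNth_zero]
    simp only [Fin.zero_succAbove, Equiv.coe_fn_mk, Fin.cons_zero, Fin.cons_succ, cast_eq]
    have hm : Measurable fun y : Fin n → ℝ => ∏ i, f i.succ (y i) :=
      Finset.measurable_prod _ fun i _ => (hf i.succ).comp (measurable_pi_apply i)
    rw [lintegral_prod_mul (f := f 0) (g := fun y : Fin n → ℝ => ∏ i, f i.succ (y i))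
      (hf 0).aemeasurable hm.aemeasurable, ih (fun i => μ i.succ) (fun i => hf i.succ)]

/-- The one-dimensional Jeffreys measure. -/
noncomputable def jeffreysMeasure : Measure ℝ :=
  (volume.restrict (Set.Ioi 0)).withDensity fun l => ENNReal.ofReal (l ^ (-(1 / 2) : ℝ))

instance : SigmaFinite jeffreysMeasure := by
  unfold jeffreysMeasure; infer_instance

theorem jeffreysPrior_eq_pi (d : ℕ) : jeffreysPrior d = Measure.pi fun _ => jeffreysMeasure := by
  symm
  refine Measure.pi_eq fun s hs => ?_
  have horth : MeasurableSet {lam : Fin d → ℝ | ∀ i, 0 < lam i} := by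
    rw [show {lam : Fin d → ℝ | ∀ i, 0 < lam i} = Set.pi Set.univ fun _ => Set.Ioi 0 by
      ext; simp]
    exact MeasurableSet.univ_pi fun _ => measurableSet_Ioi
  have hbox : MeasurableSet (Set.pi Set.univ s) := MeasurableSet.univ_pi hs
  rw [jeffreysPrior, withDensity_apply _ hbox, Measure.restrict_restrict hbox,
    ← lintegral_indicator (hbox.inter horth)]
  have e : ∀ i, jeffreysMeasure (s i)
      = ∫⁻ l, (s i ∩ Set.Ioi 0).indicator (fun l => ENNReal.ofReal (l ^ (-(1 / 2) : ℝ))) l := by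
    intro i
    rw [jeffreysMeasure, withDensity_apply _ (hs i), Measure.restrict_restrict (hs i),
      lintegral_indicator ((hs i).inter measurableSet_Ioi)]
  simp_rw [e]
  rw [← lintegral_pi_prod (fun _ => volume) (fun i => Measurable.indicator (by fun_prop)
    ((hs i).inter measurableSet_Ioi)), ← volume_pi]
  refine lintegral_congr fun lam => ?_
  by_cases h : lam ∈ Set.pi Set.univ s ∩ {lam : Fin d → ℝ | ∀ i, 0 < lam i}
  · rw [Set.indicator_of_mem h, ENNReal.ofReal_prod_of_nonneg
      fun i _ => Real.rpow_nonneg (h.2 i).le _]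
    refine Finset.prod_congr rfl fun i _ => ?_
    exact (Set.indicator_of_mem (show lam i ∈ s i ∩ Set.Ioi 0 from ⟨h.1 i (Set.mem_univ i), h.2 i⟩)
      fun l : ℝ => ENNReal.ofReal (l ^ (-(1 / 2) : ℝ))).symm
  · rw [Set.indicator_of_notMem h]
    symm
    have : ∃ i, lam i ∉ s i ∩ Set.Ioi 0 := by
      by_contra hcon
      push Not at hcon
      exact h ⟨fun i _ => (hcon i).1, fun i => (hcon i).2⟩
    obtain ⟨i, hi⟩ := this
    exact Finset.prod_eq_zero (Finset.mem_univ i) (Set.indicator_of_notMem hi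
      fun l : ℝ => ENNReal.ofReal (l ^ (-(1 / 2) : ℝ)))

theorem ae_jeffreysPrior_pos (d : ℕ) : ∀ᵐ lam ∂(jeffreysPrior d), ∀ i, 0 < lam i := by
  unfold jeffreysPrior
  have horth : MeasurableSet {lam : Fin d → ℝ | ∀ i, 0 < lam i} := by
    rw [show {lam : Fin d → ℝ | ∀ i, 0 < lam i} = Set.pi Set.univ fun _ => Set.Ioi 0 by
      ext; simp]
    exact MeasurableSet.univ_pi fun _ => measurableSet_Ioi
  exact (withDensity_absolutelyContinuous _ _).ae_le (ae_restrict_mem horth)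

theorem lintegral_even_eq_two_mul (φ : ℝ → ℝ≥0∞) (h : ∀ t, φ (-t) = φ t) :
    ∫⁻ t, φ t = 2 * ∫⁻ t in Set.Ioi 0, φ t := by
  rw [← lintegral_add_compl φ (measurableSet_Ioi (a := (0 : ℝ))), Set.compl_Ioi, two_mul,
    setLIntegral_congr (Iio_ae_eq_Iic (μ := volume) (a := (0 : ℝ))).symm]
  congr 1
  have := (Measure.measurePreserving_neg (volume : Measure ℝ)).setLIntegral_comp_preimage_emb
    (MeasurableEquiv.neg ℝ).measurableEmbedding φ (Set.Iio 0)
  rw [← this]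
  simp [h]

/-- In the coordinate `θ` with `l = γ θ²` the Jeffreys measure is a multiple of Lebesgue
measure. -/
theorem lintegral_jeffreysMeasure {γ : ℝ} (hγ : 0 < γ) {φ : ℝ → ℝ≥0∞} (hφ : Measurable φ) :
    ∫⁻ l, φ l ∂jeffreysMeasure = ENNReal.ofReal (Real.sqrt γ) * ∫⁻ t, φ (γ * t ^ 2) := by
  rw [lintegral_even_eq_two_mul _ (fun t => by simp), jeffreysMeasure,
    lintegral_withDensity_eq_lintegral_mul _ (by fun_prop) hφ]
  have himg : (fun t : ℝ => γ * t ^ 2) '' Set.Ioi 0 = Set.Ioi 0 := by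
    ext l
    constructor
    · rintro ⟨t, ht, rfl⟩
      have ht : 0 < t := ht
      exact Set.mem_Ioi.2 (by positivity)
    · intro hl
      have hl : 0 < l := hl
      refine ⟨Real.sqrt (l / γ), Real.sqrt_pos.2 (by positivity), ?_⟩
      simp only
      rw [Real.sq_sqrt (by positivity)]
      field_simp
  -- For l = γt² with t > 0 one has dl/√l = 2√γ dt; the factor 2 is absorbed by integrating the even
  -- function over the whole line.
  have h := lintegral_image_eq_lintegral_abs_deriv_mul (s := Set.Ioi (0 : ℝ))
    (f := fun t : ℝ => γ * t ^ 2) (f' := fun t => γ * (2 * t)) measurableSet_Ioi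
    (fun t _ => by simpa using (((hasDerivAt_pow 2 t).const_mul γ).hasDerivWithinAt))
    (fun a ha b hb hab => by
      have ha : 0 < a := ha
      have hb : 0 < b := hb
      have : a ^ 2 = b ^ 2 := mul_left_cancel₀ hγ.ne' hab
      exact (pow_left_inj₀ ha.le hb.le two_ne_zero).1 this)
    (fun l => ENNReal.ofReal (l ^ (-(1 / 2) : ℝ)) * φ l)
  rw [himg] at h
  simp only [Pi.mul_apply]
  rw [h, ← mul_assoc, ← lintegral_const_mul _ (by fun_prop)]
  refine setLIntegral_congr_fun measurableSet_Ioi fun t ht => ?_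
  have ht : 0 < t := ht
  rw [← mul_assoc, ← ENNReal.ofReal_mul (abs_nonneg _)]
  congr 1
  rw [abs_of_pos (by positivity), Real.rpow_neg (by positivity), ← Real.sqrt_eq_rpow,
    Real.sqrt_mul hγ.le, Real.sqrt_sq ht.le,
    show (2 : ℝ≥0∞) = ENNReal.ofReal 2 by simp, ← ENNReal.ofReal_mul (Real.sqrt_nonneg _)]
  congr 1
  have hs : Real.sqrt γ ≠ 0 := (Real.sqrt_pos.2 hγ).ne'
  field_simp
  rw [Real.sq_sqrt hγ.le]

theorem lintegral_jeffreysPrior {d : ℕ} {γ : Fin d → ℝ} (hγ : ∀ i, 0 < γ i)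
    {φ : (Fin d → ℝ) → ℝ≥0∞} (hφ : Measurable φ) :
    ∫⁻ lam, φ lam ∂(jeffreysPrior d)
      = (∏ i, ENNReal.ofReal (Real.sqrt (γ i))) * ∫⁻ θ : Fin d → ℝ, φ fun i => γ i * θ i ^ 2 := by
  have hm : Measurable fun (θ : Fin d → ℝ) i => γ i * θ i ^ 2 := by fun_prop
  have h : jeffreysPrior d = (∏ i, ENNReal.ofReal (Real.sqrt (γ i))) •
      (volume : Measure (Fin d → ℝ)).map fun θ i => γ i * θ i ^ 2 := by
    rw [jeffreysPrior_eq_pi]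
    refine Measure.pi_eq fun s hs => ?_
    have hpre : (fun (θ : Fin d → ℝ) i => γ i * θ i ^ 2) ⁻¹' Set.pi Set.univ s
        = Set.pi Set.univ fun i => (fun t : ℝ => γ i * t ^ 2) ⁻¹' s i := by
      ext; simp
    rw [Measure.smul_apply, Measure.map_apply hm (MeasurableSet.univ_pi hs), hpre, volume_pi,
      Measure.pi_pi, smul_eq_mul, ← Finset.prod_mul_distrib]
    refine Finset.prod_congr rfl fun i _ => ?_
    have hmi : Measurable fun t : ℝ => γ i * t ^ 2 := by fun_prop
    have := lintegral_jeffreysMeasure (hγ i) (φ := (s i).indicator 1)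
      (measurable_one.indicator (hs i))
    rw [lintegral_indicator_one (hs i)] at this
    rw [this, ← lintegral_indicator_one (hmi (hs i))]
    rfl
  rw [h, lintegral_smul_measure, lintegral_map hφ hm, smul_eq_mul]

/-! ### Gaussian smoothing of Riesz kernels -/

theorem lintegral_rpow_mul_exp_neg {a c : ℝ} (ha : 0 < a) (hc : 0 < c) :
    ∫⁻ t in Set.Ioi 0, ENNReal.ofReal (t ^ (a - 1) * Real.exp (-(c * t)))
      = ENNReal.ofReal ((1 / c) ^ a * Real.Gamma a) := by
  have h := Real.integral_rpow_mul_exp_neg_mul_Ioi ha hc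
  have hpos : 0 < (1 / c) ^ a * Real.Gamma a := by
    have := Real.Gamma_pos_of_pos ha
    positivity
  have hi : Integrable (fun t : ℝ => t ^ (a - 1) * Real.exp (-(c * t)))
      (volume.restrict (Set.Ioi 0)) := by
    by_contra hcon
    rw [integral_undef hcon] at h
    exact hpos.ne h
  rw [← h, ofReal_integral_eq_lintegral_ofReal hi]
  exact (ae_restrict_iff' measurableSet_Ioi).2 (Filter.Eventually.of_forall fun t ht => by
    have ht : 0 < t := ht
    simp only [Pi.zero_apply]
    positivity)

theorem lintegral_gaussian_centered {b : ℝ} (hb : 0 < b) (m : ℝ) :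
    ∫⁻ t : ℝ, ENNReal.ofReal (Real.exp (-b * (t - m) ^ 2)) = ENNReal.ofReal (Real.sqrt (Real.pi / b)) := by
  rw [lintegral_sub_right_eq_self (fun t : ℝ => ENNReal.ofReal (Real.exp (-b * t ^ 2))) m,
    ← integral_gaussian, ofReal_integral_eq_lintegral_ofReal (integrable_exp_neg_mul_sq hb)
    (Filter.Eventually.of_forall fun t => (Real.exp_pos _).le)]

/-- The density of the normal law with variance `1 / (2 δ)`. -/
noncomputable def gaussKernel (δ t m : ℝ) : ℝ := Real.sqrt (δ / Real.pi) * Real.exp (-δ * (t - m) ^ 2)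

theorem gaussKernel_nonneg (δ t m : ℝ) : 0 ≤ gaussKernel δ t m := by
  unfold gaussKernel; positivity

/-- Completing the square about (uη + δm)/(u + δ). The smoothed Gaussian is again Gaussian, with
rate uδ/(u+δ) < δ. -/
theorem lintegral_exp_mul_gaussKernel {u δ : ℝ} (hu : 0 < u) (hδ : 0 < δ) (η m : ℝ) :
    ∫⁻ t : ℝ, ENNReal.ofReal (Real.exp (-u * (t - η) ^ 2) * gaussKernel δ t m)
      = ENNReal.ofReal (Real.sqrt (δ / (u + δ)) * Real.exp (-(u * δ / (u + δ)) * (m - η) ^ 2)) := by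
  have e : ∀ t : ℝ, Real.exp (-u * (t - η) ^ 2) * gaussKernel δ t m
      = (Real.sqrt (δ / Real.pi) * Real.exp (-(u * δ / (u + δ)) * (m - η) ^ 2))
        * Real.exp (-(u + δ) * (t - (u * η + δ * m) / (u + δ)) ^ 2) := by
    intro t
    unfold gaussKernel
    rw [mul_left_comm, mul_assoc, ← Real.exp_add, ← Real.exp_add]
    congr 2
    field_simp
    ring
  simp_rw [e, ENNReal.ofReal_mul (show 0 ≤ Real.sqrt (δ / Real.pi) *
    Real.exp (-(u * δ / (u + δ)) * (m - η) ^ 2) by positivity)]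
  rw [lintegral_const_mul _ (by fun_prop), lintegral_gaussian_centered (by positivity),
    ← ENNReal.ofReal_mul (by positivity), mul_right_comm, ← Real.sqrt_mul (by positivity)]
  congr 3
  have := Real.pi_pos
  field_simp

/-- The squared Euclidean distance. -/
def sqDist {d : ℕ} (θ η : Fin d → ℝ) : ℝ := ∑ i, (θ i - η i) ^ 2

theorem sqDist_nonneg {d : ℕ} (θ η : Fin d → ℝ) : 0 ≤ sqDist θ η :=
  Finset.sum_nonneg fun _ _ => sq_nonneg _

theorem sqDist_pos {d : ℕ} {θ η : Fin d → ℝ} (h : θ ≠ η) : 0 < sqDist θ η := by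
  obtain ⟨i, hi⟩ := Function.ne_iff.1 h
  exact Finset.sum_pos' (fun _ _ => sq_nonneg _)
    ⟨i, Finset.mem_univ i, by have := sub_ne_zero.2 hi; positivity⟩

theorem continuous_sqDist {d : ℕ} (η : Fin d → ℝ) : Continuous fun θ => sqDist θ η := by
  unfold sqDist; fun_prop

/-- The power `|θ - η|^(-2α)` of the Euclidean distance. -/
noncomputable def rieszKernel {d : ℕ} (α : ℝ) (η θ : Fin d → ℝ) : ℝ≥0∞ :=
  ENNReal.ofReal (sqDist θ η) ^ (-α)

theorem measurable_rieszKernel {d : ℕ} (α : ℝ) (η : Fin d → ℝ) : Measurable (rieszKernel α η) := by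
  have := (continuous_sqDist η).measurable
  unfold rieszKernel
  fun_prop

/-- `Γ(α) |θ - η|^(-2α)` as a mixture of Gaussians. -/
theorem gamma_mul_rieszKernel {d : ℕ} {α : ℝ} (hα : 0 < α) {η θ : Fin d → ℝ} (h : θ ≠ η) :
    ENNReal.ofReal (Real.Gamma α) * rieszKernel α η θ
      = ∫⁻ u in Set.Ioi 0, ENNReal.ofReal (u ^ (α - 1) * Real.exp (-(sqDist θ η * u))) := by
  have hρ := sqDist_pos h
  rw [lintegral_rpow_mul_exp_neg hα hρ, rieszKernel, ENNReal.ofReal_rpow_of_pos hρ,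
    ← ENNReal.ofReal_mul (Real.Gamma_pos_of_pos hα).le, one_div, Real.inv_rpow hρ.le,
    ← Real.rpow_neg hρ.le, mul_comm]

theorem lintegral_Ioo_rpow_substitution {δ : ℝ} (hδ : 0 < δ) (φ : ℝ → ℝ≥0∞) :
    ∫⁻ v in Set.Ioo 0 δ, φ v
      = ∫⁻ u in Set.Ioi 0, ENNReal.ofReal ((δ / (u + δ)) ^ 2) * φ (u * δ / (u + δ)) := by
  have himg : (fun u : ℝ => u * δ / (u + δ)) '' Set.Ioi 0 = Set.Ioo 0 δ := by
    ext v
    constructor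
    · rintro ⟨u, hu, rfl⟩
      have hu : 0 < u := hu
      refine ⟨by positivity, ?_⟩
      simp only
      rw [div_lt_iff₀ (by positivity)]
      nlinarith
    · rintro ⟨h0, h1⟩
      have h2 : 0 < δ - v := by linarith
      refine ⟨v * δ / (δ - v), Set.mem_Ioi.2 (by positivity), ?_⟩
      simp only
      field_simp
      ring
  have h := lintegral_image_eq_lintegral_abs_deriv_mul (s := Set.Ioi (0 : ℝ))
    (f := fun u : ℝ => u * δ / (u + δ)) (f' := fun u => (δ / (u + δ)) ^ 2) measurableSet_Ioi
    (fun u hu => by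
      have hu : 0 < u := hu
      have h1 := ((hasDerivAt_id u).mul_const δ).div ((hasDerivAt_id u).add_const δ)
        (show id u + δ ≠ 0 by simp only [id]; positivity)
      refine (h1.congr_deriv ?_).hasDerivWithinAt
      simp only [id]
      field_simp
      ring)
    (fun a ha b hb hab => by
      have ha : 0 < a := ha
      have hb : 0 < b := hb
      simp only at hab
      rw [div_eq_div_iff (by positivity) (by positivity)] at hab
      have : (a - b) * (δ * δ) = 0 := by linarith
      rcases mul_eq_zero.1 this with h | h
      · linarith
      · have : 0 < δ * δ := by positivity
        linarith) φ
  rw [himg] at h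
  rw [h]
  refine lintegral_congr fun u => ?_
  rw [abs_of_nonneg (by positivity)]

theorem ae_ne_pi {d : ℕ} (hd : 0 < d) (η : Fin d → ℝ) : ∀ᵐ θ : Fin d → ℝ, θ ≠ η := by
  have : Nonempty (Fin d) := ⟨⟨0, hd⟩⟩
  have : Nontrivial (Fin d → ℝ) := inferInstance
  exact Measure.ae_ne volume η

/-- Smoothing acts on each Gaussian of the mixture. In terms of the new rate v = uδ/(u+δ) the
mixture keeps a density at most v^(α-1) but lives on (0, δ) only: the missing tail v ≥ δ is the
strict loss of superharmonicity. -/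
theorem gamma_mul_lintegral_rieszKernel_le {d : ℕ} {α : ℝ} (hα : 0 < α)
    (hαd : α ≤ ((d : ℝ) - 2) / 2) {δ : ℝ} (hδ : 0 < δ) (η m : Fin d → ℝ) :
    ENNReal.ofReal (Real.Gamma α) *
        ∫⁻ θ : Fin d → ℝ, rieszKernel α η θ * ∏ i, ENNReal.ofReal (gaussKernel δ (θ i) (m i))
      ≤ ∫⁻ v in Set.Ioo 0 δ, ENNReal.ofReal (v ^ (α - 1) * Real.exp (-(sqDist m η * v))) := by
  have hd : 0 < d := by
    rcases Nat.eq_zero_or_pos d with h | h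
    · subst h; norm_num at hαd; linarith
    · exact h
  have hgm : ∀ i, Measurable fun θ : Fin d → ℝ => ENNReal.ofReal (gaussKernel δ (θ i) (m i)) :=
    fun i => by unfold gaussKernel; fun_prop
  have hmG : Measurable fun θ : Fin d → ℝ => ∏ i, ENNReal.ofReal (gaussKernel δ (θ i) (m i)) :=
    Finset.measurable_prod _ fun i _ => hgm i
  have hsq := (continuous_sqDist η).measurable
  calc ENNReal.ofReal (Real.Gamma α) *
        ∫⁻ θ : Fin d → ℝ, rieszKernel α η θ * ∏ i, ENNReal.ofReal (gaussKernel δ (θ i) (m i))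
      = ∫⁻ θ : Fin d → ℝ, ∫⁻ u in Set.Ioi 0,
          ENNReal.ofReal (u ^ (α - 1) * Real.exp (-(sqDist θ η * u))) *
            ∏ i, ENNReal.ofReal (gaussKernel δ (θ i) (m i)) := by
        have hmK : Measurable fun θ : Fin d → ℝ =>
            rieszKernel α η θ * ∏ i, ENNReal.ofReal (gaussKernel δ (θ i) (m i)) :=
          (measurable_rieszKernel α η).mul hmG
        rw [← lintegral_const_mul _ hmK]
        refine lintegral_congr_ae ?_
        filter_upwards [ae_ne_pi hd η] with θ hθ
        rw [← mul_assoc, gamma_mul_rieszKernel hα hθ, lintegral_mul_const _ (by fun_prop)]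
    _ = ∫⁻ u in Set.Ioi 0, ∫⁻ θ : Fin d → ℝ,
          ENNReal.ofReal (u ^ (α - 1) * Real.exp (-(sqDist θ η * u))) *
            ∏ i, ENNReal.ofReal (gaussKernel δ (θ i) (m i)) := by
        refine lintegral_lintegral_swap (Measurable.aemeasurable ?_)
        refine Measurable.mul ?_ (hmG.comp measurable_fst)
        have h2 : Measurable fun a : (Fin d → ℝ) × ℝ => sqDist a.1 η := hsq.comp measurable_fst
        exact ((measurable_snd.pow_const _).mul
          (Real.measurable_exp.comp (h2.mul measurable_snd).neg)).ennreal_ofReal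
    _ = ∫⁻ u in Set.Ioi 0, ENNReal.ofReal (u ^ (α - 1)) * ENNReal.ofReal
          ((δ / (u + δ)) ^ ((d : ℝ) / 2) * Real.exp (-(sqDist m η * (u * δ / (u + δ))))) := by
        refine setLIntegral_congr_fun measurableSet_Ioi fun u hu => ?_
        have hu : 0 < u := hu
        have e1 : ∀ θ : Fin d → ℝ, ENNReal.ofReal (u ^ (α - 1) * Real.exp (-(sqDist θ η * u))) *
            ∏ i, ENNReal.ofReal (gaussKernel δ (θ i) (m i)) = ENNReal.ofReal (u ^ (α - 1)) *
            ∏ i, ENNReal.ofReal (Real.exp (-u * (θ i - η i) ^ 2) * gaussKernel δ (θ i) (m i)) := by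
          intro θ
          rw [ENNReal.ofReal_mul (by positivity), mul_assoc]
          congr 1
          simp_rw [ENNReal.ofReal_mul (Real.exp_pos _).le]
          rw [Finset.prod_mul_distrib, ← ENNReal.ofReal_prod_of_nonneg
            (fun i _ => (Real.exp_pos _).le), ← Real.exp_sum]
          congr 3
          rw [sqDist, Finset.sum_mul, ← Finset.sum_neg_distrib]
          exact Finset.sum_congr rfl fun i _ => by ring
        have hfi : ∀ i : Fin d, Measurable fun t : ℝ =>
            ENNReal.ofReal (Real.exp (-u * (t - η i) ^ 2) * gaussKernel δ t (m i)) :=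
          fun i => by unfold gaussKernel; fun_prop
        simp_rw [e1]
        rw [lintegral_const_mul' _ _ ENNReal.ofReal_ne_top, volume_pi,
          lintegral_pi_prod (fun _ => volume) hfi]
        congr 1
        simp_rw [lintegral_exp_mul_gaussKernel hu hδ]
        rw [← ENNReal.ofReal_prod_of_nonneg (fun i _ => by positivity), Finset.prod_mul_distrib,
          ← Real.exp_sum, Finset.prod_const, Finset.card_univ, Fintype.card_fin]
        congr 2
        · rw [Real.sqrt_eq_rpow, ← Real.rpow_natCast, ← Real.rpow_mul (by positivity)]
          congr 1
          ring
        · congr 1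
          rw [sqDist, Finset.sum_mul, ← Finset.sum_neg_distrib]
          exact Finset.sum_congr rfl fun i _ => by ring
    _ ≤ ∫⁻ v in Set.Ioo 0 δ, ENNReal.ofReal (v ^ (α - 1) * Real.exp (-(sqDist m η * v))) := by
        rw [lintegral_Ioo_rpow_substitution hδ]
        refine setLIntegral_mono' measurableSet_Ioi fun u hu => ?_
        have hu : 0 < u := hu
        rw [← ENNReal.ofReal_mul (by positivity), ← ENNReal.ofReal_mul (by positivity)]
        refine ENNReal.ofReal_le_ofReal ?_
        rw [← mul_assoc, ← mul_assoc]
        refine mul_le_mul_of_nonneg_right ?_ (Real.exp_pos _).le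
        -- With w = dv-factor δ/(u+δ) ≤ 1 and v = uw, the claim becomes w^(d/2) ≤ w^(α+1). This is
        -- the one place where the exact threshold α ≤ (d-2)/2 is required.
        set w := δ / (u + δ) with hw
        have hw0 : 0 < w := by positivity
        have hw1 : w ≤ 1 := by rw [hw, div_le_one (by positivity)]; linarith
        rw [mul_div_assoc, ← hw, Real.mul_rpow hu.le hw0.le, ← mul_assoc, mul_comm (w ^ 2), mul_assoc]
        refine mul_le_mul_of_nonneg_left ?_ (by positivity)
        rw [← Real.rpow_natCast w 2, ← Real.rpow_add hw0]
        refine Real.rpow_le_rpow_of_exponent_ge hw0 hw1 ?_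
        push_cast
        linarith

theorem lintegral_rieszKernel_gauss_ne_top {d : ℕ} {α : ℝ} (hα : 0 < α)
    (hαd : α ≤ ((d : ℝ) - 2) / 2) {δ : ℝ} (hδ : 0 < δ) (η m : Fin d → ℝ) :
    ∫⁻ θ : Fin d → ℝ, rieszKernel α η θ * ∏ i, ENNReal.ofReal (gaussKernel δ (θ i) (m i)) ≠ ∞ := by
  have h := gamma_mul_lintegral_rieszKernel_le hα hαd hδ η m
  have hfin : ∫⁻ v in Set.Ioo 0 δ, ENNReal.ofReal (v ^ (α - 1) * Real.exp (-(sqDist m η * v))) ≠ ∞ := by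
    have h1 : ∫⁻ v in Set.Ioo 0 δ, ENNReal.ofReal (v ^ (α - 1) * Real.exp (-(sqDist m η * v)))
        ≤ ∫⁻ v in Set.Ioo 0 δ, ENNReal.ofReal (Real.exp δ * (v ^ (α - 1) * Real.exp (-(1 * v)))) := by
      refine setLIntegral_mono' measurableSet_Ioo fun v hv => ENNReal.ofReal_le_ofReal ?_
      have hv0 := hv.1
      rw [mul_left_comm, ← Real.exp_add]
      refine mul_le_mul_of_nonneg_left (Real.exp_le_exp.2 ?_) (by positivity)
      have := mul_nonneg (sqDist_nonneg m η) hv0.le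
      have := hv.2
      linarith
    have h2 : ∫⁻ v in Set.Ioo 0 δ, ENNReal.ofReal (Real.exp δ * (v ^ (α - 1) * Real.exp (-(1 * v))))
        ≤ ENNReal.ofReal (Real.exp δ) * ENNReal.ofReal ((1 / 1) ^ α * Real.Gamma α) := by
      rw [← lintegral_rpow_mul_exp_neg hα one_pos, ← lintegral_const_mul _ (by fun_prop)]
      simp_rw [ENNReal.ofReal_mul (Real.exp_pos δ).le]
      exact lintegral_mono_set fun v hv => hv.1
    exact ne_top_of_le_ne_top (ENNReal.mul_ne_top ENNReal.ofReal_ne_top ENNReal.ofReal_ne_top)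
      (h1.trans h2)
  intro hcon
  rw [hcon, ENNReal.mul_top (ENNReal.ofReal_pos.2 (Real.Gamma_pos_of_pos hα)).ne'] at h
  exact hfin (top_le_iff.1 h)

/-- The Gaussian average of the superharmonic function `|θ - η|^(-2α)` is strictly smaller than
its value at the centre. -/
theorem lintegral_rieszKernel_gauss_lt {d : ℕ} {α : ℝ} (hα : 0 < α)
    (hαd : α ≤ ((d : ℝ) - 2) / 2) {δ : ℝ} (hδ : 0 < δ) {η m : Fin d → ℝ} (hm : m ≠ η) :
    ∫⁻ θ : Fin d → ℝ, rieszKernel α η θ * ∏ i, ENNReal.ofReal (gaussKernel δ (θ i) (m i))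
      < rieszKernel α η m := by
  have h := gamma_mul_lintegral_rieszKernel_le hα hαd hδ η m
  have hρ := sqDist_pos hm
  have hG := Real.Gamma_pos_of_pos hα
  have h2 : ∫⁻ v in Set.Ioo 0 δ, ENNReal.ofReal (v ^ (α - 1) * Real.exp (-(sqDist m η * v)))
      < ENNReal.ofReal (Real.Gamma α) * rieszKernel α η m := by
    rw [gamma_mul_rieszKernel hα hm]
    -- The full mixture exceeds its part on (0, δ) by a tail integral that is already positive on
    -- (δ, δ+1).
    have hU : Set.Ioi (0 : ℝ) = Set.Ioo 0 δ ∪ Set.Ici δ := (Set.Ioo_union_Ici_eq_Ioi hδ).symm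
    have hdisj : Disjoint (Set.Ioo 0 δ) (Set.Ici δ) :=
      Set.disjoint_left.2 fun v hv hv' => not_lt.2 hv' hv.2
    have htot : ∫⁻ u in Set.Ioi 0, ENNReal.ofReal (u ^ (α - 1) * Real.exp (-(sqDist m η * u))) ≠ ∞ := by
      rw [lintegral_rpow_mul_exp_neg hα hρ]; exact ENNReal.ofReal_ne_top
    rw [hU, lintegral_union measurableSet_Ici hdisj] at htot ⊢
    refine ENNReal.lt_add_right (ne_top_of_le_ne_top htot le_self_add) ?_
    refine (setLIntegral_pos_iff (by fun_prop)).2 ?_ |>.ne'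
    refine lt_of_lt_of_le ?_ (measure_mono (s := Set.Ioo δ (δ + 1)) fun v hv => ⟨?_, hv.1.le⟩)
    · simp
    · have : 0 < v := hδ.trans hv.1
      simp only [Function.mem_support]
      exact (ENNReal.ofReal_pos.2 (by positivity)).ne'
  exact (ENNReal.mul_lt_mul_iff_right (ENNReal.ofReal_pos.2 hG).ne' ENNReal.ofReal_ne_top).1 (h.trans_lt h2)

/-! ### Binomial thinning as a heat flow -/

theorem gamma_add_half_mul (n : ℕ) :
    Real.Gamma ((n : ℝ) + 1 / 2) * (4 ^ n * n.factorial) = (2 * n).factorial * Real.sqrt Real.pi := by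
  induction n with
  | zero => simpa using Real.Gamma_one_half_eq
  | succ n ih =>
    have e : ((n + 1 : ℕ) : ℝ) + 1 / 2 = ((n : ℝ) + 1 / 2) + 1 := by push_cast; ring
    rw [e, Real.Gamma_add_one (by positivity), show 2 * (n + 1) = 2 * n + 1 + 1 by ring,
      Nat.factorial_succ, Nat.factorial_succ, Nat.factorial_succ]
    push_cast
    linear_combination (4 * ((n : ℝ) + 1 / 2) * (n + 1)) * ih

/-- A form of the duplication formula. It converts the binomial coefficients of thinning, weighted
by Jeffreys masses, into the even binomial coefficients in the expansion of a 2z-th power. -/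
theorem choose_mul_gamma_half (k l : ℕ) :
    ((k + l).choose k : ℝ) * Real.sqrt Real.pi * Real.Gamma (((k + l : ℕ) : ℝ) + 1 / 2)
      = ((2 * (k + l)).choose (2 * k) : ℝ) * Real.Gamma ((k : ℝ) + 1 / 2)
        * Real.Gamma ((l : ℝ) + 1 / 2) := by
  have hG : ∀ n : ℕ, Real.Gamma ((n : ℝ) + 1 / 2)
      = (2 * n).factorial * Real.sqrt Real.pi / (4 ^ n * n.factorial) := fun n => by
    rw [eq_div_iff (by positivity)]; exact gamma_add_half_mul n
  rw [hG, hG, hG, show 2 * (k + l) = 2 * k + 2 * l by ring, Nat.choose_symm_add,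
    Nat.choose_symm_add, Nat.add_choose, Nat.add_choose,
    Nat.cast_div (Nat.factorial_mul_factorial_dvd_factorial_add _ _) (by positivity),
    Nat.cast_div (Nat.factorial_mul_factorial_dvd_factorial_add _ _) (by positivity)]
  push_cast
  rw [pow_add]
  field_simp

theorem sum_range_eq_sum_even (F : ℕ → ℝ) (hF : ∀ k, F (2 * k + 1) = 0) (z : ℕ) :
    ∑ j ∈ Finset.range (2 * z + 1), F j = ∑ k ∈ Finset.range (z + 1), F (2 * k) := by
  induction z with
  | zero => simp
  | succ z ih =>
    rw [Finset.sum_range_succ _ (z + 1), ← ih, show 2 * (z + 1) + 1 = 2 * z + 1 + 1 + 1 by ring,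
      Finset.sum_range_succ, Finset.sum_range_succ, hF]
    simp [show 2 * (z + 1) = 2 * z + 1 + 1 by ring]

theorem add_pow_add_sub_pow (x u : ℝ) (z : ℕ) :
    (u + x) ^ (2 * z) + (-u + x) ^ (2 * z) = 2 * ∑ p ∈ Finset.HasAntidiagonal.antidiagonal z,
      ((2 * z).choose (2 * p.1) : ℝ) * x ^ (2 * p.1) * (u ^ 2) ^ p.2 := by
  rw [Finset.Nat.sum_antidiagonal_eq_sum_range_succ_mk, add_comm u x, add_comm (-u) x, add_pow,
    add_pow, ← Finset.sum_add_distrib, sum_range_eq_sum_even, Finset.mul_sum]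
  · refine Finset.sum_congr rfl fun k hk => ?_
    have hk : k ≤ z := by have := Finset.mem_range.1 hk; omega
    have e : 2 * z - 2 * k = 2 * (z - k) := by omega
    rw [e, pow_mul u, pow_mul (-u), neg_sq]
    ring
  · intro k
    by_cases hk : 2 * k + 1 ≤ 2 * z
    · have hodd : Odd (2 * z - (2 * k + 1)) := ⟨z - k - 1, by omega⟩
      rw [hodd.neg_pow]
      ring
    · rw [Nat.choose_eq_zero_of_lt (by omega)]
      simp

theorem lintegral_sq_pow_mul_exp {b : ℝ} (hb : 0 < b) (m : ℕ) :
    ∫⁻ u : ℝ, ENNReal.ofReal ((u ^ 2) ^ m * Real.exp (-(b * u ^ 2)))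
      = ENNReal.ofReal ((1 / b) ^ m * Real.sqrt (1 / b) * Real.Gamma ((m : ℝ) + 1 / 2)) := by
  have h := lintegral_jeffreysMeasure one_pos
    (φ := fun l => ENNReal.ofReal (l ^ m * Real.exp (-(b * l)))) (by fun_prop)
  simp only [Real.sqrt_one, ENNReal.ofReal_one, one_mul] at h
  rw [← h, jeffreysMeasure, lintegral_withDensity_eq_lintegral_mul _ (by fun_prop) (by fun_prop)]
  have h2 := lintegral_rpow_mul_exp_neg (a := (m : ℝ) + 1 / 2) (by positivity) hb
  rw [Real.rpow_add (by positivity), Real.rpow_natCast, ← Real.sqrt_eq_rpow] at h2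
  rw [← h2]
  refine setLIntegral_congr_fun measurableSet_Ioi fun l hl => ?_
  have hl : 0 < l := hl
  simp only [Pi.mul_apply]
  rw [← ENNReal.ofReal_mul (by positivity), ← mul_assoc, ← Real.rpow_natCast l m,
    ← Real.rpow_add hl, show -(1 / 2 : ℝ) + m = m + 1 / 2 - 1 by ring]

/-- Averaging over u and -u removes the odd powers of u, and the even ones are Gamma integrals. -/
theorem lintegral_shifted_pow_mul_exp {b : ℝ} (hb : 0 < b) (x : ℝ) (z : ℕ) :
    ∫⁻ u : ℝ, ENNReal.ofReal ((u + x) ^ (2 * z) * Real.exp (-(b * u ^ 2)))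
      = ENNReal.ofReal (∑ p ∈ Finset.HasAntidiagonal.antidiagonal z,
        ((2 * z).choose (2 * p.1) : ℝ) * x ^ (2 * p.1) *
          ((1 / b) ^ p.2 * Real.sqrt (1 / b) * Real.Gamma ((p.2 : ℝ) + 1 / 2))) := by
  have heven : ∀ (y : ℝ) (n : ℕ), 0 ≤ y ^ (2 * n) := fun y n => by rw [pow_mul]; positivity
  set h : ℝ → ℝ≥0∞ := fun u => ENNReal.ofReal ((u + x) ^ (2 * z) * Real.exp (-(b * u ^ 2))) with hh
  have hm : Measurable h := by fun_prop
  have h1 : ∫⁻ u, h u = ∫⁻ u, h (-u) := (lintegral_neg_eq_self h).symm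
  have h2 : 2 * ∫⁻ u, h u = ∫⁻ u, (h u + h (-u)) := by
    rw [lintegral_add_left hm, ← h1, two_mul]
  have h3 : ∀ u, h u + h (-u) = 2 * ∑ p ∈ Finset.HasAntidiagonal.antidiagonal z,
      ENNReal.ofReal (((2 * z).choose (2 * p.1) : ℝ) * x ^ (2 * p.1)) *
        ENNReal.ofReal ((u ^ 2) ^ p.2 * Real.exp (-(b * u ^ 2))) := by
    intro u
    simp only [hh]
    rw [neg_sq, ← ENNReal.ofReal_add (mul_nonneg (heven _ _) (Real.exp_pos _).le)
      (mul_nonneg (heven _ _) (Real.exp_pos _).le), ← add_mul, add_pow_add_sub_pow, mul_assoc,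
      ENNReal.ofReal_mul zero_le_two, Finset.sum_mul, ENNReal.ofReal_sum_of_nonneg]
    · rw [ENNReal.ofReal_ofNat]
      congr 1
      refine Finset.sum_congr rfl fun p _ => ?_
      rw [mul_assoc, ENNReal.ofReal_mul (mul_nonneg (Nat.cast_nonneg _) (heven _ _))]
    · intro p _
      have := heven x p.1
      positivity
  have h4 : 2 * ∫⁻ u, h u = 2 * ENNReal.ofReal (∑ p ∈ Finset.HasAntidiagonal.antidiagonal z,
        ((2 * z).choose (2 * p.1) : ℝ) * x ^ (2 * p.1) *
          ((1 / b) ^ p.2 * Real.sqrt (1 / b) * Real.Gamma ((p.2 : ℝ) + 1 / 2))) := by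
    rw [h2, lintegral_congr h3, lintegral_const_mul' _ _ (by norm_num),
      lintegral_finsetSum _ fun p _ => by fun_prop]
    congr 1
    rw [ENNReal.ofReal_sum_of_nonneg]
    · refine Finset.sum_congr rfl fun p _ => ?_
      rw [lintegral_const_mul' _ _ ENNReal.ofReal_ne_top, lintegral_sq_pow_mul_exp hb,
        ← ENNReal.ofReal_mul (mul_nonneg (Nat.cast_nonneg _) (heven _ _))]
    · intro p _
      have := heven x p.1
      have := Real.Gamma_pos_of_pos (show 0 < (p.2 : ℝ) + 1 / 2 by positivity)
      positivity
  exact (ENNReal.mul_right_inj (by norm_num) (by norm_num)).1 h4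

/-- The marginal mass function under the one-dimensional Jeffreys prior. -/
noncomputable def jeffreysMass (c : ℝ) (k : ℕ) : ℝ :=
  Real.Gamma ((k : ℝ) + 1 / 2) / (k.factorial * Real.sqrt c)

theorem jeffreysMass_pos {c : ℝ} (hc : 0 < c) (k : ℕ) : 0 < jeffreysMass c k := by
  have := Real.Gamma_pos_of_pos (show 0 < (k : ℝ) + 1 / 2 by positivity)
  unfold jeffreysMass
  positivity

theorem lintegral_poissonWeight_jeffreysMeasure {c : ℝ} (hc : 0 < c) (k : ℕ) :
    ∫⁻ l, ENNReal.ofReal (poissonWeight c l k) ∂jeffreysMeasure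
      = ENNReal.ofReal (jeffreysMass c k) := by
  rw [lintegral_jeffreysMeasure one_pos (continuous_poissonWeight c k).measurable.ennreal_ofReal]
  have e : ∀ t : ℝ, ENNReal.ofReal (poissonWeight c (1 * t ^ 2) k) = ENNReal.ofReal
      (c ^ k / k.factorial) * ENNReal.ofReal ((t ^ 2) ^ k * Real.exp (-(c * t ^ 2))) := by
    intro t
    rw [← ENNReal.ofReal_mul (by positivity), poissonWeight]
    congr 1
    rw [one_mul, mul_pow]
    ring
  simp_rw [e]
  rw [lintegral_const_mul' _ _ ENNReal.ofReal_ne_top, lintegral_sq_pow_mul_exp hc,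
    ← ENNReal.ofReal_mul (by positivity), Real.sqrt_one, ENNReal.ofReal_one, one_mul]
  congr 1
  rw [jeffreysMass, one_div, Real.sqrt_inv, inv_pow]
  field_simp

/-- Binomial thinning of normalized Poisson likelihoods is a heat flow in the coordinate
`θ = √(l / γ)`, `γ = 1 / r - 1 / (r + s)`. -/
theorem lintegral_gaussKernel_mul_poissonWeight {r s : ℝ} (hr : 0 < r) (hs : 0 < s) (θ : ℝ) (z : ℕ) :
    ∫⁻ φ : ℝ, ENNReal.ofReal (gaussKernel 1 θ φ *
        poissonWeight (r + s) ((1 / r - 1 / (r + s)) * φ ^ 2) z)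
      = ENNReal.ofReal (jeffreysMass (r + s) z * ∑ p ∈ Finset.HasAntidiagonal.antidiagonal z,
          splitWeight r s p.1 p.2 * (poissonWeight r ((1 / r - 1 / (r + s)) * θ ^ 2) p.1
            / jeffreysMass r p.1)) := by
  have hrs : 0 < r + s := by positivity
  set b := (r + s) / r with hb
  have hb0 : 0 < b := by positivity
  set K := Real.sqrt (1 / Real.pi) * ((s / r) ^ z / z.factorial)
    * Real.exp (-(s / (r + s) * θ ^ 2)) with hK
  have hK0 : 0 ≤ K := by positivity
  -- Since (r+s)γ = s/r, the exponent is -(θ-φ)² - (s/r)φ². Its square is completed at φ = rθ/(r+s),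
  -- leaving precision (r+s)/r in u and the factor exp(-sθ²/(r+s)). The latter is the Poisson factor
  -- of rate r, as rγ = s/(r+s).
  rw [← lintegral_add_right_eq_self _ (r / (r + s) * θ)]
  have e : ∀ u : ℝ, gaussKernel 1 θ (u + r / (r + s) * θ) *
      poissonWeight (r + s) ((1 / r - 1 / (r + s)) * (u + r / (r + s) * θ) ^ 2) z
      = K * ((u + r / (r + s) * θ) ^ (2 * z) * Real.exp (-(b * u ^ 2))) := by
    intro u
    have e1 : (r + s) * ((1 / r - 1 / (r + s)) * (u + r / (r + s) * θ) ^ 2)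
        = s / r * (u + r / (r + s) * θ) ^ 2 := by
      field_simp
      ring
    rw [gaussKernel, poissonWeight, e1, mul_pow, ← pow_mul, hK]
    have e2 : Real.exp (-1 * (θ - (u + r / (r + s) * θ)) ^ 2)
        * Real.exp (-(s / r * (u + r / (r + s) * θ) ^ 2))
        = Real.exp (-(s / (r + s) * θ ^ 2)) * Real.exp (-(b * u ^ 2)) := by
      rw [← Real.exp_add, ← Real.exp_add, hb]
      congr 1
      field_simp
      ring
    linear_combination (Real.sqrt (1 / Real.pi) * ((s / r) ^ z / z.factorial)
      * (u + r / (r + s) * θ) ^ (2 * z)) * e2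
  simp_rw [e, ENNReal.ofReal_mul hK0]
  rw [lintegral_const_mul' _ _ ENNReal.ofReal_ne_top, lintegral_shifted_pow_mul_exp hb0,
    ← ENNReal.ofReal_mul hK0]
  congr 1
  rw [Finset.mul_sum, Finset.mul_sum]
  refine Finset.sum_congr rfl fun p hp => ?_
  obtain ⟨k, l⟩ := p
  have hz : k + l = z := Finset.HasAntidiagonal.mem_antidiagonal.1 hp
  subst hz
  simp only
  have hch := choose_mul_gamma_half k l
  have hGk := Real.Gamma_pos_of_pos (show 0 < (k : ℝ) + 1 / 2 by positivity)
  have e1 : r * ((1 / r - 1 / (r + s)) * θ ^ 2) = s / (r + s) * θ ^ 2 := by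
    field_simp
    ring
  have hpi := Real.pi_pos
  have hspi : 0 < Real.sqrt Real.pi := Real.sqrt_pos.2 hpi
  rw [hK, splitWeight, poissonWeight, e1, jeffreysMass, jeffreysMass, hb, one_div_div,
    Real.sqrt_div hr.le, one_div Real.pi, Real.sqrt_inv]
  have hch2 : ((2 * (k + l)).choose (2 * k) : ℝ) * Real.Gamma ((l : ℝ) + 1 / 2)
      = ((k + l).choose k : ℝ) * Real.sqrt Real.pi * Real.Gamma (((k + l : ℕ) : ℝ) + 1 / 2)
        / Real.Gamma ((k : ℝ) + 1 / 2) := by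
    rw [hch]; field_simp
  have hsr : 0 < Real.sqrt r := Real.sqrt_pos.2 hr
  have hsrs : 0 < Real.sqrt (r + s) := Real.sqrt_pos.2 hrs
  calc _ = (Real.sqrt Real.pi)⁻¹ * ((s / r) ^ (k + l) / (k + l).factorial)
        * Real.exp (-(s / (r + s) * θ ^ 2)) * (r / (r + s) * θ) ^ (2 * k) *
        ((r / (r + s)) ^ l * (Real.sqrt r / Real.sqrt (r + s))) *
        (((2 * (k + l)).choose (2 * k) : ℝ) * Real.Gamma ((l : ℝ) + 1 / 2)) := by ring
    _ = _ := by
      rw [hch2]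
      simp only [mul_pow, div_pow, pow_add, pow_mul]
      field_simp
      rw [pow_right_comm (r + s) 2 k]
      ring

/-! ### Marginals of the Jeffreys and shrinkage priors -/

theorem priorMarginal_jeffreysPrior {d : ℕ} {c : Fin d → ℝ} (hc : ∀ i, 0 < c i) (x : Fin d → ℕ) :
    priorMarginal c (jeffreysPrior d) x = ∏ i, ENNReal.ofReal (jeffreysMass (c i) (x i)) := by
  have e : priorMarginal c (jeffreysPrior d) x
      = ∫⁻ lam, ∏ i, ENNReal.ofReal (poissonWeight (c i) (lam i) (x i)) ∂(jeffreysPrior d) := by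
    refine lintegral_congr_ae ?_
    filter_upwards [ae_jeffreysPrior_pos d] with lam h
    exact poissonLaw_singleton_eq_prod (fun i => (mul_pos (hc i) (h i)).le) x
  rw [e, jeffreysPrior_eq_pi, lintegral_pi_prod _ fun i =>
    (continuous_poissonWeight (c i) (x i)).measurable.ennreal_ofReal]
  exact Finset.prod_congr rfl fun i _ => lintegral_poissonWeight_jeffreysMeasure (hc i) (x i)

theorem priorMarginal_jeffreysPrior_ne_zero {d : ℕ} {c : Fin d → ℝ} (hc : ∀ i, 0 < c i)
    (x : Fin d → ℕ) : priorMarginal c (jeffreysPrior d) x ≠ 0 := by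
  rw [priorMarginal_jeffreysPrior hc]
  exact (CanonicallyOrderedAdd.prod_pos.2 fun i _ =>
    ENNReal.ofReal_pos.2 (jeffreysMass_pos (hc i) _)).ne'

theorem priorMarginal_jeffreysPrior_ne_top {d : ℕ} {c : Fin d → ℝ} (hc : ∀ i, 0 < c i)
    (x : Fin d → ℕ) : priorMarginal c (jeffreysPrior d) x ≠ ∞ := by
  rw [priorMarginal_jeffreysPrior hc]
  exact ENNReal.prod_ne_top fun _ _ => ENNReal.ofReal_ne_top

theorem measurable_pointShrinkage {d : ℕ} (η : Fin d → ℝ) (α : ℝ) :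
    Measurable (pointShrinkage η α) := by
  unfold pointShrinkage
  fun_prop

theorem ae_priorOf_pos {d : ℕ} (γ : Fin d → ℝ) (f : (Fin d → ℝ) → ℝ≥0∞) :
    ∀ᵐ lam ∂(priorOf γ f), ∀ i, 0 < lam i :=
  (withDensity_absolutelyContinuous _ _).ae_le (ae_jeffreysPrior_pos d)

/-- Flipping the sign of a coordinate permutes the summands, so the sum over signs extends evenly
from the orthant to ℝ^d. Each summand is there a Riesz kernel with a reflected centre. -/
theorem pointShrinkage_abs {d : ℕ} (η : Fin d → ℝ) (α : ℝ) (θ : Fin d → ℝ) :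
    pointShrinkage η α (fun i => |θ i|)
      = ∑ a : Fin d → ℤˣ, rieszKernel α (fun i => ((a i : ℤ) : ℝ) * η i) θ := by
  set σ : Fin d → ℤˣ := fun i => if θ i < 0 then -1 else 1 with hσ
  have hσθ : ∀ i, ((σ i : ℤ) : ℝ) * |θ i| = θ i := by
    intro i
    simp only [hσ]
    split_ifs with h
    · rw [abs_of_neg h]; simp
    · rw [abs_of_nonneg (not_lt.1 h)]; simp
  unfold pointShrinkage
  rw [← Equiv.sum_comp (Equiv.mulRight σ)]
  refine Finset.sum_congr rfl fun a _ => ?_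
  rw [rieszKernel, sqDist]
  congr 2
  refine Finset.sum_congr rfl fun i _ => ?_
  have ha : ((a i : ℤ) : ℝ) * ((a i : ℤ) : ℝ) = 1 := by
    rcases Int.units_eq_one_or (a i) with h | h <;> simp [h]
  simp only [Equiv.coe_mulRight, Pi.mul_apply, Units.val_mul, Int.cast_mul]
  rw [mul_assoc, hσθ]
  linear_combination (θ i ^ 2 - η i ^ 2) * ha

/-- The unnormalized integral of a Riesz kernel against Poisson likelihoods. -/
noncomputable def rieszMarginal {d : ℕ} (γ c : Fin d → ℝ) (α : ℝ) (η : Fin d → ℝ)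
    (x : Fin d → ℕ) : ℝ≥0∞ :=
  ∫⁻ θ : Fin d → ℝ, rieszKernel α η θ *
    ∏ i, ENNReal.ofReal (poissonWeight (c i) (γ i * θ i ^ 2) (x i))

theorem measurable_prod_poissonWeight {d : ℕ} (γ c : Fin d → ℝ) (x : Fin d → ℕ) :
    Measurable fun θ : Fin d → ℝ =>
      ∏ i, ENNReal.ofReal (poissonWeight (c i) (γ i * θ i ^ 2) (x i)) := by
  refine Finset.measurable_prod _ fun i _ => ?_
  have := continuous_poissonWeight (c i) (x i)
  exact (this.measurable.comp (by fun_prop : Measurable fun θ : Fin d → ℝ =>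
    γ i * θ i ^ 2)).ennreal_ofReal

theorem measurable_rieszKernel_mul {d : ℕ} (γ c : Fin d → ℝ) (α : ℝ) (η : Fin d → ℝ)
    (x : Fin d → ℕ) : Measurable fun θ : Fin d → ℝ => rieszKernel α η θ *
      ∏ i, ENNReal.ofReal (poissonWeight (c i) (γ i * θ i ^ 2) (x i)) :=
  (measurable_rieszKernel α η).mul (measurable_prod_poissonWeight γ c x)

theorem priorMarginal_priorOf {d : ℕ} {γ c : Fin d → ℝ} (hγ : ∀ i, 0 < γ i) (hc : ∀ i, 0 < c i)
    (α : ℝ) (η : Fin d → ℝ) (x : Fin d → ℕ) :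
    priorMarginal c (priorOf γ (pointShrinkage η α)) x
      = (∏ i, ENNReal.ofReal (Real.sqrt (γ i))) *
        ∑ a : Fin d → ℤˣ, rieszMarginal γ c α (fun i => ((a i : ℤ) : ℝ) * η i) x := by
  have hf : Measurable fun lam : Fin d → ℝ =>
      pointShrinkage η α fun i => Real.sqrt (lam i / γ i) :=
    (measurable_pointShrinkage η α).comp (by fun_prop)
  have hP := measurable_poissonLaw_singleton c x
  rw [priorMarginal, priorOf, lintegral_withDensity_eq_lintegral_mul _ hf hP,
    lintegral_jeffreysPrior hγ (hf.mul hP)]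
  congr 1
  unfold rieszMarginal
  rw [← lintegral_finsetSum _ fun a _ => measurable_rieszKernel_mul γ c α _ x]
  refine lintegral_congr fun θ => ?_
  have hsq : (fun i => Real.sqrt (γ i * θ i ^ 2 / γ i)) = fun i => |θ i| := by
    funext i
    rw [mul_div_cancel_left₀ _ (hγ i).ne', Real.sqrt_sq_eq_abs]
  simp only [Pi.mul_apply]
  rw [hsq, pointShrinkage_abs, poissonLaw_singleton_eq_prod (fun i =>
    mul_nonneg (hc i).le (mul_nonneg (hγ i).le (sq_nonneg _))), Finset.sum_mul]

/-- Half of the exponential decay pays for the power, which leaves a Gaussian majorant in θ when y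
is proportional to θ². -/
theorem poissonWeight_le {y : ℝ} (hy : 0 ≤ y) (k : ℕ) :
    y ^ k / k.factorial * Real.exp (-y) ≤ 2 ^ k * Real.exp (-(y / 2)) := by
  have h := Real.pow_div_factorial_le_exp (y / 2) (by positivity) k
  have e : Real.exp (-(y / 2)) = Real.exp (y / 2) * Real.exp (-y) := by
    rw [← Real.exp_add]; congr 1; ring
  rw [e, ← mul_assoc]
  refine mul_le_mul_of_nonneg_right ?_ (Real.exp_pos _).le
  have e2 : y ^ k / k.factorial = 2 ^ k * ((y / 2) ^ k / k.factorial) := by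
    rw [div_pow]; field_simp
  rw [e2]
  exact mul_le_mul_of_nonneg_left h (by positivity)

theorem rieszMarginal_ne_top {d : ℕ} {γ c : Fin d → ℝ} (hγ : ∀ i, 0 < γ i) (hc : ∀ i, 0 < c i)
    {α : ℝ} (hα : 0 < α) (hαd : α ≤ ((d : ℝ) - 2) / 2) (η : Fin d → ℝ) (x : Fin d → ℕ) :
    rieszMarginal γ c α η x ≠ ∞ := by
  have hd : 0 < d := by
    rcases Nat.eq_zero_or_pos d with h | h
    · subst h; norm_num at hαd; linarith
    · exact h
  have : Nonempty (Fin d) := ⟨⟨0, hd⟩⟩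
  -- The smallest decay rate serves all coordinates, so that the majorant is isotropic and the
  -- Gaussian integral of the Riesz kernel applies.
  obtain ⟨i₀, hi₀⟩ := Finite.exists_min fun i => c i * γ i / 2
  set δ := c i₀ * γ i₀ / 2 with hδdef
  have hδ : 0 < δ := by have := hγ i₀; have := hc i₀; positivity
  have hpi := Real.pi_pos
  set C : Fin d → ℝ := fun i => 2 ^ x i / Real.sqrt (δ / Real.pi) with hC
  have hC0 : ∀ i, 0 ≤ C i := fun i => by positivity
  have hle : ∀ (θ : Fin d → ℝ) i, ENNReal.ofReal (poissonWeight (c i) (γ i * θ i ^ 2) (x i))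
      ≤ ENNReal.ofReal (C i) * ENNReal.ofReal (gaussKernel δ (θ i) 0) := by
    intro θ i
    rw [← ENNReal.ofReal_mul (hC0 i)]
    refine ENNReal.ofReal_le_ofReal ?_
    have hy : 0 ≤ c i * (γ i * θ i ^ 2) := by have := hγ i; have := hc i; positivity
    refine (poissonWeight_le hy (x i)).trans ?_
    have hs : 0 < Real.sqrt (δ / Real.pi) := Real.sqrt_pos.2 (by positivity)
    rw [gaussKernel, hC]
    simp only
    rw [← mul_assoc (2 ^ x i / _), div_mul_cancel₀ _ hs.ne', sub_zero]
    refine mul_le_mul_of_nonneg_left (Real.exp_le_exp.2 ?_) (by positivity)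
    have := mul_le_mul_of_nonneg_right (hi₀ i) (sq_nonneg (θ i))
    nlinarith
  have hbound : rieszMarginal γ c α η x ≤ (∏ i, ENNReal.ofReal (C i)) *
      ∫⁻ θ : Fin d → ℝ, rieszKernel α η θ * ∏ i, ENNReal.ofReal (gaussKernel δ (θ i) 0) := by
    rw [← lintegral_const_mul' _ _ (ENNReal.prod_ne_top fun _ _ => ENNReal.ofReal_ne_top)]
    refine lintegral_mono fun θ => ?_
    simp only
    rw [mul_left_comm, ← Finset.prod_mul_distrib]
    gcongr with i
    exact hle θ i
  exact ne_top_of_le_ne_top (ENNReal.mul_ne_top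
    (ENNReal.prod_ne_top fun _ _ => ENNReal.ofReal_ne_top)
    (lintegral_rieszKernel_gauss_ne_top hα hαd hδ η fun _ => 0)) hbound

theorem ae_prod_poissonWeight_pos {d : ℕ} {γ c : Fin d → ℝ} (hγ : ∀ i, 0 < γ i)
    (hc : ∀ i, 0 < c i) (x : Fin d → ℕ) : ∀ᵐ θ : Fin d → ℝ,
      ∏ i, ENNReal.ofReal (poissonWeight (c i) (γ i * θ i ^ 2) (x i)) ≠ 0 := by
  have h : ∀ᵐ θ : Fin d → ℝ, ∀ i, θ i ≠ 0 := by
    rw [ae_all_iff]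
    exact fun i => Measure.ae_eval_ne (fun _ => volume) i 0
  filter_upwards [h] with θ hθ
  refine (CanonicallyOrderedAdd.prod_pos.2 fun i _ => ENNReal.ofReal_pos.2
    (poissonWeight_pos ?_ _)).ne'
  have := hγ i
  have := hc i
  have := hθ i
  positivity

theorem rieszKernel_ne_zero {d : ℕ} {α : ℝ} (hα : 0 < α) (η θ : Fin d → ℝ) :
    rieszKernel α η θ ≠ 0 := by
  unfold rieszKernel
  rw [Ne, ENNReal.rpow_eq_zero_iff]
  rintro (⟨_, h⟩ | ⟨h, _⟩)
  · linarith
  · exact ENNReal.ofReal_ne_top h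

theorem rieszMarginal_ne_zero {d : ℕ} {γ c : Fin d → ℝ} (hγ : ∀ i, 0 < γ i) (hc : ∀ i, 0 < c i)
    {α : ℝ} (hα : 0 < α) (η : Fin d → ℝ) (x : Fin d → ℕ) : rieszMarginal γ c α η x ≠ 0 := by
  unfold rieszMarginal
  rw [Ne, lintegral_eq_zero_iff (measurable_rieszKernel_mul γ c α η x)]
  intro h
  obtain ⟨θ, h1, h2⟩ := (h.and (ae_prod_poissonWeight_pos hγ hc x)).exists
  exact mul_ne_zero (rieszKernel_ne_zero hα η θ) h2 h1

/-! ### Strict inequality for the ratios of marginals -/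

/-- One step of binomial averaging strictly decreases the marginal of a Riesz kernel relative to
the Jeffreys marginal. -/
theorem sum_splitProd_rieszMarginal_lt {d : ℕ} {r s : Fin d → ℝ} (hr : ∀ i, 0 < r i)
    (hs : ∀ i, 0 < s i) {α : ℝ} (hα : 0 < α) (hαd : α ≤ ((d : ℝ) - 2) / 2) (η : Fin d → ℝ)
    (z : Fin d → ℕ) :
    ∑ p ∈ Fintype.piFinset (fun i => Finset.HasAntidiagonal.antidiagonal (z i)),
      splitProd r s (fun i => (p i).1) (fun i => (p i).2) *
        (rieszMarginal (durationScale r s) r α η (fun i => (p i).1)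
          / priorMarginal r (jeffreysPrior d) (fun i => (p i).1))
      < rieszMarginal (durationScale r s) (r + s) α η z
        / priorMarginal (r + s) (jeffreysPrior d) z := by
  set γ := durationScale r s with hγdef
  have hrs : ∀ i, 0 < (r + s) i := fun i => add_pos (hr i) (hs i)
  have hγ : ∀ i, 0 < γ i := fun i => by
    have h1 := hr i
    have h2 := hs i
    simp only [hγdef, durationScale]
    rw [sub_pos]
    exact one_div_lt_one_div_of_lt h1 (by linarith)
  have hd : 0 < d := by
    rcases Nat.eq_zero_or_pos d with h | h
    · subst h; norm_num at hαd; linarith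
    · exact h
  set J := priorMarginal (r + s) (jeffreysPrior d) z with hJ
  have hJ0 : J ≠ 0 := priorMarginal_jeffreysPrior_ne_zero hrs z
  have hJ1 : J ≠ ∞ := priorMarginal_jeffreysPrior_ne_top hrs z
  set T : Fin d → ℝ → ℝ := fun i t => ∑ p ∈ Finset.HasAntidiagonal.antidiagonal (z i),
    splitWeight (r i) (s i) p.1 p.2 *
      (poissonWeight (r i) (γ i * t ^ 2) p.1 / jeffreysMass (r i) p.1) with hT
  have hpw : ∀ i t k, 0 ≤ poissonWeight (r i) (γ i * t ^ 2) k := fun i t k =>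
    poissonWeight_nonneg (by have := hr i; have := hγ i; positivity) k
  set W : (Fin d → ℝ) → ℝ≥0∞ := fun φ =>
    ∏ i, ENNReal.ofReal (poissonWeight ((r + s) i) (γ i * φ i ^ 2) (z i)) with hW
  have hWm : Measurable W := measurable_prod_poissonWeight γ (r + s) z
  -- the averaged likelihood is a Gaussian smoothing of the likelihood at the sum
  have hflow : ∀ θ : Fin d → ℝ, J * ∏ i, ENNReal.ofReal (T i (θ i))
      = ∫⁻ φ : Fin d → ℝ, (∏ i, ENNReal.ofReal (gaussKernel 1 (θ i) (φ i))) * W φ := by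
    intro θ
    have hgm : ∀ i, Measurable fun t : ℝ => ENNReal.ofReal (gaussKernel 1 (θ i) t *
        poissonWeight ((r + s) i) (γ i * t ^ 2) (z i)) := fun i => by
      unfold gaussKernel poissonWeight
      fun_prop
    have e : ∀ φ : Fin d → ℝ, (∏ i, ENNReal.ofReal (gaussKernel 1 (θ i) (φ i))) * W φ
        = ∏ i, ENNReal.ofReal (gaussKernel 1 (θ i) (φ i) *
          poissonWeight ((r + s) i) (γ i * φ i ^ 2) (z i)) := by
      intro φ
      rw [hW, ← Finset.prod_mul_distrib]
      exact Finset.prod_congr rfl fun i _ => (ENNReal.ofReal_mul (gaussKernel_nonneg _ _ _)).symm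
    simp_rw [e]
    rw [volume_pi, lintegral_pi_prod (fun _ => volume) hgm, hJ, priorMarginal_jeffreysPrior hrs,
      ← Finset.prod_mul_distrib]
    refine Finset.prod_congr rfl fun i _ => ?_
    rw [← ENNReal.ofReal_mul (jeffreysMass_pos (hrs i) _).le]
    exact (lintegral_gaussKernel_mul_poissonWeight (hr i) (hs i) (θ i) (z i)).symm
  have hLHS : ∑ p ∈ Fintype.piFinset (fun i => Finset.HasAntidiagonal.antidiagonal (z i)),
      splitProd r s (fun i => (p i).1) (fun i => (p i).2) *
        (rieszMarginal γ r α η (fun i => (p i).1)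
          / priorMarginal r (jeffreysPrior d) (fun i => (p i).1))
      = ∫⁻ θ : Fin d → ℝ, rieszKernel α η θ * ∏ i, ENNReal.ofReal (T i (θ i)) := by
    have e : ∀ θ : Fin d → ℝ, rieszKernel α η θ * ∏ i, ENNReal.ofReal (T i (θ i))
        = ∑ p ∈ Fintype.piFinset (fun i => Finset.HasAntidiagonal.antidiagonal (z i)),
          (splitProd r s (fun i => (p i).1) (fun i => (p i).2) *
            (priorMarginal r (jeffreysPrior d) (fun i => (p i).1))⁻¹) * (rieszKernel α η θ *
              ∏ i, ENNReal.ofReal (poissonWeight (r i) (γ i * θ i ^ 2) (p i).1)) := by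
      intro θ
      have e1 : ∀ i, ENNReal.ofReal (T i (θ i))
          = ∑ p ∈ Finset.HasAntidiagonal.antidiagonal (z i),
            ENNReal.ofReal (splitWeight (r i) (s i) p.1 p.2) *
            (ENNReal.ofReal (jeffreysMass (r i) p.1))⁻¹ *
              ENNReal.ofReal (poissonWeight (r i) (γ i * θ i ^ 2) p.1) := by
        intro i
        rw [hT, ENNReal.ofReal_sum_of_nonneg]
        · refine Finset.sum_congr rfl fun p _ => ?_
          rw [ENNReal.ofReal_mul (splitWeight_pos (hr i) (hs i) _ _).le,
            ENNReal.ofReal_div_of_pos (jeffreysMass_pos (hr i) _), div_eq_mul_inv]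
          ring
        · intro p _
          exact mul_nonneg (splitWeight_pos (hr i) (hs i) _ _).le
            (div_nonneg (hpw _ _ _) (jeffreysMass_pos (hr i) _).le)
      simp_rw [e1]
      rw [Finset.prod_univ_sum, Finset.mul_sum]
      refine Finset.sum_congr rfl fun p _ => ?_
      rw [Finset.prod_mul_distrib, Finset.prod_mul_distrib, priorMarginal_jeffreysPrior hr,
        ENNReal.prod_inv_distrib fun i _ j _ _ => Or.inr ENNReal.ofReal_ne_top, splitProd]
      ring
    simp_rw [e]
    rw [lintegral_finsetSum _ fun p _ =>
      (measurable_rieszKernel_mul γ r α η fun i => (p i).1).const_mul _]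
    refine Finset.sum_congr rfl fun p _ => ?_
    rw [lintegral_const_mul _ (measurable_rieszKernel_mul γ r α η fun i => (p i).1), rieszMarginal, div_eq_mul_inv]
    ring
  rw [hLHS, ENNReal.lt_div_iff_mul_lt (Or.inl hJ0) (Or.inl hJ1), mul_comm,
    ← lintegral_const_mul' _ _ hJ1]
  have hgm2 : Measurable fun q : (Fin d → ℝ) × (Fin d → ℝ) =>
      ∏ i, ENNReal.ofReal (gaussKernel 1 (q.1 i) (q.2 i)) := by
    refine Finset.measurable_prod _ fun i _ => ?_
    unfold gaussKernel
    fun_prop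
  calc ∫⁻ θ : Fin d → ℝ, J * (rieszKernel α η θ * ∏ i, ENNReal.ofReal (T i (θ i)))
      = ∫⁻ θ : Fin d → ℝ, ∫⁻ φ : Fin d → ℝ, rieszKernel α η θ *
          ((∏ i, ENNReal.ofReal (gaussKernel 1 (θ i) (φ i))) * W φ) := by
        refine lintegral_congr fun θ => ?_
        rw [mul_left_comm, hflow, lintegral_const_mul]
        exact (hgm2.comp (measurable_const.prodMk measurable_id)).mul hWm
    -- The symmetric Gaussian kernel changes roles here: it smoothed the likelihood in φ and now
    -- smooths the Riesz kernel in θ.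
    _ = ∫⁻ φ : Fin d → ℝ, ∫⁻ θ : Fin d → ℝ, rieszKernel α η θ *
          ((∏ i, ENNReal.ofReal (gaussKernel 1 (θ i) (φ i))) * W φ) := by
        refine lintegral_lintegral_swap (Measurable.aemeasurable ?_)
        exact ((measurable_rieszKernel α η).comp measurable_fst).mul
          (hgm2.mul (hWm.comp measurable_snd))
    _ = ∫⁻ φ : Fin d → ℝ, (∫⁻ θ : Fin d → ℝ, rieszKernel α η θ *
          ∏ i, ENNReal.ofReal (gaussKernel 1 (θ i) (φ i))) * W φ := by
        refine lintegral_congr fun φ => ?_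
        rw [← lintegral_mul_const' _ _ (ENNReal.prod_ne_top fun _ _ => ENNReal.ofReal_ne_top)]
        exact lintegral_congr fun θ => (mul_assoc _ _ _).symm
    _ < rieszMarginal γ (r + s) α η z := by
        unfold rieszMarginal
        have hlt : ∀ φ : Fin d → ℝ, φ ≠ η → W φ ≠ 0 → (∫⁻ θ : Fin d → ℝ, rieszKernel α η θ *
            ∏ i, ENNReal.ofReal (gaussKernel 1 (θ i) (φ i))) * W φ < rieszKernel α η φ * W φ :=
          fun φ h1 h2 => ENNReal.mul_lt_mul_left h2
            (ENNReal.prod_ne_top fun _ _ => ENNReal.ofReal_ne_top)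
            (lintegral_rieszKernel_gauss_lt hα hαd one_pos h1)
        -- Strictness fails at most at the centre η and where the likelihood vanishes, that is, on a
        -- null set.
        have hae : ∀ᵐ φ : Fin d → ℝ, (∫⁻ θ : Fin d → ℝ, rieszKernel α η θ *
            ∏ i, ENNReal.ofReal (gaussKernel 1 (θ i) (φ i))) * W φ < rieszKernel α η φ * W φ := by
          filter_upwards [ae_ne_pi hd η, ae_prod_poissonWeight_pos hγ hrs z] with φ h1 h2
          exact hlt φ h1 h2
        refine lintegral_strict_mono (NeZero.ne _) ?_ ?_ hae
        · exact ((measurable_rieszKernel α η).mul hWm).aemeasurable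
        · exact ne_top_of_le_ne_top (rieszMarginal_ne_top hγ hrs hα hαd η z)
            (lintegral_mono_ae (hae.mono fun _ h => h.le))

/-! ### Exact risk of the Jeffreys predictive distribution -/

open InformationTheory in
theorem klDiv_eq_ofReal_integral {Y : Type*} [MeasurableSpace Y] [Countable Y]
    [MeasurableSingletonClass Y] (P Q : Measure Y) [IsProbabilityMeasure P]
    [IsProbabilityMeasure Q] {h : Y → ℝ}
    (hPQ : ∀ y, P {y} = ENNReal.ofReal (Real.exp (h y)) * Q {y}) (hi : Integrable h P) :
    klDiv P Q = ENNReal.ofReal (∫ y, h y ∂P) ∧ 0 ≤ ∫ y, h y ∂P := by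
  have hmeas : Measurable fun y => ENNReal.ofReal (Real.exp (h y)) := measurable_of_countable _
  have hP : P = Q.withDensity fun y => ENNReal.ofReal (Real.exp (h y)) := by
    refine Measure.ext_of_singleton fun y => ?_
    rw [withDensity_apply _ (measurableSet_singleton y), lintegral_singleton, hPQ]
  have hac : P ≪ Q := by
    rw [hP]; exact withDensity_absolutelyContinuous _ _
  have hllr : llr P Q =ᵐ[P] h := by
    have h1 : P.rnDeriv Q =ᵐ[Q] fun y => ENNReal.ofReal (Real.exp (h y)) := by
      conv_lhs => rw [hP]
      exact Measure.rnDeriv_withDensity Q hmeas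
    filter_upwards [hac.ae_le h1] with y hy
    rw [llr, hy, ENNReal.toReal_ofReal (Real.exp_pos _).le, Real.log_exp]
  have hi' : Integrable (llr P Q) P := hi.congr hllr.symm
  have h2 := klDiv_of_ac_of_integrable hac hi'
  have h3 := integral_llr_add_sub_measure_univ_nonneg hac hi'
  rw [integral_congr_ae hllr] at h2 h3
  simp only [probReal_univ, add_sub_cancel_right] at h2 h3
  exact ⟨h2, h3⟩

theorem Tame.integrable {g : ℕ → ℝ} (hg : Tame g) (μ : NNReal) :
    Integrable g (ProbabilityTheory.poissonMeasure μ) := by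
  rw [ProbabilityTheory.integrable_poissonMeasure_iff]
  refine ((hg.summable μ).norm.mul_left (Real.exp (-μ))).congr fun k => ?_
  rw [norm_mul, Real.norm_of_nonneg (by positivity : (0 : ℝ) ≤ (μ : ℝ) ^ k / k.factorial)]
  ring

theorem integral_poissonMeasure_eq_poissonMean (g : ℕ → ℝ) (μ : NNReal) :
    ∫ k, g k ∂(ProbabilityTheory.poissonMeasure μ) = poissonMean g μ := by
  rw [ProbabilityTheory.integral_poissonMeasure, poissonMean, expSeries, ← tsum_mul_left]
  refine tsum_congr fun k => ?_
  rw [smul_eq_mul]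
  ring

theorem Tame.shift {g : ℕ → ℝ} (hg : Tame g) (k : ℕ) : Tame fun l => g (k + l) := by
  obtain ⟨C, hC⟩ := hg
  refine ⟨C * 2 ^ k, fun l => (hC (k + l)).trans (le_of_eq ?_)⟩
  ring

theorem Tame.integrable_integral {g : ℕ → ℝ} (hg : Tame g) (μ ν : NNReal) :
    Integrable (fun k => ∫ l, g (k + l) ∂(ProbabilityTheory.poissonMeasure ν))
      (ProbabilityTheory.poissonMeasure μ) := by
  have h := hg.integrable (μ + ν)
  rw [← ProbabilityTheory.poissonMeasure_conv_poissonMeasure,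
    integrable_conv_iff (Measurable.of_discrete).aestronglyMeasurable] at h
  exact h.2.mono (Measurable.of_discrete).aestronglyMeasurable
    (Filter.Eventually.of_forall fun k => (norm_integral_le_integral_norm _).trans
      (le_abs_self _))

/-- The sum of independent Poisson variables is Poisson, so the expectation over (x, y) of a
function of x + y is a single Poisson mean. -/
theorem Tame.integral_integral {g : ℕ → ℝ} (hg : Tame g) (μ ν : NNReal) :
    ∫ k, ∫ l, g (k + l) ∂(ProbabilityTheory.poissonMeasure ν)
      ∂(ProbabilityTheory.poissonMeasure μ) = poissonMean g (μ + ν) := by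
  have h := hg.integrable (μ + ν)
  rw [← ProbabilityTheory.poissonMeasure_conv_poissonMeasure] at h
  rw [← integral_conv h, ProbabilityTheory.poissonMeasure_conv_poissonMeasure,
    integral_poissonMeasure_eq_poissonMean]
  push_cast
  rfl

theorem integrable_eval_poissonLaw {d : ℕ} (c lam : Fin d → ℝ) (i : Fin d) {g : ℕ → ℝ}
    (hg : Integrable g (ProbabilityTheory.poissonMeasure (c i * lam i).toNNReal)) :
    Integrable (fun x : Fin d → ℕ => g (x i)) (poissonLaw c lam) := by
  unfold poissonLaw
  exact integrable_comp_eval hg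

theorem integral_eval_poissonLaw {d : ℕ} (c lam : Fin d → ℝ) (i : Fin d) (g : ℕ → ℝ) :
    ∫ x : Fin d → ℕ, g (x i) ∂(poissonLaw c lam)
      = ∫ k, g k ∂(ProbabilityTheory.poissonMeasure (c i * lam i).toNNReal) := by
  unfold poissonLaw
  exact integral_comp_eval (Measurable.of_discrete).aestronglyMeasurable

theorem integrable_sum_sub {d : ℕ} (s lam : Fin d → ℝ) {e₁ e₂ : Fin d → ℕ → ℝ}
    (h₁ : ∀ i, Tame (e₁ i)) (x : Fin d → ℕ) :
    Integrable (fun y => ∑ i, (e₁ i (x i + y i) - e₂ i (x i))) (poissonLaw s lam) :=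
  integrable_finsetSum _ fun i _ => (integrable_eval_poissonLaw s lam i
    (((h₁ i).shift (x i)).integrable _)).sub (integrable_const _)

theorem integral_sum_sub {d : ℕ} (s lam : Fin d → ℝ) {e₁ e₂ : Fin d → ℕ → ℝ}
    (h₁ : ∀ i, Tame (e₁ i)) (x : Fin d → ℕ) :
    ∫ y, ∑ i, (e₁ i (x i + y i) - e₂ i (x i)) ∂(poissonLaw s lam)
      = ∑ i, (∫ l, e₁ i (x i + l) ∂(ProbabilityTheory.poissonMeasure (s i * lam i).toNNReal)
        - e₂ i (x i)) := by
  have hi : ∀ i, Integrable (fun y : Fin d → ℕ => e₁ i (x i + y i)) (poissonLaw s lam) :=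
    fun i => integrable_eval_poissonLaw s lam i (((h₁ i).shift (x i)).integrable _)
  have hsub : ∀ i, Integrable (fun y : Fin d → ℕ => e₁ i (x i + y i) - e₂ i (x i))
      (poissonLaw s lam) := fun i => (hi i).sub (integrable_const _)
  rw [integral_finsetSum _ fun i _ => hsub i]
  refine Finset.sum_congr rfl fun i _ => ?_
  rw [integral_sub (hi i) (integrable_const _)]
  congr 1
  · exact integral_eval_poissonLaw s lam i fun l => e₁ i (x i + l)
  · simp

theorem integrable_integral_sum_sub {d : ℕ} (r s lam : Fin d → ℝ) {e₁ e₂ : Fin d → ℕ → ℝ}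
    (h₁ : ∀ i, Tame (e₁ i)) (h₂ : ∀ i, Tame (e₂ i)) :
    Integrable (fun x => ∫ y, ∑ i, (e₁ i (x i + y i) - e₂ i (x i)) ∂(poissonLaw s lam))
      (poissonLaw r lam) := by
  simp_rw [integral_sum_sub s lam h₁]
  exact integrable_finsetSum _ fun i _ => (integrable_eval_poissonLaw r lam i
    ((h₁ i).integrable_integral _ _)).sub
      (integrable_eval_poissonLaw r lam i ((h₂ i).integrable _))

theorem integral_integral_sum_sub {d : ℕ} {r s lam : Fin d → ℝ} (hr : ∀ i, 0 < r i)
    (hs : ∀ i, 0 < s i) (hl : ∀ i, 0 < lam i) {e₁ e₂ : Fin d → ℕ → ℝ}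
    (h₁ : ∀ i, Tame (e₁ i)) (h₂ : ∀ i, Tame (e₂ i)) :
    ∫ x, ∫ y, ∑ i, (e₁ i (x i + y i) - e₂ i (x i)) ∂(poissonLaw s lam) ∂(poissonLaw r lam)
      = ∑ i, (poissonMean (e₁ i) ((r i + s i) * lam i) - poissonMean (e₂ i) (r i * lam i)) := by
  simp_rw [integral_sum_sub s lam h₁]
  have hi₁ : ∀ i, Integrable (fun x : Fin d → ℕ => ∫ l, e₁ i (x i + l)
      ∂(ProbabilityTheory.poissonMeasure (s i * lam i).toNNReal)) (poissonLaw r lam) :=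
    fun i => integrable_eval_poissonLaw r lam i ((h₁ i).integrable_integral _ _)
  have hi₂ : ∀ i, Integrable (fun x : Fin d → ℕ => e₂ i (x i)) (poissonLaw r lam) :=
    fun i => integrable_eval_poissonLaw r lam i ((h₂ i).integrable _)
  have hsub : ∀ i, Integrable (fun x : Fin d → ℕ => ∫ l, e₁ i (x i + l)
      ∂(ProbabilityTheory.poissonMeasure (s i * lam i).toNNReal) - e₂ i (x i))
      (poissonLaw r lam) := fun i => (hi₁ i).sub (hi₂ i)
  rw [integral_finsetSum _ fun i _ => hsub i]
  refine Finset.sum_congr rfl fun i _ => ?_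
  rw [integral_sub (hi₁ i) (hi₂ i)]
  have hri := mul_pos (hr i) (hl i)
  have hsi := mul_pos (hs i) (hl i)
  congr 1
  · refine (integral_eval_poissonLaw r lam i fun k => ∫ l, e₁ i (k + l)
      ∂(ProbabilityTheory.poissonMeasure (s i * lam i).toNNReal)).trans ?_
    rw [(h₁ i).integral_integral, Real.coe_toNNReal _ hri.le, Real.coe_toNNReal _ hsi.le, add_mul]
  · refine (integral_eval_poissonLaw r lam i (e₂ i)).trans ?_
    rw [integral_poissonMeasure_eq_poissonMean, Real.coe_toNNReal _ hri.le]

/-- The marginal mass function under the prior `l^(-1/2) exp (-b l)`. -/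
noncomputable def gammaMass (b c : ℝ) (k : ℕ) : ℝ :=
  jeffreysMass c k * (Real.sqrt (c / (c + b)) * (c / (c + b)) ^ k)

theorem gammaMass_zero {c : ℝ} (hc : 0 < c) (k : ℕ) : gammaMass 0 c k = jeffreysMass c k := by
  simp [gammaMass, div_self hc.ne']

theorem gammaMass_pos {b c : ℝ} (hb : 0 ≤ b) (hc : 0 < c) (k : ℕ) : 0 < gammaMass b c k := by
  have := jeffreysMass_pos hc k
  have : 0 < c + b := by positivity
  unfold gammaMass
  positivity

/-- The log-ratio of the likelihood and the marginal mass function. -/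
noncomputable def logEvidence (b c l : ℝ) (k : ℕ) : ℝ :=
  Real.log (poissonWeight c l k / gammaMass b c k)

theorem exp_logEvidence {b c l : ℝ} (hb : 0 ≤ b) (hc : 0 < c) (hl : 0 < l) (k : ℕ) :
    Real.exp (logEvidence b c l k) = poissonWeight c l k / gammaMass b c k :=
  Real.exp_log (div_pos (poissonWeight_pos (mul_pos hc hl) k) (gammaMass_pos hb hc k))

theorem logEvidence_eq {b c l : ℝ} (hb : 0 ≤ b) (hc : 0 < c) (hl : 0 < l) (k : ℕ) :
    logEvidence b c l k = (Real.log (c * l) + Real.log ((c + b) / c)) * k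
      + (1 / 2 * Real.log c - c * l + 1 / 2 * Real.log ((c + b) / c)) - logGammaHalf k := by
  have hG := Real.Gamma_pos_of_pos (show 0 < (k : ℝ) + 1 / 2 by positivity)
  have hcb : 0 < c + b := by positivity
  have hcl : 0 < c * l := by positivity
  have hq : 0 < (c + b) / c := by positivity
  have e : poissonWeight c l k / gammaMass b c k = (c * l) ^ k * Real.exp (-(c * l))
      * Real.sqrt c * Real.sqrt ((c + b) / c) * ((c + b) / c) ^ k / Real.Gamma ((k : ℝ) + 1 / 2) := by
    rw [poissonWeight, gammaMass, jeffreysMass]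
    have e1 : c / (c + b) = ((c + b) / c)⁻¹ := by rw [inv_div]
    rw [e1, Real.sqrt_inv, inv_pow]
    have : 0 < Real.sqrt ((c + b) / c) := Real.sqrt_pos.2 hq
    have : 0 < Real.sqrt c := Real.sqrt_pos.2 hc
    generalize Real.sqrt ((c + b) / c) = w at *
    generalize (c + b) / c = q at *
    field_simp
  rw [logEvidence, e, Real.log_div (by positivity) hG.ne', Real.log_mul (by positivity) (by positivity),
    Real.log_mul (by positivity) (by positivity), Real.log_mul (by positivity) (by positivity),
    Real.log_mul (by positivity) (by positivity), Real.log_pow, Real.log_pow, Real.log_exp,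
    Real.log_sqrt hc.le, Real.log_sqrt hq.le, logGammaHalf]
  ring

theorem logEvidence_fun_eq {b c l : ℝ} (hb : 0 ≤ b) (hc : 0 < c) (hl : 0 < l) :
    logEvidence b c l = fun k : ℕ => ((Real.log (c * l) + Real.log ((c + b) / c)) * k
      + (1 / 2 * Real.log c - c * l + 1 / 2 * Real.log ((c + b) / c))) - logGammaHalf k :=
  funext (logEvidence_eq hb hc hl)

theorem tame_logEvidence {b c l : ℝ} (hb : 0 ≤ b) (hc : 0 < c) (hl : 0 < l) :
    Tame (logEvidence b c l) := by
  rw [logEvidence_fun_eq hb hc hl]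
  exact ((tame_natCast.const_mul _).add (tame_const _)).sub tame_logGammaHalf

/-- The log-evidence is affine in k apart from log Γ(k + ½), so its mean reduces to the entropy
defect. The last term vanishes for b = 0, the Jeffreys case. -/
theorem poissonMean_logEvidence {b c l : ℝ} (hb : 0 ≤ b) (hc : 0 < c) (hl : 0 < l) :
    poissonMean (logEvidence b c l) (c * l) = entropyDefect (c * l) + 1 / 2 * Real.log c
      + (c * l + 1 / 2) * Real.log ((c + b) / c) := by
  rw [logEvidence_fun_eq hb hc hl, poissonMean_sub ((tame_natCast.const_mul _).add (tame_const _))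
    tame_logGammaHalf, poissonMean_add (tame_natCast.const_mul _) (tame_const _),
    poissonMean_const_mul, poissonMean_natCast, poissonMean_const, entropyDefect]
  ring

/-- The log-ratio of the likelihood of `y` and its predictive mass given `x`. -/
noncomputable def logPredictiveRatio {d : ℕ} (b : ℝ) (r s lam : Fin d → ℝ) (x y : Fin d → ℕ) : ℝ :=
  ∑ i, (logEvidence b (r i + s i) (lam i) (x i + y i) - logEvidence b (r i) (lam i) (x i))

theorem poissonLaw_mul_exp_logPredictiveRatio {d : ℕ} {b : ℝ} (hb : 0 ≤ b) {r s lam : Fin d → ℝ}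
    (hr : ∀ i, 0 < r i) (hs : ∀ i, 0 < s i) (hl : ∀ i, 0 < lam i) (x y : Fin d → ℕ) :
    poissonLaw r lam {x} * ENNReal.ofReal (Real.exp (logPredictiveRatio b r s lam x y))
      = poissonLaw (r + s) lam {x + y} * ∏ i, ENNReal.ofReal
        (gammaMass b (r i) (x i) / gammaMass b (r i + s i) (x i + y i)) := by
  have hrs : ∀ i, 0 < r i + s i := fun i => add_pos (hr i) (hs i)
  rw [logPredictiveRatio, Real.exp_sum, ENNReal.ofReal_prod_of_nonneg fun i _ => (Real.exp_pos _).le,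
    poissonLaw_singleton_eq_prod fun i => (mul_pos (hr i) (hl i)).le,
    poissonLaw_singleton_eq_prod (c := r + s) fun i => (mul_pos (hrs i) (hl i)).le,
    ← Finset.prod_mul_distrib, ← Finset.prod_mul_distrib]
  refine Finset.prod_congr rfl fun i _ => ?_
  have h1 := poissonWeight_pos (mul_pos (hr i) (hl i)) (x i)
  have h2 := poissonWeight_pos (mul_pos (hrs i) (hl i)) (x i + y i)
  have h3 := gammaMass_pos hb (hr i) (x i)
  have h4 := gammaMass_pos hb (hrs i) (x i + y i)
  rw [Real.exp_sub, exp_logEvidence hb (hrs i) (hl i), exp_logEvidence hb (hr i) (hl i),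
    ← ENNReal.ofReal_mul h1.le]
  change _ = ENNReal.ofReal (poissonWeight (r i + s i) (lam i) (x i + y i)) * _
  rw [← ENNReal.ofReal_mul h2.le]
  congr 1
  field_simp

theorem integral_integral_logPredictiveRatio {d : ℕ} {b : ℝ} (hb : 0 ≤ b) {r s lam : Fin d → ℝ}
    (hr : ∀ i, 0 < r i) (hs : ∀ i, 0 < s i) (hl : ∀ i, 0 < lam i) :
    ∫ x, ∫ y, logPredictiveRatio b r s lam x y ∂(poissonLaw s lam) ∂(poissonLaw r lam)
      = ∑ i, (1 / 2 * Real.log ((r i + s i) / r i)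
        + (entropyDefect ((r i + s i) * lam i) - entropyDefect (r i * lam i))
        + (((r i + s i) * lam i + 1 / 2) * Real.log ((r i + s i + b) / (r i + s i))
          - (r i * lam i + 1 / 2) * Real.log ((r i + b) / r i))) := by
  have hrs : ∀ i, 0 < r i + s i := fun i => add_pos (hr i) (hs i)
  unfold logPredictiveRatio
  rw [integral_integral_sum_sub hr hs hl (fun i => tame_logEvidence hb (hrs i) (hl i))
    (fun i => tame_logEvidence hb (hr i) (hl i))]
  refine Finset.sum_congr rfl fun i _ => ?_
  rw [poissonMean_logEvidence hb (hrs i) (hl i), poissonMean_logEvidence hb (hr i) (hl i),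
    Real.log_div (hrs i).ne' (hr i).ne']
  ring

theorem integrable_logPredictiveRatio {d : ℕ} {b : ℝ} (hb : 0 ≤ b) {r s lam : Fin d → ℝ}
    (hr : ∀ i, 0 < r i) (hs : ∀ i, 0 < s i) (hl : ∀ i, 0 < lam i) (x : Fin d → ℕ) :
    Integrable (logPredictiveRatio b r s lam x) (poissonLaw s lam) :=
  integrable_sum_sub s lam (fun i => tame_logEvidence hb (add_pos (hr i) (hs i)) (hl i)) x

theorem integrable_integral_logPredictiveRatio {d : ℕ} {b : ℝ} (hb : 0 ≤ b)
    {r s lam : Fin d → ℝ} (hr : ∀ i, 0 < r i) (hs : ∀ i, 0 < s i) (hl : ∀ i, 0 < lam i) :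
    Integrable (fun x => ∫ y, logPredictiveRatio b r s lam x y ∂(poissonLaw s lam))
      (poissonLaw r lam) :=
  integrable_integral_sum_sub r s lam
    (fun i => tame_logEvidence hb (add_pos (hr i) (hs i)) (hl i))
    (fun i => tame_logEvidence hb (hr i) (hl i))

/-- For b = 0 the function `logPredictiveRatio` is the genuine log-likelihood ratio, and it splits
over coordinates into a function of x + y minus a function of x. -/
theorem klRisk_jeffreys {d : ℕ} {r s lam : Fin d → ℝ} (hr : ∀ i, 0 < r i) (hs : ∀ i, 0 < s i)
    (hl : ∀ i, 0 < lam i) :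
    klRisk r s (bayesPredictive r s (jeffreysPrior d)) lam
      = ENNReal.ofReal (∑ i, (1 / 2 * Real.log ((r i + s i) / r i)
        + (entropyDefect ((r i + s i) * lam i) - entropyDefect (r i * lam i)))) := by
  have hrs : ∀ i, 0 < (r + s) i := fun i => add_pos (hr i) (hs i)
  have hrs' : ∀ i, 0 < r i + s i := hrs
  have hpred : IsPredictive (bayesPredictive r s (jeffreysPrior d)) :=
    isPredictive_bayesPredictive (priorMarginal_jeffreysPrior_ne_zero hr)
      (priorMarginal_jeffreysPrior_ne_top hr)
  have hdens : ∀ x y, poissonLaw s lam {y} = ENNReal.ofReal (Real.exp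
      (logPredictiveRatio 0 r s lam x y)) * bayesPredictive r s (jeffreysPrior d) x {y} := by
    intro x y
    have h := poissonLaw_mul_exp_logPredictiveRatio le_rfl hr hs hl x y
    have hm := poissonLaw_mul hr hs (fun i => (hl i).le) x y
    have hP0 : poissonLaw r lam {x} ≠ 0 :=
      (poissonLaw_singleton_pos (fun i => mul_pos (hr i) (hl i)) x).ne'
    have hP1 : poissonLaw r lam {x} ≠ ∞ := measure_ne_top _ _
    have hJ : ∏ i, ENNReal.ofReal (gammaMass 0 (r i) (x i) / gammaMass 0 (r i + s i) (x i + y i))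
        = priorMarginal r (jeffreysPrior d) x / priorMarginal (r + s) (jeffreysPrior d) (x + y) := by
      rw [priorMarginal_jeffreysPrior hr, priorMarginal_jeffreysPrior hrs, div_eq_mul_inv,
        ENNReal.prod_inv_distrib fun i _ j _ _ => Or.inr ENNReal.ofReal_ne_top,
        ← Finset.prod_mul_distrib]
      refine Finset.prod_congr rfl fun i _ => ?_
      rw [gammaMass_zero (hr i), gammaMass_zero (hrs' i),
        ENNReal.ofReal_div_of_pos (jeffreysMass_pos (hrs' i) _), div_eq_mul_inv]
      rfl
    rw [bayesPredictive_singleton hr hs (ae_jeffreysPrior_pos d)]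
    refine (ENNReal.mul_right_inj hP0 hP1).1 ?_
    rw [← mul_assoc, h, hm, hJ]
    have a0 := priorMarginal_jeffreysPrior_ne_zero hr x
    have a1 := priorMarginal_jeffreysPrior_ne_top hr x
    have b0 := priorMarginal_jeffreysPrior_ne_zero hrs (x + y)
    have b1 := priorMarginal_jeffreysPrior_ne_top hrs (x + y)
    generalize priorMarginal r (jeffreysPrior d) x = a at *
    generalize priorMarginal (r + s) (jeffreysPrior d) (x + y) = c at *
    simp only [div_eq_mul_inv]
    calc splitProd r s x y * poissonLaw (r + s) lam {x + y}
        = splitProd r s x y * poissonLaw (r + s) lam {x + y} * (a * a⁻¹) * (c * c⁻¹) := by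
          rw [ENNReal.mul_inv_cancel a0 a1, ENNReal.mul_inv_cancel b0 b1, mul_one, mul_one]
      _ = _ := by ring
  have hkl : ∀ x, InformationTheory.klDiv (poissonLaw s lam)
      (bayesPredictive r s (jeffreysPrior d) x)
      = ENNReal.ofReal (∫ y, logPredictiveRatio 0 r s lam x y ∂(poissonLaw s lam)) ∧
        0 ≤ ∫ y, logPredictiveRatio 0 r s lam x y ∂(poissonLaw s lam) := fun x => by
    have := hpred x
    exact klDiv_eq_ofReal_integral _ _ (hdens x)
      (integrable_logPredictiveRatio le_rfl hr hs hl x)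
  unfold klRisk
  simp_rw [fun x => (hkl x).1]
  rw [← ofReal_integral_eq_lintegral_ofReal
    (integrable_integral_logPredictiveRatio le_rfl hr hs hl)
    (Filter.Eventually.of_forall fun x => (hkl x).2),
    integral_integral_logPredictiveRatio le_rfl hr hs hl]
  congr 1
  refine Finset.sum_congr rfl fun i _ => ?_
  rw [add_zero, add_zero, div_self (hr i).ne', div_self (hrs' i).ne']
  simp

theorem klRisk_jeffreys_lt {d : ℕ} (hd : 0 < d) {r s lam : Fin d → ℝ} (hr : ∀ i, 0 < r i)
    (hs : ∀ i, 0 < s i) (hl : ∀ i, 0 < lam i) :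
    klRisk r s (bayesPredictive r s (jeffreysPrior d)) lam
      < ENNReal.ofReal (1.04 * minimaxLowerBound r s) := by
  have : Nonempty (Fin d) := ⟨⟨0, hd⟩⟩
  have hlog : ∀ i, 0 < Real.log ((r i + s i) / r i) := fun i => Real.log_pos (by
    rw [lt_div_iff₀ (hr i)]; linarith [hs i])
  have hlt : ∑ i, (1 / 2 * Real.log ((r i + s i) / r i)
        + (entropyDefect ((r i + s i) * lam i) - entropyDefect (r i * lam i)))
      < 1.04 * minimaxLowerBound r s := by
    rw [minimaxLowerBound, Finset.mul_sum, Finset.mul_sum]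
    refine Finset.sum_lt_sum_of_nonempty Finset.univ_nonempty fun i _ => ?_
    have h1 := mul_pos (hr i) (hl i)
    have h2 : r i * lam i < (r i + s i) * lam i :=
      mul_lt_mul_of_pos_right (by linarith [hs i]) (hl i)
    have h3 := entropyDefect_sub_lt h1 h2
    rw [← Real.log_div (h1.trans h2).ne' h1.ne', mul_div_mul_right _ _ (hl i).ne'] at h3
    linarith
  rw [klRisk_jeffreys hr hs hl]
  refine (ENNReal.ofReal_lt_ofReal_iff ?_).2 hlt
  rw [minimaxLowerBound]
  have := Finset.sum_pos (fun i _ => hlog i) (Finset.univ_nonempty (α := Fin d))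
  positivity

/-! ### Gamma priors and the minimax lower bound -/

/-- The gamma distribution with shape `1 / 2` and rate `b`. -/
noncomputable def gammaPrior (b : ℝ) : Measure ℝ :=
  jeffreysMeasure.withDensity fun l => ENNReal.ofReal (Real.sqrt (b / Real.pi) * Real.exp (-(b * l)))

theorem lintegral_gammaPrior (b : ℝ) {φ : ℝ → ℝ≥0∞} (hφ : Measurable φ) :
    ∫⁻ l, φ l ∂(gammaPrior b) = ∫⁻ l, ENNReal.ofReal (Real.sqrt (b / Real.pi)
      * Real.exp (-(b * l))) * φ l ∂jeffreysMeasure :=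
  lintegral_withDensity_eq_lintegral_mul _ (by fun_prop) hφ

theorem lintegral_poissonWeight_gammaPrior {b c : ℝ} (hb : 0 < b) (hc : 0 < c) (k : ℕ) :
    ∫⁻ l, ENNReal.ofReal (poissonWeight c l k) ∂(gammaPrior b)
      = ENNReal.ofReal (Real.sqrt (b / Real.pi) * gammaMass b c k) := by
  have hcb : 0 < c + b := by positivity
  have e : ∀ l, ENNReal.ofReal (Real.sqrt (b / Real.pi) * Real.exp (-(b * l)))
      * ENNReal.ofReal (poissonWeight c l k) = ENNReal.ofReal (Real.sqrt (b / Real.pi)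
        * (c / (c + b)) ^ k) * ENNReal.ofReal (poissonWeight (c + b) l k) := fun l => by
    rw [← ENNReal.ofReal_mul (by positivity), ← ENNReal.ofReal_mul (by positivity)]
    congr 1
    have : Real.exp (-((c + b) * l)) = Real.exp (-(b * l)) * Real.exp (-(c * l)) := by
      rw [← Real.exp_add]; congr 1; ring
    rw [poissonWeight, poissonWeight, this, mul_pow, mul_pow, div_pow]
    field_simp
  rw [lintegral_gammaPrior b (continuous_poissonWeight c k).measurable.ennreal_ofReal]
  simp_rw [e]
  rw [lintegral_const_mul' _ _ ENNReal.ofReal_ne_top, lintegral_poissonWeight_jeffreysMeasure hcb,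
    ← ENNReal.ofReal_mul (by positivity)]
  congr 1
  have : 0 < Real.sqrt c := Real.sqrt_pos.2 hc
  have : 0 < Real.sqrt (c + b) := Real.sqrt_pos.2 hcb
  rw [gammaMass, jeffreysMass, jeffreysMass, Real.sqrt_div hc.le]
  field_simp

theorem lintegral_exp_gammaPrior {b c : ℝ} (hb : 0 < b) (hc : 0 ≤ c) :
    ∫⁻ l, ENNReal.ofReal (Real.exp (-(c * l))) ∂(gammaPrior b)
      = ENNReal.ofReal (Real.sqrt (b / (c + b))) := by
  have hcb : 0 < c + b := by positivity
  have e : ∀ l, ENNReal.ofReal (Real.sqrt (b / Real.pi) * Real.exp (-(b * l)))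
      * ENNReal.ofReal (Real.exp (-(c * l))) = ENNReal.ofReal (Real.sqrt (b / Real.pi))
        * ENNReal.ofReal (poissonWeight (c + b) l 0) := fun l => by
    rw [← ENNReal.ofReal_mul (by positivity), ← ENNReal.ofReal_mul (by positivity)]
    congr 1
    have : Real.exp (-((c + b) * l)) = Real.exp (-(b * l)) * Real.exp (-(c * l)) := by
      rw [← Real.exp_add]; congr 1; ring
    simp [poissonWeight, this, mul_assoc]
  rw [lintegral_gammaPrior b (by fun_prop)]
  simp_rw [e]
  rw [lintegral_const_mul' _ _ ENNReal.ofReal_ne_top, lintegral_poissonWeight_jeffreysMeasure hcb,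
    ← ENNReal.ofReal_mul (by positivity)]
  congr 1
  have hpi := Real.pi_pos
  have : 0 < Real.sqrt Real.pi := Real.sqrt_pos.2 hpi
  rw [jeffreysMass, Nat.cast_zero, zero_add, Real.Gamma_one_half_eq, Real.sqrt_div hb.le,
    Real.sqrt_div hb.le]
  simp
  field_simp

theorem lintegral_id_gammaPrior {b : ℝ} (hb : 0 < b) :
    ∫⁻ l, ENNReal.ofReal l ∂(gammaPrior b) = ENNReal.ofReal (1 / (2 * b)) := by
  have hpi := Real.pi_pos
  have hb' : 0 < Real.sqrt (b / Real.pi) := by positivity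
  have e : ∀ l, ENNReal.ofReal (Real.sqrt (b / Real.pi) * Real.exp (-(b * l)))
      * ENNReal.ofReal l = ENNReal.ofReal (Real.sqrt (b / Real.pi) / b)
        * ENNReal.ofReal (poissonWeight b l 1) := fun l => by
    rw [← ENNReal.ofReal_mul (by positivity), ← ENNReal.ofReal_mul (by positivity)]
    congr 1
    simp [poissonWeight]
    field_simp
  rw [lintegral_gammaPrior b (by fun_prop)]
  simp_rw [e]
  rw [lintegral_const_mul' _ _ ENNReal.ofReal_ne_top, lintegral_poissonWeight_jeffreysMeasure hb,
    ← ENNReal.ofReal_mul (by positivity)]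
  congr 1
  have : 0 < Real.sqrt Real.pi := Real.sqrt_pos.2 hpi
  have : 0 < Real.sqrt b := Real.sqrt_pos.2 hb
  rw [jeffreysMass, Nat.cast_one, add_comm, Real.Gamma_add_one (by norm_num),
    Real.Gamma_one_half_eq, Real.sqrt_div hb.le]
  simp
  field_simp

theorem isProbabilityMeasure_gammaPrior {b : ℝ} (hb : 0 < b) :
    IsProbabilityMeasure (gammaPrior b) := by
  have h := lintegral_exp_gammaPrior hb le_rfl
  constructor
  simpa [div_self hb.ne'] using h

theorem ae_gammaPrior_pos (b : ℝ) : ∀ᵐ l ∂(gammaPrior b), 0 < l := by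
  refine (withDensity_absolutelyContinuous _ _).ae_le ?_
  unfold jeffreysMeasure
  exact (withDensity_absolutelyContinuous _ _).ae_le (ae_restrict_mem measurableSet_Ioi)

theorem ae_pi_gammaPrior_pos (d : ℕ) {b : ℝ} (hb : 0 < b) :
    ∀ᵐ lam ∂(Measure.pi fun _ : Fin d => gammaPrior b), ∀ i, 0 < lam i := by
  have := isProbabilityMeasure_gammaPrior hb
  rw [ae_all_iff]
  exact fun i => (measurePreserving_eval (fun _ : Fin d => gammaPrior b) i).quasiMeasurePreserving.ae
    (ae_gammaPrior_pos b)

theorem priorMarginal_gammaPrior {d : ℕ} {b : ℝ} (hb : 0 < b) {c : Fin d → ℝ}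
    (hc : ∀ i, 0 < c i) (x : Fin d → ℕ) :
    priorMarginal c (Measure.pi fun _ => gammaPrior b) x
      = ∏ i, ENNReal.ofReal (Real.sqrt (b / Real.pi) * gammaMass b (c i) (x i)) := by
  have := isProbabilityMeasure_gammaPrior hb
  have e : priorMarginal c (Measure.pi fun _ => gammaPrior b) x
      = ∫⁻ lam, ∏ i, ENNReal.ofReal (poissonWeight (c i) (lam i) (x i))
        ∂(Measure.pi fun _ => gammaPrior b) := by
    refine lintegral_congr_ae ?_
    filter_upwards [ae_pi_gammaPrior_pos d hb] with lam h
    exact poissonLaw_singleton_eq_prod (fun i => (mul_pos (hc i) (h i)).le) x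
  rw [e, lintegral_pi_prod _ fun i =>
    (continuous_poissonWeight (c i) (x i)).measurable.ennreal_ofReal]
  exact Finset.prod_congr rfl fun i _ => lintegral_poissonWeight_gammaPrior hb (hc i) (x i)

theorem tsum_priorMarginal {d : ℕ} (c : Fin d → ℝ) (prior : Measure (Fin d → ℝ))
    [IsProbabilityMeasure prior] : ∑' x, priorMarginal c prior x = 1 := by
  unfold priorMarginal
  rw [← lintegral_tsum fun x => (measurable_poissonLaw_singleton c x).aemeasurable]
  simp [tsum_poissonLaw]

/-- Gibbs' inequality, averaged over the observation. -/
theorem ofReal_integral_logPredictiveRatio_le {d : ℕ} {b : ℝ} (hb : 0 ≤ b) {r s lam : Fin d → ℝ}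
    (hr : ∀ i, 0 < r i) (hs : ∀ i, 0 < s i) (hl : ∀ i, 0 < lam i)
    {q : (Fin d → ℕ) → Measure (Fin d → ℕ)} (hq : IsPredictive q) :
    ENNReal.ofReal (∫ x, ∫ y, logPredictiveRatio b r s lam x y ∂(poissonLaw s lam)
        ∂(poissonLaw r lam) + 1)
      ≤ klRisk r s q lam + ∑' x, ∑' y, poissonLaw (r + s) lam {x + y} *
        ((∏ i, ENNReal.ofReal (gammaMass b (r i) (x i) / gammaMass b (r i + s i) (x i + y i)))
          * q x {y}) := by
  have hint := integrable_integral_logPredictiveRatio hb hr hs hl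
  have e1 : ∫ x, ∫ y, logPredictiveRatio b r s lam x y ∂(poissonLaw s lam) ∂(poissonLaw r lam) + 1
      = ∫ x, (∫ y, logPredictiveRatio b r s lam x y ∂(poissonLaw s lam) + 1)
        ∂(poissonLaw r lam) := by
    rw [integral_add hint (integrable_const _)]
    simp
  have e2 : ∑' x, ∑' y, poissonLaw (r + s) lam {x + y} *
        ((∏ i, ENNReal.ofReal (gammaMass b (r i) (x i) / gammaMass b (r i + s i) (x i + y i)))
          * q x {y})
      = ∫⁻ x, ∫⁻ y, ENNReal.ofReal (Real.exp (logPredictiveRatio b r s lam x y)) ∂(q x)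
        ∂(poissonLaw r lam) := by
    rw [lintegral_countable']
    refine tsum_congr fun x => ?_
    rw [lintegral_countable', ← ENNReal.tsum_mul_right]
    refine tsum_congr fun y => ?_
    rw [← mul_assoc, ← poissonLaw_mul_exp_logPredictiveRatio hb hr hs hl]
    ring
  rw [e1, e2, klRisk, ← lintegral_add_right _ (measurable_of_countable _)]
  refine (ofReal_integral_le_lintegral_ofReal (hint.add (integrable_const _))).trans
    (lintegral_mono fun x => ?_)
  have := hq x
  exact ofReal_integral_add_one_le_klDiv_add _ _ (measurable_of_countable _)
    (integrable_logPredictiveRatio hb hr hs hl x)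

/-- The exponential term in Gibbs' inequality averages to exactly 1 for every q: integrating the
likelihood of x + y over the prior cancels the denominator, and what remains is the marginal of x
times q(y|x). -/
theorem lintegral_evidence_gammaPrior {d : ℕ} {b : ℝ} (hb : 0 < b) {r s : Fin d → ℝ}
    (hr : ∀ i, 0 < r i) (hs : ∀ i, 0 < s i)
    {q : (Fin d → ℕ) → Measure (Fin d → ℕ)} (hq : IsPredictive q) :
    ∫⁻ lam, ∑' x, ∑' y, poissonLaw (r + s) lam {x + y} *
        ((∏ i, ENNReal.ofReal (gammaMass b (r i) (x i) / gammaMass b (r i + s i) (x i + y i)))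
          * q x {y}) ∂(Measure.pi fun _ => gammaPrior b) = 1 := by
  have := isProbabilityMeasure_gammaPrior hb
  have hrs : ∀ i, 0 < (r + s) i := fun i => add_pos (hr i) (hs i)
  have hrs' : ∀ i, 0 < r i + s i := hrs
  have hm : ∀ x y, Measurable fun lam => poissonLaw (r + s) lam {x + y} *
      ((∏ i, ENNReal.ofReal (gammaMass b (r i) (x i) / gammaMass b (r i + s i) (x i + y i)))
        * q x {y}) := fun x y => (measurable_poissonLaw_singleton _ _).mul_const _
  rw [lintegral_tsum fun x => (Measurable.tsum fun y => hm x y).aemeasurable,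
    ← tsum_priorMarginal r (Measure.pi fun _ => gammaPrior b)]
  refine tsum_congr fun x => ?_
  rw [lintegral_tsum fun y => (hm x y).aemeasurable]
  have hqx := hq x
  have hone : ∑' y, q x {y} = 1 := by
    have := lintegral_countable' (μ := q x) (fun _ => (1 : ℝ≥0∞))
    simpa using this.symm
  rw [← mul_one (priorMarginal r _ x), ← hone, ← ENNReal.tsum_mul_left]
  refine tsum_congr fun y => ?_
  rw [lintegral_mul_const _ (measurable_poissonLaw_singleton _ _), ← mul_assoc]
  congr 1
  change priorMarginal (r + s) _ (x + y) * _ = _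
  rw [priorMarginal_gammaPrior hb hrs, priorMarginal_gammaPrior hb hr, ← Finset.prod_mul_distrib]
  refine Finset.prod_congr rfl fun i _ => ?_
  have h1 := gammaMass_pos hb.le (hrs' i) (x i + y i)
  simp only [Pi.add_apply]
  rw [← ENNReal.ofReal_mul (by positivity)]
  congr 1
  field_simp

/-- The two logarithmic corrections are both bl to first order in b and cancel; log t ≥ 1 - 1/t and
log t ≤ t - 1 bound what is left. -/
theorem half_log_le_expected_logPredictiveRatio {b r s l : ℝ} (hb : 0 < b) (hr : 0 < r)
    (hs : 0 < s) (hl : 0 < l) :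
    1 / 2 * Real.log ((r + s) / r) ≤ (1 / 2 * Real.log ((r + s) / r)
        + (entropyDefect ((r + s) * l) - entropyDefect (r * l))
        + (((r + s) * l + 1 / 2) * Real.log ((r + s + b) / (r + s))
          - (r * l + 1 / 2) * Real.log ((r + b) / r)))
      + (Real.log ((r + s) / r) * Real.exp (-(r * l)) + b ^ 2 / (r + s) * l + b / (2 * r)) := by
  have hrs : 0 < r + s := by positivity
  have h1 := entropyDefect_sub_ge (mul_pos hr hl)
    (mul_le_mul_of_nonneg_right (by linarith : r ≤ r + s) hl.le)
  rw [← Real.log_div (by positivity) (by positivity), mul_div_mul_right _ _ hl.ne'] at h1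
  have h2 := Real.one_sub_inv_le_log_of_pos (x := (r + s + b) / (r + s)) (by positivity)
  have h3 := Real.log_le_sub_one_of_pos (x := (r + b) / r) (by positivity)
  have h4 := mul_le_mul_of_nonneg_left h2 (show 0 ≤ (r + s) * l + 1 / 2 by positivity)
  have h5 := mul_le_mul_of_nonneg_left h3 (show 0 ≤ r * l + 1 / 2 by positivity)
  have e5 : (r * l + 1 / 2) * ((r + b) / r - 1) = b * l + b / (2 * r) := by
    field_simp; ring
  have e4 : b * l - b ^ 2 / (r + s) * l
      ≤ ((r + s) * l + 1 / 2) * (1 - ((r + s + b) / (r + s))⁻¹) := by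
    rw [inv_div]
    have h6 : 1 - (r + s) / (r + s + b) = b / (r + s + b) := by field_simp; ring
    have h7 : b - b ^ 2 / (r + s) ≤ (r + s) * (b / (r + s + b)) := by
      rw [← sub_nonneg]
      have : (r + s) * (b / (r + s + b)) - (b - b ^ 2 / (r + s))
          = b ^ 3 / ((r + s) * (r + s + b)) := by field_simp; ring
      rw [this]; positivity
    have h8 : 0 ≤ b / (r + s + b) := by positivity
    rw [h6]
    nlinarith [mul_le_mul_of_nonneg_right h7 hl.le]
  nlinarith

/-- The supremum dominates the prior average. The error terms average through E exp(-rλ) =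
√(b/(r+b)) and E λ = 1/(2b), so even b²λ contributes only order b. -/
theorem minimaxLowerBound_le_of_gammaPrior {d : ℕ} {b : ℝ} (hb : 0 < b) {r s : Fin d → ℝ}
    (hr : ∀ i, 0 < r i) (hs : ∀ i, 0 < s i)
    {q : (Fin d → ℕ) → Measure (Fin d → ℕ)} (hq : IsPredictive q) :
    ENNReal.ofReal (minimaxLowerBound r s + 1)
      ≤ (⨆ (lam : Fin d → ℝ) (_ : ∀ i, 0 < lam i), klRisk r s q lam) + 1
        + ENNReal.ofReal (∑ i, (Real.log ((r i + s i) / r i) * Real.sqrt (b / (r i + b))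
          + b / (2 * (r i + s i)) + b / (2 * r i))) := by
  have := isProbabilityMeasure_gammaPrior hb
  have hrs : ∀ i, 0 < r i + s i := fun i => add_pos (hr i) (hs i)
  have hlog : ∀ i, 0 ≤ Real.log ((r i + s i) / r i) := fun i => Real.log_nonneg (by
    rw [le_div_iff₀ (hr i)]; linarith [hs i])
  set π : Measure (Fin d → ℝ) := Measure.pi fun _ => gammaPrior b with hπ
  set S := ⨆ (lam : Fin d → ℝ) (_ : ∀ i, 0 < lam i), klRisk r s q lam with hS
  set T : (Fin d → ℝ) → ℝ≥0∞ := fun lam => ∑' x, ∑' y, poissonLaw (r + s) lam {x + y} *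
        ((∏ i, ENNReal.ofReal (gammaMass b (r i) (x i) / gammaMass b (r i + s i) (x i + y i)))
          * q x {y}) with hT
  set E : (Fin d → ℝ) → ℝ≥0∞ := fun lam => ∑ i,
    (ENNReal.ofReal (Real.log ((r i + s i) / r i)) * ENNReal.ofReal (Real.exp (-(r i * lam i)))
      + ENNReal.ofReal (b ^ 2 / (r i + s i)) * ENNReal.ofReal (lam i)
      + ENNReal.ofReal (b / (2 * r i))) with hE
  have heval : ∀ (i : Fin d) {φ : ℝ → ℝ≥0∞} (_ : Measurable φ),
      ∫⁻ lam, φ (lam i) ∂π = ∫⁻ l, φ l ∂(gammaPrior b) := fun i φ hφ =>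
    (measurePreserving_eval (fun _ : Fin d => gammaPrior b) i).lintegral_comp hφ
  have hEint : ∫⁻ lam, E lam ∂π = ENNReal.ofReal (∑ i, (Real.log ((r i + s i) / r i)
      * Real.sqrt (b / (r i + b)) + b / (2 * (r i + s i)) + b / (2 * r i))) := by
    have hnn : ∀ i, 0 ≤ Real.log ((r i + s i) / r i) * Real.sqrt (b / (r i + b)) := fun i =>
      mul_nonneg (hlog i) (Real.sqrt_nonneg _)
    have hr' := fun i => (hr i).le
    have hrs' := fun i => (hrs i).le
    rw [hE, lintegral_finsetSum _ fun i _ => by fun_prop,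
      ENNReal.ofReal_sum_of_nonneg fun i _ => by
        have := hnn i; have := hr i; have := hrs i; positivity]
    refine Finset.sum_congr rfl fun i _ => ?_
    have h1 := hr i
    have h2 := hrs i
    rw [lintegral_add_right _ (by fun_prop), lintegral_add_right _ (by fun_prop),
      lintegral_const_mul _ (by fun_prop), lintegral_const_mul _ (by fun_prop),
      heval i (φ := fun l => ENNReal.ofReal (Real.exp (-(r i * l)))) (by fun_prop),
      heval i (φ := fun l => ENNReal.ofReal l) (by fun_prop),
      lintegral_exp_gammaPrior hb (hr i).le, lintegral_id_gammaPrior hb, lintegral_const,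
      measure_univ, mul_one, ← ENNReal.ofReal_mul (hlog i), ← ENNReal.ofReal_mul (by positivity),
      ← ENNReal.ofReal_add (hnn i) (by positivity),
      ← ENNReal.ofReal_add (add_nonneg (hnn i) (by positivity)) (by positivity)]
    congr 3
    field_simp
  have hpt : ∀ᵐ lam ∂π, ENNReal.ofReal (minimaxLowerBound r s + 1) ≤ S + T lam + E lam := by
    filter_upwards [ae_pi_gammaPrior_pos d hb] with lam hl
    have h1 := ofReal_integral_logPredictiveRatio_le hb.le hr hs hl hq
    have h2 : klRisk r s q lam ≤ S := le_iSup₂ (f := fun (lam : Fin d → ℝ)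
      (_ : ∀ i, 0 < lam i) => klRisk r s q lam) lam hl
    have h3 : minimaxLowerBound r s + 1
        ≤ (∫ x, ∫ y, logPredictiveRatio b r s lam x y ∂(poissonLaw s lam) ∂(poissonLaw r lam) + 1)
        + ∑ i, (Real.log ((r i + s i) / r i) * Real.exp (-(r i * lam i))
          + b ^ 2 / (r i + s i) * lam i + b / (2 * r i)) := by
      rw [integral_integral_logPredictiveRatio hb.le hr hs hl, minimaxLowerBound, Finset.mul_sum,
        add_right_comm, ← Finset.sum_add_distrib]
      gcongr with i
      exact half_log_le_expected_logPredictiveRatio hb (hr i) (hs i) (hl i)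
    refine (ENNReal.ofReal_le_ofReal h3).trans (ENNReal.ofReal_add_le.trans ?_)
    refine add_le_add (h1.trans (add_le_add_left h2 _)) ?_
    refine (ENNReal.ofReal_sum_of_nonneg fun i _ => ?_).le.trans (Finset.sum_le_sum fun i _ => ?_)
    · have := hlog i; have := hr i; have := hrs i; have := hl i; positivity
    · have := hrs i
      rw [← ENNReal.ofReal_mul (hlog i), ← ENNReal.ofReal_mul (by positivity)]
      exact ENNReal.ofReal_add_le.trans (add_le_add_left ENNReal.ofReal_add_le _)
  have hEm : Measurable E := by
    rw [hE]; fun_prop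
  have hTm : Measurable T := Measurable.tsum fun x => Measurable.tsum fun y =>
    (measurable_poissonLaw_singleton _ _).mul_const _
  calc ENNReal.ofReal (minimaxLowerBound r s + 1)
      = ∫⁻ _, ENNReal.ofReal (minimaxLowerBound r s + 1) ∂π := by simp
    _ ≤ ∫⁻ lam, (S + T lam + E lam) ∂π := lintegral_mono_ae hpt
    _ = _ := by
      rw [lintegral_add_right _ hEm, lintegral_add_right _ hTm, hEint,
        lintegral_evidence_gammaPrior hb hr hs hq]
      simp

theorem ofReal_minimaxLowerBound_le_minimaxRisk {d : ℕ} {r s : Fin d → ℝ} (hr : ∀ i, 0 < r i)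
    (hs : ∀ i, 0 < s i) : ENNReal.ofReal (minimaxLowerBound r s) ≤ minimaxRisk r s := by
  refine le_iInf₂ fun q hq => ?_
  set S := ⨆ (lam : Fin d → ℝ) (_ : ∀ i, 0 < lam i), klRisk r s q lam
  have hlog : ∀ i, 0 ≤ Real.log ((r i + s i) / r i) := fun i => Real.log_nonneg (by
    rw [le_div_iff₀ (hr i)]; linarith [hs i])
  have hB : 0 ≤ minimaxLowerBound r s :=
    mul_nonneg (by norm_num) (Finset.sum_nonneg fun i _ => hlog i)
  have hlim : Filter.Tendsto (fun b : ℝ => S + 1 + ENNReal.ofReal (∑ i,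
      (Real.log ((r i + s i) / r i) * Real.sqrt (b / (r i + b))
        + b / (2 * (r i + s i)) + b / (2 * r i)))) (nhdsWithin 0 (Set.Ioi 0)) (nhds (S + 1 + 0)) := by
    refine Filter.Tendsto.const_add _ ?_
    have hc : ContinuousAt (fun b : ℝ => ENNReal.ofReal (∑ i,
        (Real.log ((r i + s i) / r i) * Real.sqrt (b / (r i + b))
          + b / (2 * (r i + s i)) + b / (2 * r i)))) 0 := by
      refine ENNReal.continuous_ofReal.continuousAt.comp (tendsto_finsetSum _ fun i _ => ?_)
      have h : ContinuousAt (fun b : ℝ => b / (r i + b)) 0 :=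
        continuousAt_id.div (by fun_prop) (by simpa using (hr i).ne')
      exact ((h.sqrt.const_mul _).add (by fun_prop)).add (by fun_prop)
    simpa [ContinuousAt] using hc.tendsto.mono_left nhdsWithin_le_nhds
  -- Let b → 0: the proper gamma priors, suitably rescaled, approach the Jeffreys prior and the
  -- error disappears.
  have h := ge_of_tendsto hlim (by
    filter_upwards [self_mem_nhdsWithin] with b hb
    exact minimaxLowerBound_le_of_gammaPrior hb hr hs hq)
  rw [add_zero, ENNReal.ofReal_add hB zero_le_one, ENNReal.ofReal_one] at h
  exact (ENNReal.add_le_add_iff_right ENNReal.one_ne_top).1 h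

/-! ### Assembly, and the reduction for equal durations -/

theorem durationScale_pos {d : ℕ} {r s : Fin d → ℝ} (hr : ∀ i, 0 < r i) (hs : ∀ i, 0 < s i)
    (i : Fin d) : 0 < durationScale r s i := by
  rw [durationScale, sub_pos]
  exact one_div_lt_one_div_of_lt (hr i) (by linarith [hs i])

theorem prod_ofReal_sqrt_ne_zero {d : ℕ} {γ : Fin d → ℝ} (hγ : ∀ i, 0 < γ i) :
    ∏ i, ENNReal.ofReal (Real.sqrt (γ i)) ≠ 0 :=
  (CanonicallyOrderedAdd.prod_pos.2 fun i _ =>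
    ENNReal.ofReal_pos.2 (Real.sqrt_pos.2 (hγ i))).ne'

theorem prod_ofReal_sqrt_ne_top {d : ℕ} (γ : Fin d → ℝ) :
    ∏ i, ENNReal.ofReal (Real.sqrt (γ i)) ≠ ∞ :=
  ENNReal.prod_ne_top fun _ _ => ENNReal.ofReal_ne_top

theorem priorMarginal_priorOf_ne_zero {d : ℕ} {γ c : Fin d → ℝ} (hγ : ∀ i, 0 < γ i)
    (hc : ∀ i, 0 < c i) {α : ℝ} (hα : 0 < α) (η : Fin d → ℝ) (x : Fin d → ℕ) :
    priorMarginal c (priorOf γ (pointShrinkage η α)) x ≠ 0 := by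
  rw [priorMarginal_priorOf hγ hc]
  refine mul_ne_zero (prod_ofReal_sqrt_ne_zero hγ) fun h => ?_
  exact rieszMarginal_ne_zero hγ hc hα _ x (Finset.sum_eq_zero_iff.1 h 1 (Finset.mem_univ _))

theorem priorMarginal_priorOf_ne_top {d : ℕ} {γ c : Fin d → ℝ} (hγ : ∀ i, 0 < γ i)
    (hc : ∀ i, 0 < c i) {α : ℝ} (hα : 0 < α) (hαd : α ≤ ((d : ℝ) - 2) / 2) (η : Fin d → ℝ)
    (x : Fin d → ℕ) : priorMarginal c (priorOf γ (pointShrinkage η α)) x ≠ ∞ := by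
  rw [priorMarginal_priorOf hγ hc]
  exact ENNReal.mul_ne_top (prod_ofReal_sqrt_ne_top γ)
    (ENNReal.sum_ne_top.2 fun a _ => rieszMarginal_ne_top hγ hc hα hαd _ x)

/-- The inequality is linear in the numerator prior, so it follows by summing over the reflected
centres. -/
theorem sum_splitProd_priorMarginal_lt {d : ℕ} {r s : Fin d → ℝ} (hr : ∀ i, 0 < r i)
    (hs : ∀ i, 0 < s i) {α : ℝ} (hα : 0 < α) (hαd : α ≤ ((d : ℝ) - 2) / 2) (η : Fin d → ℝ)
    (z : Fin d → ℕ) :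
    ∑ p ∈ Fintype.piFinset (fun i => Finset.HasAntidiagonal.antidiagonal (z i)),
      splitProd r s (fun i => (p i).1) (fun i => (p i).2) *
        (priorMarginal r (priorOf (durationScale r s) (pointShrinkage η α)) (fun i => (p i).1)
          / priorMarginal r (jeffreysPrior d) (fun i => (p i).1))
      < priorMarginal (r + s) (priorOf (durationScale r s) (pointShrinkage η α)) z
        / priorMarginal (r + s) (jeffreysPrior d) z := by
  have hrs : ∀ i, 0 < (r + s) i := fun i => add_pos (hr i) (hs i)
  have hγ := durationScale_pos hr hs
  simp_rw [priorMarginal_priorOf hγ hr, priorMarginal_priorOf hγ hrs, mul_div_assoc,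
    mul_left_comm _ (∏ i, ENNReal.ofReal (Real.sqrt (durationScale r s i)))]
  rw [← Finset.mul_sum]
  refine (ENNReal.mul_lt_mul_iff_right (prod_ofReal_sqrt_ne_zero hγ)
    (prod_ofReal_sqrt_ne_top _)).2 ?_
  simp_rw [div_eq_mul_inv, Finset.sum_mul, Finset.mul_sum]
  rw [Finset.sum_comm]
  refine ENNReal.sum_lt_sum_of_nonempty Finset.univ_nonempty fun a _ => ?_
  exact sum_splitProd_rieszMarginal_lt hr hs hα hαd (fun i => ((a i : ℤ) : ℝ) * η i) z

theorem bayesPredictive_smul {d : ℕ} (r s : Fin d → ℝ) (prior : Measure (Fin d → ℝ)) {K : ℝ≥0∞}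
    (h0 : K ≠ 0) (h1 : K ≠ ∞) : bayesPredictive r s (K • prior) = bayesPredictive r s prior := by
  funext x
  unfold bayesPredictive
  congr 1
  funext y
  rw [lintegral_smul_measure, lintegral_smul_measure, smul_eq_mul, smul_eq_mul,
    ENNReal.mul_div_mul_left _ _ h0 h1]

theorem pointShrinkage_smul {d : ℕ} {κ : ℝ} (hκ : 0 < κ) (η : Fin d → ℝ) (α : ℝ) (θ : Fin d → ℝ) :
    pointShrinkage η α (fun i => κ * θ i)
      = ENNReal.ofReal (κ ^ 2) ^ (-α) * pointShrinkage (fun i => η i / κ) α θ := by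
  unfold pointShrinkage
  rw [Finset.mul_sum]
  refine Finset.sum_congr rfl fun a _ => ?_
  rw [← ENNReal.mul_rpow_of_ne_top ENNReal.ofReal_ne_top ENNReal.ofReal_ne_top,
    ← ENNReal.ofReal_mul (by positivity), Finset.mul_sum]
  congr 2
  refine Finset.sum_congr rfl fun i _ => ?_
  rw [← mul_pow]
  congr 1
  field_simp

/-- By homogeneity of f, a common rescaling of θ only moves the centre η and multiplies the prior by
a constant, which cancels in the predictive distribution. -/
theorem bayesPredictive_priorOf_const {d : ℕ} (r s : Fin d → ℝ) {κ : ℝ} (hκ : 0 < κ)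
    (η : Fin d → ℝ) (α : ℝ) :
    bayesPredictive r s (priorOf (fun _ => 1) (pointShrinkage η α))
      = bayesPredictive r s (priorOf (fun _ => κ ^ 2) (pointShrinkage (fun i => η i / κ) α)) := by
  have hK : ENNReal.ofReal (κ ^ 2) ≠ 0 := (ENNReal.ofReal_pos.2 (by positivity)).ne'
  have h1 : ENNReal.ofReal (κ ^ 2) ^ (-α) ≠ ∞ :=
    ENNReal.rpow_ne_top_of_ne_zero hK ENNReal.ofReal_ne_top
  have h0 : ENNReal.ofReal (κ ^ 2) ^ (-α) ≠ 0 :=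
    (ENNReal.rpow_pos (pos_iff_ne_zero.2 hK) ENNReal.ofReal_ne_top).ne'
  rw [← bayesPredictive_smul r s (priorOf (fun _ => κ ^ 2) _) h0 h1]
  congr 1
  unfold priorOf
  rw [← withDensity_smul' _ _ h1]
  congr 1
  funext lam
  rw [Pi.smul_apply, smul_eq_mul, ← pointShrinkage_smul hκ]
  congr 1
  funext i
  rw [div_one, Real.sqrt_div' _ (by positivity), Real.sqrt_sq hκ.le, mul_div_cancel₀ _ hκ.ne']

theorem mainTheorem7 (d : ℕ) (α : ℝ) (hα : 0 < α) (hαd : α ≤ ((d : ℝ) - 2) / 2)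
    (η : Fin d → ℝ) :
    -- arbitrary durations, with the coordinates `θ i = √(lam i / γ i)`
    (∀ r s : Fin d → ℝ, (∀ i, 0 < r i) → (∀ i, 0 < s i) →
      IsPredictive (bayesPredictive r s (jeffreysPrior d)) ∧
      IsPredictive (bayesPredictive r s (priorOf (durationScale r s) (pointShrinkage η α))) ∧
      Dominates r s (bayesPredictive r s (priorOf (durationScale r s) (pointShrinkage η α)))
        (bayesPredictive r s (jeffreysPrior d)) ∧
      NearlyMinimax r s
        (bayesPredictive r s (priorOf (durationScale r s) (pointShrinkage η α))) ∧
      ENNReal.ofReal (minimaxLowerBound r s) ≤ minimaxRisk r s) ∧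
    -- equal durations, with the coordinates `θ i = √(lam i)`
    (∀ r s : Fin d → ℝ, (∀ i, 0 < r i) → (∀ i, 0 < s i) →
      (∀ i j, r i = r j) → (∀ i j, s i = s j) →
      IsPredictive (bayesPredictive r s (jeffreysPrior d)) ∧
      IsPredictive (bayesPredictive r s (priorOf (fun _ => 1) (pointShrinkage η α))) ∧
      Dominates r s (bayesPredictive r s (priorOf (fun _ => 1) (pointShrinkage η α)))
        (bayesPredictive r s (jeffreysPrior d)) ∧
      NearlyMinimax r s (bayesPredictive r s (priorOf (fun _ => 1) (pointShrinkage η α))) ∧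
      ENNReal.ofReal (minimaxLowerBound r s) ≤ minimaxRisk r s) := by
  have hd : 0 < d := by
    rcases Nat.eq_zero_or_pos d with h | h
    · subst h; norm_num at hαd; linarith
    · exact h
  have main : ∀ (η : Fin d → ℝ) (r s : Fin d → ℝ), (∀ i, 0 < r i) → (∀ i, 0 < s i) →
      IsPredictive (bayesPredictive r s (jeffreysPrior d)) ∧
      IsPredictive (bayesPredictive r s (priorOf (durationScale r s) (pointShrinkage η α))) ∧
      Dominates r s (bayesPredictive r s (priorOf (durationScale r s) (pointShrinkage η α)))
        (bayesPredictive r s (jeffreysPrior d)) ∧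
      NearlyMinimax r s
        (bayesPredictive r s (priorOf (durationScale r s) (pointShrinkage η α))) ∧
      ENNReal.ofReal (minimaxLowerBound r s) ≤ minimaxRisk r s := by
    intro η r s hr hs
    have hγ := durationScale_pos hr hs
    have hlt : ∀ lam : Fin d → ℝ, (∀ i, 0 < lam i) →
        klRisk r s (bayesPredictive r s (priorOf (durationScale r s) (pointShrinkage η α))) lam
          < klRisk r s (bayesPredictive r s (jeffreysPrior d)) lam := fun lam hl =>
      klRisk_lt_of_marginal_ratio hr hs (ae_jeffreysPrior_pos d) (ae_priorOf_pos _ _)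
        (fun _ hc => priorMarginal_jeffreysPrior_ne_zero hc)
        (fun _ hc => priorMarginal_jeffreysPrior_ne_top hc)
        (fun _ hc => priorMarginal_priorOf_ne_zero hγ hc hα η)
        (fun _ hc => priorMarginal_priorOf_ne_top hγ hc hα hαd η)
        (sum_splitProd_priorMarginal_lt hr hs hα hαd η) hl
        (klRisk_jeffreys_lt hd hr hs hl).ne_top
    exact ⟨isPredictive_bayesPredictive (priorMarginal_jeffreysPrior_ne_zero hr)
        (priorMarginal_jeffreysPrior_ne_top hr),
      isPredictive_bayesPredictive (priorMarginal_priorOf_ne_zero hγ hr hα η)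
        (priorMarginal_priorOf_ne_top hγ hr hα hαd η),
      ⟨fun lam hl => (hlt lam hl).le, fun _ => 1, fun _ => one_pos, hlt _ fun _ => one_pos⟩,
      fun lam hl => (hlt lam hl).trans (klRisk_jeffreys_lt hd hr hs hl),
      ofReal_minimaxLowerBound_le_minimaxRisk hr hs⟩
  refine ⟨main η, fun r s hr hs hr' hs' => ?_⟩
  have hγ := durationScale_pos hr hs
  -- For equal durations γ is the same in every coordinate, so κ = √γ reduces this case to the first
  -- one with centre η/κ.
  have hκ : 0 < Real.sqrt (durationScale r s ⟨0, hd⟩) := Real.sqrt_pos.2 (hγ _)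
  have e : (fun _ => Real.sqrt (durationScale r s ⟨0, hd⟩) ^ 2) = durationScale r s := by
    funext i
    rw [Real.sq_sqrt (hγ _).le]
    simp only [durationScale]
    rw [hr' i ⟨0, hd⟩, hs' i ⟨0, hd⟩]
  rw [bayesPredictive_priorOf_const r s hκ, e]
  exact main _ r s hr hs
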